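/- **Setting.** Let $L$ be even. *First-level Bethe numbers* are $N$ pairwise distinct numbers $I_1,\dots,I_N\in(-\tfrac L2,\tfrac L2]$, integers if $N$ is odd and half-integers if $N$ is even. The spin $s=-1$ Bethe equations with imaginary extensive twist $\varphi\ge 0$ are, for pairwise distinct $\lambda_1,\dots,\lambda_N\in\mathbb C$, $$\Big(\frac{\lambda_k-i}{\lambda_k+i}\Big)^L=e^{-2\varphi L}\prod_{l\ne k}\frac{\lambda_k-\lambda_l+i}{\lambda_k-\lambda_l-i},\qquad \frac1\pi\arctan\lambda_k=\frac{I_k}{L}+\frac{i\varphi}{\pi}-\frac1{\pi L}\sum_{l=1}^N\arctan(\lambda_k-\lambda_l),$$ where $\arctan(\lambda_k-\lambda_l)$ is the principal value and $\arctan\lambda_k$ is the determination fixed by the equation. The energy per site is $\frac1L\sum_k\frac{2}{\lambda_k^2+1}$. For first-level Bethe numbers we consider the branch of solutions, continuous in $\varphi\in[\varphi_0,\infty)$, all of whose roots converge to $i$ as $\varphi\to\infty$. A *first-level filling function* at density $m>0$ is a measurable $\chi_m$ on $[-\frac{1+m}2,\frac{1+m}2]$ with $0\le\chi_m\le1$,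 $\int\chi_m=m$ and $\chi_m(x)=0$ for $\frac12<|x|<\frac{1+m}2$. A sequence of first-level Bethe numbers with $L\to\infty$ and $N/L\to m$ *has filling function* $\chi_m$ if $\frac1L\#\{k: a<I_k/L<b\}\to\int_a^b\chi_m$ for all $-\frac{1+m}2\le a<b\le\frac{1+m}2$. Its moments are $X_a(\chi_m)=\int_{-(1+m)/2}^{(1+m)/2}e^{2i\pi ax}\chi_m(x)\,dx$, $a\in\mathbb Z$. For a double sequence $(c_{ab})_{a,b\ge0}$ put $c^{[k]}_{ab}=\sum c_{a_1b_1}\cdots c_{a_kb_k}$ over $a_1+\dots+a_k=a$, $b_1+\dots+b_k=b$ (so $c^{[0]}_{ab}$ is $1$ at $(0,0)$ and $0$ elsewhere), $\tilde c_{00}=0$, $\tilde c_{ab}=c_{a+1,b+1}/c_{11}$ for $(a,b)\neq(0,0)$, and define $\tilde c^{[k]}$ likewise. Given $X=(X_a)_{a\in\mathbb Z}$, consider the conditions $c_{0b}=c_{a0}=0$, $c_{11}=-2i$ and, for all $a,b\ge0$, $$\frac{\tilde c_{ab}}{2i\pi}=-\sum_{n\ge0}\sum_{q=0}^n\sum_{a_2\ge0}\sum_{b_1+b_2=b}\frac{\arctan^{(n)}(0)}{n!\,\pi}\binom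 nq(-1)^{n-q}c^{[q]}_{ab_1}c^{[n-q]}_{a_2b_2}X_{a_2}+\sum_{n\ge1}\frac{(-1)^{n+1}}{n(2i)^{n+1}\pi}c^{[n]}_{ab}+\frac1{2i\pi}\sum_{n\ge2}\frac{(-1)^n}{n}\tilde c^{[n]}_{ab},$$ all sums having finitely many non-zero terms. For integers $b\ge-1$ put $$f_b=\sum_{n\ge0}\sum_{a\ge-1}X_a\Big(\frac{(-1)^n}{ic_{11}}\tilde c^{[n]}_{a+1,b+1}+\frac{c^{[n]}_{ab}}{2(-2i)^n}\Big)$$ (terms with a negative index on $c^{[n]}$ are zero). **Theorem 1.** 1. For every $X=(X_a)_{a\in\mathbb Z}$ in $\mathbb C$ these conditions have exactly one solution $(c_{ab})$; it has $c_{11}=-2i$ and $c_{ab}=0$ for $a>b$. For every $b\ge-1$ there is a universal polynomial $P_b$ with rational coefficients such that $f_b=P_b(X_{-1},\dots,X_{b+1})$ for all $X$. 2. Let $m>0$, let $\chi_m$ be a first-level filling function, and let $c_{ab}$ and $f_b(\chi_m)$ be obtained from $X_a=X_a(\chi_m)$. For every sequence of first-level Bethe numbers with filling function $\chi_m$ and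 every $a\in\mathbb Z$, $X_a(\chi_m)=\lim_{L\to\infty}\frac1L\sum_k e^{2i\pi aI_k/L}$. Moreover there is $\varphi_0\ge0$ such that: - for all first-level Bethe numbers, in every even size $L>0$, there is exactly one continuous branch of solutions on $[\varphi_0,\infty)$ all of whose roots converge to $i$ as $\varphi\to\infty$; - for $\varphi\ge\varphi_0$ the series $\sum_{a,b}e^{-2b\varphi}|c_{ab}|$ converges, and along every sequence of first-level Bethe numbers with filling function $\chi_m$ the roots of this branch satisfy $\max_k\big|\lambda_k-i-\sum_{a,b}e^{-2b\varphi}e^{2i\pi aI_k/L}c_{ab}\big|\to0$; - for $\varphi\ge\varphi_0$ the energy per site of this branch has, along every such sequence, the same thermodynamic limit $F_{\chi_m}(\varphi)$, and $$F_{\chi_m}(\varphi)=\sum_{b\ge-1}e^{-2b\varphi}f_b(\chi_m),$$ the series being (unconditionally) convergent. -/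

import Mathlib

open Filter Topology

noncomputable section

namespace TwistedBethe

/-! ### Finite size: the Bethe equations with an imaginary extensive twist -/

/-- `I` is an admissible family of `N` first-level Bethe numbers for the (even) size `L`: pairwise
distinct, integers if `N` is odd, half-integers if `N` is even, all of them in `(-L/2, L/2]`. -/
structure IsFirstLevelBetheNumbers (L N : ℕ) (I : Fin N → ℝ) : Prop where
  size_pos : 0 < L
  size_even : Even L
  integer_of_odd : Odd N → ∀ k, ∃ n : ℤ, I k = n
  half_integer_of_even : Even N → ∀ k, ∃ n : ℤ, I k = n + 1 / 2
  injective : Function.Injective I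
  range : ∀ k, -(L : ℝ) / 2 < I k ∧ I k ≤ (L : ℝ) / 2

/-- `lam` is a solution of the spin `s = -1` Bethe equations in size `L` with `N` roots and twist
`φ`, its `k`-th root having the Bethe number `I k`. The roots are distinct, they solve the equations
in product form (all denominators being non-zero), and they solve the logarithmic equations
`(1/π) arctan λ_k = I_k / L + i φ / π - (1/(π L)) ∑_l arctan (λ_k - λ_l)`.
The arctangent on the right is the principal one. On the left, `θ` is the determination of the
multivalued `arctan λ_k` (that is, `tan θ = λ_k`, written without division) which is selected by the
right-hand side. -/
structure IsBetheSolution (L N : ℕ) (I : Fin N → ℝ) (φ : ℝ) (lam : Fin N → ℂ) : Prop where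
  injective : Function.Injective lam
  ne_pole : ∀ k, lam k ≠ -Complex.I
  sub_ne_pole : ∀ k l, lam k - lam l ≠ Complex.I
  product_form : ∀ k,
    ((lam k - Complex.I) / (lam k + Complex.I)) ^ L =
      (Real.exp (-2 * φ * L) : ℂ) *
        ∏ l ∈ Finset.univ.erase k,
          (lam k - lam l + Complex.I) / (lam k - lam l - Complex.I)
  log_form : ∀ k, ∃ θ : ℂ, Complex.sin θ = lam k * Complex.cos θ ∧
    1 / (Real.pi : ℂ) * θ = (I k : ℂ) / L + Complex.I * φ / Real.pi
      - 1 / ((Real.pi : ℂ) * L) * ∑ l, Complex.arctan (lam k - lam l)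

/-- A branch of solutions with fixed Bethe numbers, continuous in the twist `φ ∈ [φ₀, ∞)`, all of
whose roots converge to `i` when `φ → ∞`. -/
structure IsTwistBranch (L N : ℕ) (I : Fin N → ℝ) (φ₀ : ℝ) (lam : ℝ → Fin N → ℂ) : Prop where
  continuousOn : ContinuousOn lam (Set.Ici φ₀)
  solution : ∀ φ, φ₀ ≤ φ → IsBetheSolution L N I φ (lam φ)
  tendsto_I : ∀ k, Tendsto (fun φ => lam φ k) atTop (𝓝 Complex.I)

/-- The energy per site `(1/L) ∑_k 2 / (λ_k² + 1)`. -/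
def energyPerSite (L N : ℕ) (lam : Fin N → ℂ) : ℂ :=
  1 / (L : ℂ) * ∑ k, 2 / (lam k ^ 2 + 1)

/-! ### Thermodynamic limit: filling functions and moments -/

/-- `χ` is a filling function at density `m` (on `[-(1+m)/2, (1+m)/2]`) of the first level. Only the
values of `χ` on this interval are meaningful. -/
structure IsFirstLevelFilling (m : ℝ) (χ : ℝ → ℝ) : Prop where
  measurable : Measurable χ
  bounds : ∀ x ∈ Set.Icc (-((1 + m) / 2)) ((1 + m) / 2), 0 ≤ χ x ∧ χ x ≤ 1
  integral_eq : ∫ x in (-((1 + m) / 2))..((1 + m) / 2), χ x = m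
  first_level : ∀ x, 1 / 2 < |x| → |x| < (1 + m) / 2 → χ x = 0

/-- The sequence of Bethe number configurations `I j` (in sizes `L j`, with `N j` roots) has density
`m` and filling function `χ` in the thermodynamic limit: `L → ∞`, `N / L → m`, and the proportion
(relative to `L`) of Bethe numbers with `a < I / L < b` tends to `∫_a^b χ`. -/
structure HasFilling (m : ℝ) (χ : ℝ → ℝ) (L N : ℕ → ℕ) (I : ∀ j, Fin (N j) → ℝ) : Prop where
  firstLevel : ∀ j, IsFirstLevelBetheNumbers (L j) (N j) (I j)
  size_tendsto : Tendsto L atTop atTop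
  density_tendsto : Tendsto (fun j => (N j : ℝ) / L j) atTop (𝓝 m)
  count_tendsto : ∀ a b : ℝ, -((1 + m) / 2) ≤ a → a < b → b ≤ (1 + m) / 2 →
    Tendsto (fun j => (Nat.card {k : Fin (N j) // a < I j k / L j ∧ I j k / L j < b} : ℝ) / L j)
      atTop (𝓝 (∫ x in a..b, χ x))

/-- The Fourier moments `X_a(χ) = ∫ e^{2 i π a x} χ(x) dx`, `a ∈ ℤ`. -/
def moment (m : ℝ) (χ : ℝ → ℝ) (a : ℤ) : ℂ :=
  ∫ x in (-((1 + m) / 2))..((1 + m) / 2),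
    Complex.exp (2 * Complex.I * Real.pi * a * x) * (χ x : ℂ)

/-! ### The recursion -/

/-- `convPow c k a b = ∑ c_{a₁ b₁} ⋯ c_{a_k b_k}` over all `a₁ + ⋯ + a_k = a`, `b₁ + ⋯ + b_k = b`
(natural numbers); for `k = 0` it is `1` at `(0, 0)` and `0` elsewhere. -/
def convPow (c : ℕ → ℕ → ℂ) : ℕ → ℕ → ℕ → ℂ
  | 0, a, b => if a = 0 ∧ b = 0 then 1 else 0
  | k + 1, a, b => ∑ p ∈ Finset.HasAntidiagonal.antidiagonal a, ∑ r ∈ Finset.HasAntidiagonal.antidiagonal b,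
      c p.1 r.1 * convPow c k p.2 r.2

/-- `c̃_{ab} = c_{a+1,b+1} / c_{11}` for `(a, b) ≠ (0, 0)`, and `c̃_{00} = 0`. -/
def ctilde (c : ℕ → ℕ → ℂ) (a b : ℕ) : ℂ :=
  if a = 0 ∧ b = 0 then 0 else c (a + 1) (b + 1) / c 1 1

/-- The recursion that determines the root-expansion coefficients `c_{ab}` from the moments `X`.
The sums over `n` and `a₂` are over all natural numbers (`n ≥ 1` and `n ≥ 2` in the last two lines)
and have finite support. -/
structure IsRootExpansion (X : ℤ → ℂ) (c : ℕ → ℕ → ℂ) : Prop where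
  zero_left : ∀ b, c 0 b = 0
  zero_right : ∀ a, c a 0 = 0
  one_one : c 1 1 = -2 * Complex.I
  recursion : ∀ a b : ℕ,
    ctilde c a b / (2 * Complex.I * Real.pi) =
      - (∑ᶠ n : ℕ, ∑ q ∈ Finset.range (n + 1), ∑ᶠ a₂ : ℕ, ∑ r ∈ Finset.HasAntidiagonal.antidiagonal b,
          ((iteratedDeriv n Real.arctan 0 : ℝ) : ℂ) / ((n.factorial : ℂ) * Real.pi)
            * (n.choose q : ℂ) * (-1) ^ (n - q)
            * convPow c q a r.1 * convPow c (n - q) a₂ r.2 * X (a₂ : ℤ))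
      + (∑ᶠ n : ℕ, (-1) ^ (n + 2) / (((n + 1 : ℕ) : ℂ) * (2 * Complex.I) ^ (n + 2) * Real.pi)
            * convPow c (n + 1) a b)
      + 1 / (2 * Complex.I * Real.pi)
          * ∑ᶠ n : ℕ, (-1) ^ (n + 2) / ((n + 2 : ℕ) : ℂ) * convPow (ctilde c) (n + 2) a b

/-- Extension by zero of a double sequence to integer indices. -/
def zext (d : ℕ → ℕ → ℂ) (a b : ℤ) : ℂ :=
  if 0 ≤ a ∧ 0 ≤ b then d a.toNat b.toNat else 0

/-- The energy coefficient `f_b = ∑_{n ≥ 0} ∑_{a ≥ -1} X_a ( (-1)^n / (i c_{11}) c̃^{[n]}_{a+1,b+1}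
+ c^{[n]}_{ab} / (2 (-2i)^n) )`; the terms with `a < -1` vanish. -/
def energyCoeff (X : ℤ → ℂ) (c : ℕ → ℕ → ℂ) (b : ℤ) : ℂ :=
  ∑ᶠ n : ℕ, ∑ᶠ a : ℤ, X a *
    ((-1) ^ n / (Complex.I * c 1 1) * zext (convPow (ctilde c) n) (a + 1) (b + 1)
      + zext (convPow c n) a b / (2 * (-2 * Complex.I) ^ n))

end TwistedBethe

end

namespace TwistedBethe

lemma convPow_succ (c : ℕ → ℕ → ℂ) (k a b : ℕ) :
    convPow c (k + 1) a b = ∑ p ∈ Finset.HasAntidiagonal.antidiagonal a, ∑ r ∈ Finset.HasAntidiagonal.antidiagonal b,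
      c p.1 r.1 * convPow c k p.2 r.2 := rfl

lemma convPow_congr {c c' : ℕ → ℕ → ℂ} {B : ℕ} (h : ∀ a b, b ≤ B → c a b = c' a b) (n : ℕ) :
    ∀ a b, b ≤ B → convPow c n a b = convPow c' n a b := by
  induction n with
  | zero => intro a b _; rfl
  | succ n ih =>
    intro a b hb
    rw [convPow_succ, convPow_succ]
    refine Finset.sum_congr rfl fun p _ => Finset.sum_congr rfl fun r hr => ?_
    have := Finset.HasAntidiagonal.mem_antidiagonal.mp hr
    rw [h _ _ (by omega), ih _ _ (by omega)]

lemma convPow_eq_zero_of_lt {c : ℕ → ℕ → ℂ} (h : ∀ a, c a 0 = 0) (n : ℕ) :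
    ∀ a b, b < n → convPow c n a b = 0 := by
  induction n with
  | zero => intro a b hb; omega
  | succ n ih =>
    intro a b hb
    rw [convPow_succ]
    refine Finset.sum_eq_zero fun p _ => Finset.sum_eq_zero fun r hr => ?_
    have := Finset.HasAntidiagonal.mem_antidiagonal.mp hr
    rcases Nat.eq_zero_or_pos r.1 with h0 | h0
    · rw [h0, h, zero_mul]
    · rw [ih _ _ (by omega), mul_zero]

lemma convPow_eq_zero_of_support {c : ℕ → ℕ → ℂ} (h : ∀ a b, b < a → c a b = 0) (n : ℕ) :
    ∀ a b, b < a → convPow c n a b = 0 := by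
  induction n with
  | zero => intro a b hb; simp only [convPow]; rw [if_neg (by omega)]
  | succ n ih =>
    intro a b hb
    rw [convPow_succ]
    refine Finset.sum_eq_zero fun p hp => Finset.sum_eq_zero fun r hr => ?_
    have := Finset.HasAntidiagonal.mem_antidiagonal.mp hr
    have := Finset.HasAntidiagonal.mem_antidiagonal.mp hp
    rcases lt_or_ge r.1 p.1 with h0 | h0
    · rw [h _ _ h0, zero_mul]
    · rw [ih _ _ (by omega), mul_zero]

/-- Truncation of a double sequence to second indices below `B`. -/
noncomputable def rowTrunc (B : ℕ) (c : ℕ → ℕ → ℂ) (a b : ℕ) : ℂ := if b < B then c a b else 0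

lemma convPow_rowTrunc {c : ℕ → ℕ → ℂ} (h : ∀ a, c a 0 = 0) (n a B : ℕ) :
    convPow c (n + 2) a B = convPow (rowTrunc B c) (n + 2) a B := by
  have h' : ∀ a, rowTrunc B c a 0 = 0 := by intro a; simp [rowTrunc, h]
  rw [convPow_succ, convPow_succ]
  refine Finset.sum_congr rfl fun p _ => Finset.sum_congr rfl fun r hr => ?_
  have := Finset.HasAntidiagonal.mem_antidiagonal.mp hr
  rcases Nat.eq_zero_or_pos r.1 with h0 | h0
  · rw [h0, h, h', zero_mul, zero_mul]
  rcases Nat.eq_zero_or_pos r.2 with h1 | h1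
  · rw [h1, convPow_eq_zero_of_lt h _ _ _ (by omega), convPow_eq_zero_of_lt h' _ _ _ (by omega),
      mul_zero, mul_zero]
  · rw [rowTrunc, if_pos (by omega)]
    congr 1
    refine convPow_congr (B := r.2) (fun a b hb => ?_) _ _ _ le_rfl
    rw [rowTrunc, if_pos (by omega)]

lemma convPow_zero_row {c : ℕ → ℕ → ℂ} (h0 : c 0 0 = 0) (n a : ℕ)
    (h : ∀ a' < a, c a' 0 = 0) : convPow c (n + 2) a 0 = 0 := by
  rw [convPow_succ]
  refine Finset.sum_eq_zero fun p hp => Finset.sum_eq_zero fun r hr => ?_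
  have := Finset.HasAntidiagonal.mem_antidiagonal.mp hr
  have := Finset.HasAntidiagonal.mem_antidiagonal.mp hp
  have hr1 : r.1 = 0 := by omega
  have hr2 : r.2 = 0 := by omega
  rw [hr1, hr2]
  rcases Nat.lt_or_ge p.1 a with h1 | h1
  · rw [h _ h1, zero_mul]
  · have hp2 : p.2 = 0 := by omega
    rw [hp2, convPow_succ]
    simp [h0]

/-- The right-hand side of the recursion, multiplied by `2 i π`. -/
noncomputable def recursionRhs (X : ℤ → ℂ) (c : ℕ → ℕ → ℂ) (a b : ℕ) : ℂ :=
  2 * Complex.I * Real.pi * (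
      - (∑ᶠ n : ℕ, ∑ q ∈ Finset.range (n + 1), ∑ᶠ a₂ : ℕ, ∑ r ∈ Finset.HasAntidiagonal.antidiagonal b,
          ((iteratedDeriv n Real.arctan 0 : ℝ) : ℂ) / ((n.factorial : ℂ) * Real.pi)
            * (n.choose q : ℂ) * (-1) ^ (n - q)
            * convPow c q a r.1 * convPow c (n - q) a₂ r.2 * X (a₂ : ℤ))
      + (∑ᶠ n : ℕ, (-1) ^ (n + 2) / (((n + 1 : ℕ) : ℂ) * (2 * Complex.I) ^ (n + 2) * Real.pi)
            * convPow c (n + 1) a b)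
      + 1 / (2 * Complex.I * Real.pi)
          * ∑ᶠ n : ℕ, (-1) ^ (n + 2) / ((n + 2 : ℕ) : ℂ) * convPow (ctilde c) (n + 2) a b)

lemma recursion_iff {X : ℤ → ℂ} {c : ℕ → ℕ → ℂ} (a b : ℕ) :
    ctilde c a b / (2 * Complex.I * Real.pi) =
      - (∑ᶠ n : ℕ, ∑ q ∈ Finset.range (n + 1), ∑ᶠ a₂ : ℕ, ∑ r ∈ Finset.HasAntidiagonal.antidiagonal b,
          ((iteratedDeriv n Real.arctan 0 : ℝ) : ℂ) / ((n.factorial : ℂ) * Real.pi)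
            * (n.choose q : ℂ) * (-1) ^ (n - q)
            * convPow c q a r.1 * convPow c (n - q) a₂ r.2 * X (a₂ : ℤ))
      + (∑ᶠ n : ℕ, (-1) ^ (n + 2) / (((n + 1 : ℕ) : ℂ) * (2 * Complex.I) ^ (n + 2) * Real.pi)
            * convPow c (n + 1) a b)
      + 1 / (2 * Complex.I * Real.pi)
          * ∑ᶠ n : ℕ, (-1) ^ (n + 2) / ((n + 2 : ℕ) : ℂ) * convPow (ctilde c) (n + 2) a b
    ↔ ctilde c a b = recursionRhs X c a b := by
  have h : (2 * Complex.I * Real.pi : ℂ) ≠ 0 := by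
    simp [Complex.I_ne_zero, Real.pi_ne_zero]
  rw [recursionRhs, div_eq_iff h, mul_comm (2 * Complex.I * Real.pi : ℂ)]

/-- The base conditions for root coefficients which make the recursion triangular. -/
structure IsTriangular (c : ℕ → ℕ → ℂ) : Prop where
  zero_left : ∀ b, c 0 b = 0
  zero_right : ∀ a, c a 0 = 0
  one_one : c 1 1 = -2 * Complex.I
  first_row : ∀ a, ctilde c a 0 = 0

lemma recursionRhs_congr {X : ℤ → ℂ} {c c' : ℕ → ℕ → ℂ} (hc : IsTriangular c)
    (hc' : IsTriangular c') {B : ℕ} (h : ∀ a b, b ≤ B → c a b = c' a b) (a : ℕ) :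
    recursionRhs X c a B = recursionRhs X c' a B := by
  have h1 : ∀ n a b, b ≤ B → convPow c n a b = convPow c' n a b := convPow_congr h
  have h2 : ∀ n, convPow (ctilde c) (n + 2) a B = convPow (ctilde c') (n + 2) a B := by
    intro n
    rw [convPow_rowTrunc hc.first_row, convPow_rowTrunc hc'.first_row]
    congr 1
    ext a b
    unfold rowTrunc
    split_ifs with hb
    · rw [ctilde, ctilde, hc.one_one, hc'.one_one, h _ _ hb]
    · rfl
  unfold recursionRhs
  congr 3
  · congr 1
    refine finsum_congr fun n => Finset.sum_congr rfl fun q _ => finsum_congr fun a₂ =>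
      Finset.sum_congr rfl fun r hr => ?_
    have := Finset.HasAntidiagonal.mem_antidiagonal.mp hr
    rw [h1 _ _ _ (by omega : r.1 ≤ B), h1 _ _ _ (by omega : r.2 ≤ B)]
  · exact finsum_congr fun n => by rw [h1 _ _ _ le_rfl]
  · exact finsum_congr fun n => by rw [h2]

lemma convPow_mul_convPow_zero {c : ℕ → ℕ → ℂ} (hz : ∀ a, c a 0 = 0) (n q a a₂ : ℕ)
    (hn : n ≠ 0) : convPow c q a 0 * convPow c (n - q) a₂ 0 = 0 := by
  rcases Nat.eq_zero_or_pos q with h0 | h0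
  · rw [convPow_eq_zero_of_lt hz (n - q) _ _ (by omega), mul_zero]
  · rw [convPow_eq_zero_of_lt hz q _ _ h0, zero_mul]

lemma recursionRhs_zero_row {X : ℤ → ℂ} {c : ℕ → ℕ → ℂ} (hz : ∀ a, c a 0 = 0) (a : ℕ)
    (h : ∀ a' < a, ctilde c a' 0 = 0) : recursionRhs X c a 0 = 0 := by
  have h1 : ∀ n, convPow c (n + 1) a 0 = 0 := fun n => convPow_eq_zero_of_lt hz _ _ _ (by omega)
  have h2 : ∀ n, convPow (ctilde c) (n + 2) a 0 = 0 := fun n =>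
    convPow_zero_row (by simp [ctilde]) n a h
  have h3 : ∀ n q a₂ : ℕ, ((iteratedDeriv n Real.arctan 0 : ℝ) : ℂ) / ((n.factorial : ℂ) * Real.pi)
            * (n.choose q : ℂ) * (-1) ^ (n - q)
            * convPow c q a 0 * convPow c (n - q) a₂ 0 * X (a₂ : ℤ) = 0 := by
    intro n q a₂
    rcases eq_or_ne n 0 with rfl | hn
    · simp
    · rw [mul_assoc _ (convPow c q a 0), convPow_mul_convPow_zero hz n q a a₂ hn]
      simp
  simp [recursionRhs, h1, h2, h3]

lemma IsRootExpansion.isTriangular {X : ℤ → ℂ} {c : ℕ → ℕ → ℂ} (hc : IsRootExpansion X c) :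
    IsTriangular c := by
  refine ⟨hc.zero_left, hc.zero_right, hc.one_one, fun a => ?_⟩
  induction a using Nat.strong_induction_on with
  | _ a ih =>
    rw [(recursion_iff a 0).mp (hc.recursion a 0)]
    exact recursionRhs_zero_row hc.zero_right a ih

lemma IsRootExpansion.eq_recursionRhs {X : ℤ → ℂ} {c : ℕ → ℕ → ℂ} (hc : IsRootExpansion X c)
    (a b : ℕ) : ctilde c a b = recursionRhs X c a b :=
  (recursion_iff a b).mp (hc.recursion a b)

lemma IsTriangular.apply_succ_succ {c : ℕ → ℕ → ℂ} (hc : IsTriangular c) (a b : ℕ)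
    (h : b ≠ 0) : c (a + 1) (b + 1) = -2 * Complex.I * ctilde c a b := by
  rw [ctilde, if_neg (by tauto), hc.one_one]
  field_simp [Complex.I_ne_zero]

lemma IsTriangular.first_row_apply {c : ℕ → ℕ → ℂ} (hc : IsTriangular c) (a : ℕ) (ha : a ≠ 0) :
    c (a + 1) 1 = 0 := by
  have h1 := hc.first_row a
  have hI : (-2 * Complex.I : ℂ) ≠ 0 := by simp [Complex.I_ne_zero]
  rw [ctilde, if_neg (by tauto), hc.one_one, div_eq_zero_iff] at h1
  simpa [hI] using h1

lemma IsRootExpansion.unique {X : ℤ → ℂ} {c c' : ℕ → ℕ → ℂ} (hc : IsRootExpansion X c)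
    (hc' : IsRootExpansion X c') : c = c' := by
  suffices h : ∀ B a b, b ≤ B → c a b = c' a b by ext a b; exact h b a b le_rfl
  have ht := hc.isTriangular
  have ht' := hc'.isTriangular
  intro B
  induction B with
  | zero =>
    intro a b hb
    obtain rfl : b = 0 := by omega
    rw [hc.zero_right, hc'.zero_right]
  | succ B ih =>
    intro a b hb
    rcases Nat.lt_or_ge b (B + 1) with h | h
    · exact ih _ _ (by omega)
    obtain rfl : b = B + 1 := by omega
    rcases a with _ | a
    · rw [hc.zero_left, hc'.zero_left]
    rcases eq_or_ne B 0 with rfl | hB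
    · rcases eq_or_ne a 0 with rfl | ha
      · exact hc.one_one.trans hc'.one_one.symm
      · rw [zero_add, ht.first_row_apply a ha, ht'.first_row_apply a ha]
    · rw [ht.apply_succ_succ a B hB, ht'.apply_succ_succ a B hB, hc.eq_recursionRhs,
        hc'.eq_recursionRhs, recursionRhs_congr ht ht' ih]

/-- One step of the recursion, as a map on double sequences. -/
noncomputable def recursionStep (X : ℤ → ℂ) (c : ℕ → ℕ → ℂ) : ℕ → ℕ → ℂ
  | 0, _ => 0
  | _ + 1, 0 => 0
  | a + 1, 1 => if a = 0 then -2 * Complex.I else 0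
  | a + 1, b + 2 => -2 * Complex.I * recursionRhs X c a (b + 1)

lemma recursionStep_isTriangular (X : ℤ → ℂ) (c : ℕ → ℕ → ℂ) :
    IsTriangular (recursionStep X c) := by
  refine ⟨fun b => rfl, fun a => by cases a <;> rfl, rfl, fun a => ?_⟩
  rw [ctilde]
  split_ifs with h
  · rfl
  · have : a ≠ 0 := by tauto
    simp [recursionStep, this]

lemma recursionRhs_support {X : ℤ → ℂ} {c : ℕ → ℕ → ℂ} (hs : ∀ a b, b < a → c a b = 0) (a b : ℕ)
    (hab : b < a) : recursionRhs X c a b = 0 := by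
  have hs' : ∀ a b, b < a → ctilde c a b = 0 := by
    intro a b h
    rw [ctilde]
    split_ifs
    · rfl
    · rw [hs _ _ (by omega), zero_div]
  have h1 := convPow_eq_zero_of_support hs
  have h2 := convPow_eq_zero_of_support hs'
  have e1 : ∀ n, convPow c (n + 1) a b = 0 := fun n => h1 _ _ _ hab
  have e2 : ∀ n, convPow (ctilde c) (n + 2) a b = 0 := fun n => h2 _ _ _ hab
  have e3 : ∀ n q a₂ : ℕ, ∑ r ∈ Finset.HasAntidiagonal.antidiagonal b,
          ((iteratedDeriv n Real.arctan 0 : ℝ) : ℂ) / ((n.factorial : ℂ) * Real.pi)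
            * (n.choose q : ℂ) * (-1) ^ (n - q)
            * convPow c q a r.1 * convPow c (n - q) a₂ r.2 * X (a₂ : ℤ) = 0 := by
    intro n q a₂
    refine Finset.sum_eq_zero fun r hr => ?_
    have := Finset.HasAntidiagonal.mem_antidiagonal.mp hr
    rw [h1 q a r.1 (by omega)]
    simp
  simp [recursionRhs, e1, e2, e3]

lemma recursionStep_support {X : ℤ → ℂ} {c : ℕ → ℕ → ℂ} (hs : ∀ a b, b < a → c a b = 0) (a b : ℕ)
    (hab : b < a) : recursionStep X c a b = 0 := by
  match a, b with
  | 0, _ => rfl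
  | _ + 1, 0 => rfl
  | a + 1, 1 => simp only [recursionStep]; rw [if_neg (by omega)]
  | a + 1, b + 2 =>
    simp only [recursionStep]
    rw [recursionRhs_support hs a (b + 1) (by omega), mul_zero]

/-- The iterates of the recursion step. -/
noncomputable def recursionIter (X : ℤ → ℂ) (k : ℕ) : ℕ → ℕ → ℂ :=
  (recursionStep X)^[k] (recursionStep X 0)

lemma recursionIter_succ (X : ℤ → ℂ) (k : ℕ) :
    recursionIter X (k + 1) = recursionStep X (recursionIter X k) :=
  Function.iterate_succ_apply' _ _ _

lemma recursionIter_isTriangular (X : ℤ → ℂ) (k : ℕ) : IsTriangular (recursionIter X k) := by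
  cases k with
  | zero => exact recursionStep_isTriangular _ _
  | succ k => rw [recursionIter_succ]; exact recursionStep_isTriangular _ _

lemma recursionIter_support (X : ℤ → ℂ) (k : ℕ) :
    ∀ a b, b < a → recursionIter X k a b = 0 := by
  induction k with
  | zero => exact recursionStep_support fun a b _ => rfl
  | succ k ih => rw [recursionIter_succ]; exact recursionStep_support ih

lemma recursionStep_congr {X : ℤ → ℂ} {c c' : ℕ → ℕ → ℂ} (hc : IsTriangular c)
    (hc' : IsTriangular c') {B : ℕ} (h : ∀ a b, b ≤ B → c a b = c' a b) (a b : ℕ)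
    (hb : b ≤ B + 1) : recursionStep X c a b = recursionStep X c' a b := by
  match a, b with
  | 0, _ => rfl
  | _ + 1, 0 => rfl
  | a + 1, 1 => rfl
  | a + 1, b + 2 =>
    simp only [recursionStep]
    rw [recursionRhs_congr hc hc' (fun a' b' hb' => h a' b' (by omega)) a]

lemma recursionIter_stable (X : ℤ → ℂ) (k : ℕ) :
    ∀ a b, b ≤ k → recursionIter X (k + 1) a b = recursionIter X k a b := by
  induction k with
  | zero =>
    intro a b hb
    obtain rfl : b = 0 := by omega
    rw [(recursionIter_isTriangular X 1).zero_right, (recursionIter_isTriangular X 0).zero_right]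
  | succ k ih =>
    intro a b hb
    rw [recursionIter_succ X (k + 1)]
    conv_rhs => rw [recursionIter_succ X k]
    exact recursionStep_congr (recursionIter_isTriangular X _) (recursionIter_isTriangular X _)
      ih a b hb

/-- The solution of the recursion. -/
noncomputable def rootCoeff (X : ℤ → ℂ) (a b : ℕ) : ℂ := recursionIter X b a b

lemma rootCoeff_eq (X : ℤ → ℂ) (k a b : ℕ) (h : b ≤ k) :
    rootCoeff X a b = recursionIter X k a b := by
  induction k, h using Nat.le_induction with
  | base => rfl
  | succ k hk ih => rw [recursionIter_stable X k a b hk, ih]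

lemma rootCoeff_step (X : ℤ → ℂ) : recursionStep X (rootCoeff X) = rootCoeff X := by
  have ht : IsTriangular (rootCoeff X) := by
    have h1 := recursionIter_isTriangular X 1
    refine ⟨fun b => (recursionIter_isTriangular X b).zero_left b,
      fun a => (recursionIter_isTriangular X 0).zero_right a, h1.one_one, fun a => ?_⟩
    rw [← h1.first_row a, ctilde, ctilde]
    rfl
  ext a b
  rw [rootCoeff_eq X (b + 1) a b (by omega), recursionIter_succ]
  exact recursionStep_congr ht (recursionIter_isTriangular X b)
    (fun a' b' hb => rootCoeff_eq X b a' b' hb) a b (by omega)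

lemma rootCoeff_isRootExpansion (X : ℤ → ℂ) : IsRootExpansion X (rootCoeff X) := by
  have ht : IsTriangular (rootCoeff X) := by
    rw [← rootCoeff_step]; exact recursionStep_isTriangular _ _
  refine ⟨ht.zero_left, ht.zero_right, ht.one_one, fun a b => (recursion_iff a b).mpr ?_⟩
  rcases b with _ | b
  · rw [ht.first_row, recursionRhs_zero_row ht.zero_right a fun a' _ => ht.first_row a']
  · have hI : (-2 * Complex.I : ℂ) ≠ 0 := by simp [Complex.I_ne_zero]
    have h := ht.apply_succ_succ a (b + 1) (by omega)
    rw [← rootCoeff_step] at h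
    simp only [recursionStep] at h
    rw [rootCoeff_step] at h
    exact (mul_left_cancel₀ hI h).symm

lemma IsRootExpansion.eq_rootCoeff {X : ℤ → ℂ} {c : ℕ → ℕ → ℂ} (hc : IsRootExpansion X c) :
    c = rootCoeff X := hc.unique (rootCoeff_isRootExpansion X)

lemma rootCoeff_support (X : ℤ → ℂ) (a b : ℕ) (h : b < a) : rootCoeff X a b = 0 :=
  recursionIter_support X b a b h

end TwistedBethe

namespace TwistedBethe

lemma hasSum_of_forall_eq {ι E : Type*} [AddCommMonoid E] [TopologicalSpace E] {f g : ι → E} {s : E}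
    (h : HasSum f s) (e : ∀ n, g n = f n) : HasSum g s := (funext e : g = f) ▸ h

/-- The Taylor coefficients of `arctan` at `0`. -/
noncomputable def arctanCoeff (n : ℕ) : ℝ := if Odd n then (-1) ^ (n / 2) / n else 0

lemma hasSum_odd_iff {E : Type*} [NormedAddCommGroup E] {f : ℕ → E} (hf : ∀ n, ¬ Odd n → f n = 0)
    (s : E) : HasSum (fun k => f (2 * k + 1)) s ↔ HasSum f s := by
  have hinj : Function.Injective (fun k : ℕ => 2 * k + 1) := fun a b h => by
    simp only at h; omega
  refine hinj.hasSum_iff (f := f) fun n hn => hf n fun ho => hn ?_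
  obtain ⟨k, hk⟩ := ho
  exact ⟨k, hk.symm⟩

lemma hasSum_arctanCoeff {x : ℝ} (hx : ‖x‖ < 1) :
    HasSum (fun n => arctanCoeff n * x ^ n) (Real.arctan x) := by
  rw [← hasSum_odd_iff]
  · refine hasSum_of_forall_eq (Real.hasSum_arctan hx) fun k => ?_
    have h1 : Odd (2 * k + 1) := ⟨k, rfl⟩
    have h2 : (2 * k + 1) / 2 = k := by omega
    rw [arctanCoeff, if_pos h1, h2]
    ring
  · intro n hn
    rw [arctanCoeff, if_neg hn, zero_mul]

lemma iteratedDeriv_arctan_zero (n : ℕ) :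
    iteratedDeriv n Real.arctan 0 / n.factorial = arctanCoeff n := by
  have h1 : HasFPowerSeriesAt Real.arctan (FormalMultilinearSeries.ofScalars ℝ arctanCoeff) 0 := by
    rw [hasFPowerSeriesAt_iff]
    filter_upwards [Metric.ball_mem_nhds (0 : ℝ) one_pos] with x hx
    rw [zero_add]
    refine hasSum_of_forall_eq (hasSum_arctanCoeff (x := x) (by simpa using hx)) fun n => ?_
    rw [FormalMultilinearSeries.coeff_ofScalars, smul_eq_mul, mul_comm]
  have h2 := h1.analyticAt.hasFPowerSeriesAt
  have h3 := congrArg (fun p => FormalMultilinearSeries.coeff p n)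
    (h2.eq_formalMultilinearSeries h1)
  simpa [FormalMultilinearSeries.coeff_ofScalars] using h3

/-- The Taylor coefficients of `s ↦ -2 artanh (2 s)`, that is of `s ↦ -2 i arctan (-2 i s)`. -/
def artanhCoeff (n : ℕ) : ℚ := if Odd n then -(2 ^ (n + 1)) / n else 0

lemma artanhCoeff_eq (n : ℕ) :
    -(2 * Complex.I) * (arctanCoeff n : ℂ) * (-2 * Complex.I) ^ n = (artanhCoeff n : ℂ) := by
  rw [arctanCoeff, artanhCoeff]
  split_ifs with h
  · obtain ⟨k, rfl⟩ := h
    have h2 : (2 * k + 1) / 2 = k := by omega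
    rw [h2]
    push_cast
    have h3 : (-2 * Complex.I) ^ (2 * k + 1) = (-1) ^ k * (2 ^ (2 * k) * (-2 * Complex.I)) := by
      rw [pow_succ, pow_mul, mul_pow, Complex.I_sq]
      rw [show ((-2 : ℂ) ^ 2 * -1) = (-1) * 2 ^ 2 by ring, mul_pow, ← pow_mul]
      ring
    have h4 : ((-1 : ℂ) ^ k) * (-1) ^ k = 1 := by rw [← mul_pow]; simp
    rw [h3]
    calc _ = ((-1 : ℂ) ^ k * (-1) ^ k) * (4 * (Complex.I * Complex.I) * 2 ^ (2 * k))
            / (2 * k + 1) := by ring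
      _ = _ := by rw [h4, Complex.I_mul_I]; ring
  · simp

/-- The rescaled coefficients `d = (i / 2) c`, in which the recursion is rational. -/
noncomputable def halfCoeff (c : ℕ → ℕ → ℂ) (a b : ℕ) : ℂ := Complex.I / 2 * c a b

lemma convPow_eq_halfCoeff (c : ℕ → ℕ → ℂ) (n : ℕ) :
    ∀ a b, convPow c n a b = (-2 * Complex.I) ^ n * convPow (halfCoeff c) n a b := by
  induction n with
  | zero => intro a b; simp [convPow]
  | succ n ih =>
    intro a b
    rw [convPow_succ, convPow_succ, Finset.mul_sum]
    refine Finset.sum_congr rfl fun p _ => ?_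
    rw [Finset.mul_sum]
    refine Finset.sum_congr rfl fun r _ => ?_
    rw [ih, halfCoeff]
    linear_combination (c p.1 r.1 * ((-2 * Complex.I) ^ n * convPow (halfCoeff c) n p.2 r.2)) *
      Complex.I_mul_I

lemma two_I_pow_coeff (n : ℕ) : 2 * Complex.I * Real.pi *
    ((-1) ^ (n + 2) / (((n + 1 : ℕ) : ℂ) * (2 * Complex.I) ^ (n + 2) * Real.pi)) *
      (-2 * Complex.I) ^ (n + 1) = - (1 / ((n + 1 : ℕ) : ℂ)) := by
  have hp : (Real.pi : ℂ) ≠ 0 := by exact_mod_cast Real.pi_ne_zero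
  have hn : ((n + 1 : ℕ) : ℂ) ≠ 0 := by exact_mod_cast n.succ_ne_zero
  have hI : (2 * Complex.I : ℂ) ≠ 0 := by simp [Complex.I_ne_zero]
  have h1 : (-2 * Complex.I) ^ (n + 1) = (-1) ^ (n + 1) * (2 * Complex.I) ^ (n + 1) := by
    rw [← mul_pow]; ring
  have h2 : ((-1 : ℂ) ^ n) * (-1) ^ n = 1 := by rw [← mul_pow]; simp
  rw [h1, pow_succ (2 * Complex.I) (n + 1)]
  have hI' := pow_ne_zero (n + 1) hI
  generalize (2 * Complex.I) ^ (n + 1) = w at *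
  generalize (2 * Complex.I) = v at *
  field_simp
  rw [pow_add, pow_add]
  linear_combination -h2

lemma IsRootExpansion.halfCoeff_zero_right {X : ℤ → ℂ} {c : ℕ → ℕ → ℂ}
    (hc : IsRootExpansion X c) (a : ℕ) : halfCoeff c a 0 = 0 := by
  rw [halfCoeff, hc.zero_right, mul_zero]

lemma IsRootExpansion.support {X : ℤ → ℂ} {c : ℕ → ℕ → ℂ}
    (hc : IsRootExpansion X c) (a b : ℕ) (h : b < a) : c a b = 0 := by
  rw [hc.eq_rootCoeff]; exact rootCoeff_support X a b h

lemma IsRootExpansion.halfCoeff_support {X : ℤ → ℂ} {c : ℕ → ℕ → ℂ}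
    (hc : IsRootExpansion X c) (a b : ℕ) (h : b < a) : halfCoeff c a b = 0 := by
  rw [halfCoeff, hc.support a b h, mul_zero]

lemma IsRootExpansion.ctilde_support {X : ℤ → ℂ} {c : ℕ → ℕ → ℂ}
    (hc : IsRootExpansion X c) (a b : ℕ) (h : b < a) : ctilde c a b = 0 := by
  rw [ctilde]
  split_ifs
  · rfl
  · rw [hc.support _ _ (by omega), zero_div]

lemma IsRootExpansion.halfCoeff_succ_succ {X : ℤ → ℂ} {c : ℕ → ℕ → ℂ}
    (hc : IsRootExpansion X c) (a b : ℕ) (h : ¬ (a = 0 ∧ b = 0)) :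
    halfCoeff c (a + 1) (b + 1) = ctilde c a b := by
  rw [halfCoeff, ctilde, if_neg h, hc.one_one]
  field_simp [Complex.I_ne_zero]
  rw [Complex.I_sq]; ring

lemma IsRootExpansion.halfCoeff_one_one {X : ℤ → ℂ} {c : ℕ → ℕ → ℂ}
    (hc : IsRootExpansion X c) : halfCoeff c 1 1 = 1 := by
  rw [halfCoeff, hc.one_one]
  linear_combination -Complex.I_mul_I

lemma IsRootExpansion.ctilde_eq {X : ℤ → ℂ} {c : ℕ → ℕ → ℂ} (hc : IsRootExpansion X c)
    (a b : ℕ) :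
    ctilde c a b =
      (∑ n ∈ Finset.range (b + 1), ∑ q ∈ Finset.range (n + 1), ∑ a₂ ∈ Finset.range (b + 1),
        ∑ r ∈ Finset.HasAntidiagonal.antidiagonal b,
          (artanhCoeff n : ℂ) * (n.choose q : ℂ) * (-1) ^ (n - q)
            * convPow (halfCoeff c) q a r.1 * convPow (halfCoeff c) (n - q) a₂ r.2 * X (a₂ : ℤ))
      - ∑ n ∈ Finset.range (b + 1), 1 / ((n + 1 : ℕ) : ℂ) * convPow (halfCoeff c) (n + 1) a b
      + ∑ n ∈ Finset.range (b + 1), (-1) ^ n / ((n + 2 : ℕ) : ℂ)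
          * convPow (ctilde c) (n + 2) a b := by
  have hp : (Real.pi : ℂ) ≠ 0 := by exact_mod_cast Real.pi_ne_zero
  have z1 := convPow_eq_zero_of_lt hc.zero_right
  have z2 := convPow_eq_zero_of_lt hc.isTriangular.first_row
  have s1 := convPow_eq_zero_of_support hc.support
  have e1 : ∀ n q : ℕ, (∑ᶠ a₂ : ℕ, ∑ r ∈ Finset.HasAntidiagonal.antidiagonal b,
          ((iteratedDeriv n Real.arctan 0 : ℝ) : ℂ) / ((n.factorial : ℂ) * Real.pi)
            * (n.choose q : ℂ) * (-1) ^ (n - q)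
            * convPow c q a r.1 * convPow c (n - q) a₂ r.2 * X (a₂ : ℤ)) =
      ∑ a₂ ∈ Finset.range (b + 1), ∑ r ∈ Finset.HasAntidiagonal.antidiagonal b,
          ((iteratedDeriv n Real.arctan 0 : ℝ) : ℂ) / ((n.factorial : ℂ) * Real.pi)
            * (n.choose q : ℂ) * (-1) ^ (n - q)
            * convPow c q a r.1 * convPow c (n - q) a₂ r.2 * X (a₂ : ℤ) := by
    intro n q
    refine finsum_eq_sum_of_support_subset _ fun a₂ ha => ?_
    by_contra hlt
    refine ha (Finset.sum_eq_zero fun r hr => ?_)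
    have := Finset.HasAntidiagonal.mem_antidiagonal.mp hr
    simp only [Finset.coe_range, Set.mem_Iio, not_lt] at hlt
    rw [s1 (n - q) a₂ r.2 (by omega)]
    ring
  have e2 : ∀ n q a₂ : ℕ, ∀ r ∈ Finset.HasAntidiagonal.antidiagonal b, q ≤ n → b < n →
      convPow c q a r.1 * convPow c (n - q) a₂ r.2 = 0 := by
    intro n q a₂ r hr hq hb
    have := Finset.HasAntidiagonal.mem_antidiagonal.mp hr
    rcases lt_or_ge r.1 q with h | h
    · rw [z1 _ _ _ h, zero_mul]
    · rw [z1 (n - q) _ _ (by omega), mul_zero]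
  rw [hc.eq_recursionRhs, recursionRhs]
  rw [mul_add, mul_add, sub_eq_add_neg]
  congr 2
  · rw [finsum_eq_sum_of_support_subset (s := Finset.range (b + 1)), ← Finset.sum_neg_distrib,
      Finset.mul_sum]
    · refine Finset.sum_congr rfl fun n _ => ?_
      rw [← Finset.sum_neg_distrib, Finset.mul_sum]
      refine Finset.sum_congr rfl fun q hq => ?_
      rw [e1, ← Finset.sum_neg_distrib, Finset.mul_sum]
      refine Finset.sum_congr rfl fun a₂ _ => ?_
      rw [← Finset.sum_neg_distrib, Finset.mul_sum]
      refine Finset.sum_congr rfl fun r _ => ?_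
      rw [convPow_eq_halfCoeff c q, convPow_eq_halfCoeff c (n - q), ← artanhCoeff_eq,
        ← iteratedDeriv_arctan_zero]
      have hqn : q + (n - q) = n := by
        have := Finset.mem_range.mp hq; omega
      have hpow : (-2 * Complex.I) ^ n = (-2 * Complex.I) ^ q * (-2 * Complex.I) ^ (n - q) := by
        rw [← pow_add, hqn]
      rw [hpow]
      push_cast
      have hf : (n.factorial : ℂ) ≠ 0 := by exact_mod_cast n.factorial_ne_zero
      field_simp
    · intro n hn
      by_contra hlt
      simp only [Finset.coe_range, Set.mem_Iio, not_lt] at hlt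
      refine hn (Finset.sum_eq_zero fun q hq => ?_)
      rw [e1]
      refine Finset.sum_eq_zero fun a₂ _ => Finset.sum_eq_zero fun r hr => ?_
      have := Finset.mem_range.mp hq
      rw [mul_assoc _ (convPow c q a r.1), e2 n q a₂ r hr (by omega) (by omega)]
      ring
  · rw [finsum_eq_sum_of_support_subset (s := Finset.range (b + 1)), ← Finset.sum_neg_distrib,
      Finset.mul_sum]
    · refine Finset.sum_congr rfl fun n _ => ?_
      rw [convPow_eq_halfCoeff, ← neg_mul, ← two_I_pow_coeff]
      ring
    · intro n hn
      by_contra hlt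
      simp only [Finset.coe_range, Set.mem_Iio, not_lt] at hlt
      exact hn (by simp only; rw [z1 _ _ _ (by omega), mul_zero])
  · rw [← mul_assoc, mul_one_div_cancel (by simp [Complex.I_ne_zero, Real.pi_ne_zero]), one_mul,
      finsum_eq_sum_of_support_subset (s := Finset.range (b + 1))]
    · refine Finset.sum_congr rfl fun n _ => ?_
      rw [pow_add]; norm_num
    · intro n hn
      by_contra hlt
      simp only [Finset.coe_range, Set.mem_Iio, not_lt] at hlt
      exact hn (by simp only; rw [z2 _ _ _ (by omega), mul_zero])

lemma zext_sub_one (d : ℕ → ℕ → ℂ) (i j : ℕ) :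
    zext d ((i : ℤ) - 1 + 1) ((j : ℤ) - 1 + 1) = d i j := by
  simp [zext]

lemma IsRootExpansion.energyCoeff_eq {X : ℤ → ℂ} {c : ℕ → ℕ → ℂ} (hc : IsRootExpansion X c)
    (j : ℕ) : energyCoeff X c ((j : ℤ) - 1) =
      ∑ n ∈ Finset.range (j + 1), ∑ i ∈ Finset.range (j + 1), X ((i : ℤ) - 1) *
        ((-1) ^ n / 2 * convPow (ctilde c) n i j
          + 1 / 2 * zext (convPow (halfCoeff c) n) ((i : ℤ) - 1) ((j : ℤ) - 1)) := by
  have z1 := convPow_eq_zero_of_lt hc.zero_right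
  have z2 := convPow_eq_zero_of_lt hc.isTriangular.first_row
  have s1 := convPow_eq_zero_of_support hc.support
  have s2 := convPow_eq_zero_of_support hc.ctilde_support
  have hterm : ∀ (n : ℕ) (i : ℕ), X ((i : ℤ) - 1) * ((-1) ^ n / (Complex.I * c 1 1) *
      zext (convPow (ctilde c) n) ((i : ℤ) - 1 + 1) ((j : ℤ) - 1 + 1)
      + zext (convPow c n) ((i : ℤ) - 1) ((j : ℤ) - 1) / (2 * (-2 * Complex.I) ^ n)) =
      X ((i : ℤ) - 1) *
        ((-1) ^ n / 2 * convPow (ctilde c) n i j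
          + 1 / 2 * zext (convPow (halfCoeff c) n) ((i : ℤ) - 1) ((j : ℤ) - 1)) := by
    intro n i
    have hI : Complex.I * c 1 1 = 2 := by
      rw [hc.one_one]; linear_combination -2 * Complex.I_mul_I
    rw [zext_sub_one, hI]
    congr 2
    unfold zext
    split_ifs
    · rw [convPow_eq_halfCoeff]
      have : (-2 * Complex.I : ℂ) ^ n ≠ 0 := pow_ne_zero _ (by simp [Complex.I_ne_zero])
      field_simp
    · simp
  have hinner : ∀ n : ℕ, (∑ᶠ a : ℤ, X a * ((-1) ^ n / (Complex.I * c 1 1) *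
      zext (convPow (ctilde c) n) (a + 1) ((j : ℤ) - 1 + 1)
      + zext (convPow c n) a ((j : ℤ) - 1) / (2 * (-2 * Complex.I) ^ n))) =
      ∑ i ∈ Finset.range (j + 1), X ((i : ℤ) - 1) *
        ((-1) ^ n / 2 * convPow (ctilde c) n i j
          + 1 / 2 * zext (convPow (halfCoeff c) n) ((i : ℤ) - 1) ((j : ℤ) - 1)) := by
    intro n
    let e : ℕ ↪ ℤ := ⟨fun i => (i : ℤ) - 1, fun a b h => by simpa using h⟩
    rw [finsum_eq_sum_of_support_subset (s := (Finset.range (j + 1)).map e)]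
    · rw [Finset.sum_map]
      exact Finset.sum_congr rfl fun i _ => hterm n i
    · intro a ha
      by_contra hmem
      apply ha
      have hout : a < -1 ∨ (j : ℤ) - 1 < a := by
        by_contra hcon
        push Not at hcon
        apply hmem
        rw [Finset.coe_map]
        refine ⟨(a + 1).toNat, ?_, ?_⟩
        · simp only [Finset.coe_range, Set.mem_Iio]; omega
        · change ((a + 1).toNat : ℤ) - 1 = a
          omega
      have e1 : zext (convPow (ctilde c) n) (a + 1) ((j : ℤ) - 1 + 1) = 0 := by
        unfold zext
        split_ifs with h
        · exact s2 _ _ _ (by omega)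
        · rfl
      have e2 : zext (convPow c n) a ((j : ℤ) - 1) = 0 := by
        unfold zext
        split_ifs with h
        · exact s1 _ _ _ (by omega)
        · rfl
      simp only
      rw [e1, e2]
      simp
  rw [energyCoeff, finsum_congr hinner]
  refine finsum_eq_sum_of_support_subset _ fun n hn => ?_
  by_contra hlt
  simp only [Finset.coe_range, Set.mem_Iio, not_lt] at hlt
  refine hn (Finset.sum_eq_zero fun i _ => ?_)
  rw [z2 _ _ _ (by omega)]
  have e2 : zext (convPow (halfCoeff c) n) ((i : ℤ) - 1) ((j : ℤ) - 1) = 0 := by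
    unfold zext
    split_ifs with h
    · exact convPow_eq_zero_of_lt hc.halfCoeff_zero_right _ _ _ (by omega)
    · rfl
  rw [e2]
  simp

/-! ### Polynomial dependence on the moments -/

/-- Functions of the moments which are rational polynomials in the `X a`, `a ∈ S`. -/
noncomputable def momentPoly (S : Set ℤ) : Subalgebra ℚ ((ℤ → ℂ) → ℂ) :=
  Algebra.adjoin ℚ ((fun (a : ℤ) (X : ℤ → ℂ) => X a) '' S)

lemma momentPoly_mono {S T : Set ℤ} (h : S ⊆ T) : momentPoly S ≤ momentPoly T :=
  Algebra.adjoin_mono (Set.image_mono h)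

lemma coord_mem_momentPoly {S : Set ℤ} {a : ℤ} (h : a ∈ S) :
    (fun X : ℤ → ℂ => X a) ∈ momentPoly S := Algebra.subset_adjoin ⟨a, h, rfl⟩

lemma const_mem (S : Subalgebra ℚ ((ℤ → ℂ) → ℂ)) (x : ℚ) : (fun _ : ℤ → ℂ => (x : ℂ)) ∈ S := by
  exact S.algebraMap_mem x

lemma sum_fun_mem (S : Subalgebra ℚ ((ℤ → ℂ) → ℂ)) {ι : Type*} (s : Finset ι)
    (f : ι → (ℤ → ℂ) → ℂ) (h : ∀ i ∈ s, f i ∈ S) : (fun X => ∑ i ∈ s, f i X) ∈ S := by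
  have := S.sum_mem h
  convert this using 1
  ext X
  simp

lemma convPow_mem (S : Subalgebra ℚ ((ℤ → ℂ) → ℂ)) {g : (ℤ → ℂ) → ℕ → ℕ → ℂ} {B : ℕ}
    (h : ∀ a b, b ≤ B → (fun X => g X a b) ∈ S) (n : ℕ) :
    ∀ a b, b ≤ B → (fun X => convPow (g X) n a b) ∈ S := by
  induction n with
  | zero =>
    intro a b _
    simp only [convPow]
    split_ifs
    · simpa using const_mem S 1
    · simpa using const_mem S 0
  | succ n ih =>
    intro a b hb
    simp only [convPow_succ]
    refine sum_fun_mem S _ _ fun p _ => sum_fun_mem S _ _ fun r hr => ?_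
    have := Finset.HasAntidiagonal.mem_antidiagonal.mp hr
    exact S.mul_mem (h _ _ (by omega)) (ih _ _ (by omega))

lemma halfCoeff_mem (b : ℕ) : ∀ a, (fun X => halfCoeff (rootCoeff X) a b) ∈
    momentPoly {i : ℤ | 0 ≤ i ∧ i < b} := by
  induction b using Nat.strong_induction_on with
  | _ b ih =>
  intro a
  have hc := rootCoeff_isRootExpansion
  have hzero : ∀ S : Subalgebra ℚ ((ℤ → ℂ) → ℂ), (fun _ : ℤ → ℂ => (0 : ℂ)) ∈ S :=
    fun S => by simpa using const_mem S 0
  rcases b with _ | b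
  · simp only [fun X => (hc X).halfCoeff_zero_right]
    exact hzero _
  rcases a with _ | a
  · simp only [halfCoeff, fun X => (hc X).zero_left, mul_zero]
    exact hzero _
  by_cases h0 : a = 0 ∧ b = 0
  · obtain ⟨rfl, rfl⟩ := h0
    simp only [zero_add, fun X => (hc X).halfCoeff_one_one]
    simpa using const_mem _ 1
  simp only [fun X => (hc X).halfCoeff_succ_succ a b h0]
  set S := momentPoly {i : ℤ | 0 ≤ i ∧ i < ((b + 1 : ℕ) : ℤ)} with hS
  have hd : ∀ a' b', b' ≤ b → (fun X => halfCoeff (rootCoeff X) a' b') ∈ S := by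
    intro a' b' hb'
    refine momentPoly_mono ?_ (ih b' (by omega) a')
    intro i hi
    simp only [Set.mem_ofPred_eq] at hi ⊢
    omega
  have hdp := convPow_mem S hd
  have htp : ∀ n, (fun X => convPow (ctilde (rootCoeff X)) (n + 2) a b) ∈ S := by
    intro n
    simp only [fun X => convPow_rowTrunc (hc X).isTriangular.first_row n a b]
    refine convPow_mem (B := b) S (fun a' b' _ => ?_) _ _ _ le_rfl
    simp only [rowTrunc]
    split_ifs with hb'
    · by_cases h0' : a' = 0 ∧ b' = 0
      · simp only [ctilde, if_pos h0']
        exact hzero _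
      · simp only [← fun X => (hc X).halfCoeff_succ_succ a' b' h0']
        exact hd _ _ (by omega)
    · exact hzero _
  simp only [fun X => (hc X).ctilde_eq a b]
  refine S.add_mem (S.sub_mem (sum_fun_mem S _ _ fun n _ => sum_fun_mem S _ _ fun q _ =>
    sum_fun_mem S _ _ fun a₂ ha₂ => sum_fun_mem S _ _ fun r hr => ?_)
      (sum_fun_mem S _ _ fun n _ => ?_)) (sum_fun_mem S _ _ fun n _ => ?_)
  · have := Finset.HasAntidiagonal.mem_antidiagonal.mp hr
    have h1 := const_mem S (artanhCoeff n * (n.choose q : ℚ) * (-1) ^ (n - q))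
    push_cast at h1
    refine S.mul_mem (S.mul_mem (S.mul_mem h1 (hdp _ _ _ (by omega))) (hdp _ _ _ (by omega)))
      (coord_mem_momentPoly ?_)
    have := Finset.mem_range.mp ha₂
    simp only [Set.mem_ofPred_eq]
    omega
  · have h1 := const_mem S (1 / ((n + 1 : ℕ) : ℚ))
    push_cast at h1 ⊢
    exact S.mul_mem h1 (hdp _ _ _ le_rfl)
  · have h1 := const_mem S ((-1) ^ n / ((n + 2 : ℕ) : ℚ))
    push_cast at h1 ⊢
    exact S.mul_mem h1 (htp n)

lemma ctilde_mem (a b : ℕ) : (fun X => ctilde (rootCoeff X) a b) ∈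
    momentPoly {i : ℤ | 0 ≤ i ∧ i ≤ b} := by
  by_cases h0 : a = 0 ∧ b = 0
  · simp only [ctilde, if_pos h0]
    simpa using const_mem _ 0
  · simp only [← fun X => (rootCoeff_isRootExpansion X).halfCoeff_succ_succ a b h0]
    refine momentPoly_mono ?_ (halfCoeff_mem (b + 1) (a + 1))
    intro i hi
    simp only [Set.mem_ofPred_eq] at hi ⊢
    omega

lemma energyCoeff_mem (j : ℕ) : (fun X => energyCoeff X (rootCoeff X) ((j : ℤ) - 1)) ∈
    momentPoly {i : ℤ | -1 ≤ i ∧ i ≤ (j : ℤ) - 1 + 1} := by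
  set S := momentPoly {i : ℤ | -1 ≤ i ∧ i ≤ (j : ℤ) - 1 + 1} with hS
  simp only [fun X => (rootCoeff_isRootExpansion X).energyCoeff_eq j]
  refine sum_fun_mem S _ _ fun n _ => sum_fun_mem S _ _ fun i hi =>
    S.mul_mem (coord_mem_momentPoly ?_) (S.add_mem (S.mul_mem ?_ ?_) (S.mul_mem ?_ ?_))
  · have := Finset.mem_range.mp hi
    simp only [Set.mem_ofPred_eq]
    omega
  · have h1 := const_mem S ((-1) ^ n / 2)
    push_cast at h1
    exact h1
  · refine convPow_mem (B := j) S (fun a b hb => momentPoly_mono ?_ (ctilde_mem a b)) _ _ _ le_rfl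
    intro i hi
    simp only [Set.mem_ofPred_eq] at hi ⊢
    omega
  · have h1 := const_mem S (1 / 2)
    push_cast at h1
    exact h1
  · unfold zext
    split_ifs with h
    · refine convPow_mem (B := j) S
        (fun a b hb => momentPoly_mono ?_ (halfCoeff_mem b a)) _ _ _ (by omega)
      intro i hi
      simp only [Set.mem_ofPred_eq] at hi ⊢
      omega
    · simpa using const_mem S 0

lemma continuous_of_mem_momentPoly {S : Set ℤ} {f : (ℤ → ℂ) → ℂ} (hf : f ∈ momentPoly S) :
    Continuous f := by
  induction hf using Algebra.adjoin_induction with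
  | mem x hx => obtain ⟨a, _, rfl⟩ := hx; exact continuous_apply a
  | algebraMap r => exact continuous_const
  | add x y _ _ hx hy => exact hx.add hy
  | mul x y _ _ hx hy => exact hx.mul hy

lemma exists_polynomial_of_mem_momentPoly {S : Set ℤ} {f : (ℤ → ℂ) → ℂ} (hf : f ∈ momentPoly S) :
    ∃ P : MvPolynomial ℤ ℚ, (∀ a ∈ P.vars, a ∈ S) ∧ ∀ X, f X = MvPolynomial.aeval X P := by
  have h1 : momentPoly S = (MvPolynomial.supported ℚ S).map
      (MvPolynomial.aeval (fun (a : ℤ) (X : ℤ → ℂ) => X a)) := by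
    rw [MvPolynomial.supported, AlgHom.map_adjoin, momentPoly, ← Set.image_comp]
    congr 2
    ext a X
    simp
  rw [h1] at hf
  obtain ⟨P, hP, rfl⟩ := hf
  refine ⟨P, fun a ha => (MvPolynomial.mem_supported.mp hP) ha, fun X => ?_⟩
  have h2 : (Pi.evalAlgHom ℚ (fun _ : ℤ → ℂ => ℂ) X).comp
      (MvPolynomial.aeval (fun (a : ℤ) (X : ℤ → ℂ) => X a)) = MvPolynomial.aeval X := by
    ext a
    simp
  exact DFunLike.congr_fun h2 P

lemma exists_energy_polynomial : ∃ P : ℤ → MvPolynomial ℤ ℚ,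
    (∀ b : ℤ, -1 ≤ b → ∀ a ∈ (P b).vars, -1 ≤ a ∧ a ≤ b + 1) ∧
      ∀ (X : ℤ → ℂ) (c : ℕ → ℕ → ℂ), IsRootExpansion X c →
        ∀ b : ℤ, -1 ≤ b → energyCoeff X c b = MvPolynomial.aeval X (P b) := by
  choose P hP1 hP2 using fun j => exists_polynomial_of_mem_momentPoly (energyCoeff_mem j)
  have key : ∀ b : ℤ, -1 ≤ b → ((b + 1).toNat : ℤ) - 1 = b := fun b hb => by omega
  refine ⟨fun b => P (b + 1).toNat, fun b hb a ha => ?_, fun X c hc b hb => ?_⟩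
  · have := hP1 _ a ha
    rw [key b hb] at this
    exact this
  · rw [hc.eq_rootCoeff, ← hP2 (b + 1).toNat X, key b hb]

end TwistedBethe

namespace TwistedBethe

/-! ### Generating series -/

/-- The generating series `∑ c_{ab} z^a t^b` of a lower triangular double sequence, as a power series
in `t` over the polynomials in `z`. -/
noncomputable def rowSeries (c : ℕ → ℕ → ℂ) : PowerSeries (Polynomial ℂ) :=
  PowerSeries.mk fun b => ∑ a ∈ Finset.range (b + 1), Polynomial.monomial a (c a b)

lemma coeff_rowSeries {c : ℕ → ℕ → ℂ} (hs : ∀ a b, b < a → c a b = 0) (a b : ℕ) :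
    (PowerSeries.coeff b (rowSeries c)).coeff a = c a b := by
  simp only [rowSeries, PowerSeries.coeff_mk, Polynomial.finsetSum_coeff,
    Polynomial.coeff_monomial, Finset.sum_ite_eq', Finset.mem_range]
  split_ifs with h
  · rfl
  · rw [hs a b (by omega)]

lemma coeff_rowSeries_pow {c : ℕ → ℕ → ℂ} (hs : ∀ a b, b < a → c a b = 0) (n : ℕ) :
    ∀ a b, (PowerSeries.coeff b (rowSeries c ^ n)).coeff a = convPow c n a b := by
  induction n with
  | zero =>
    intro a b
    rw [pow_zero, PowerSeries.coeff_one, convPow]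
    split_ifs with h1 h2 h2
    · rw [Polynomial.coeff_one, if_pos h2.1]
    · rw [Polynomial.coeff_one, if_neg (by tauto)]
    · tauto
    · rw [Polynomial.coeff_zero]
  | succ n ih =>
    intro a b
    rw [pow_succ', PowerSeries.coeff_mul, Polynomial.finsetSum_coeff, convPow_succ,
      Finset.sum_comm]
    refine Finset.sum_congr rfl fun r _ => ?_
    rw [Polynomial.coeff_mul]
    exact Finset.sum_congr rfl fun p _ => by rw [coeff_rowSeries hs, ih]

/-- The linear functional `z^a ↦ X a` on polynomials. -/
noncomputable def momentFunctional (X : ℕ → ℂ) : Polynomial ℂ →ₗ[ℂ] ℂ :=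
  Polynomial.lsum fun a => LinearMap.lsmul ℂ ℂ (X a)

lemma momentFunctional_eq_sum (X : ℕ → ℂ) (P : Polynomial ℂ) (M : ℕ) (h : ∀ a, M ≤ a → P.coeff a = 0) :
    momentFunctional X P = ∑ a ∈ Finset.range M, P.coeff a * X a := by
  have h1 : momentFunctional X P = P.sum fun a x => X a * x := by
    simp [momentFunctional, Polynomial.lsum_apply]
  rw [h1, Polynomial.sum_def]
  rw [Finset.sum_subset (s₂ := Finset.range M)]
  · exact Finset.sum_congr rfl fun a _ => mul_comm _ _
  · intro a ha
    by_contra hlt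
    exact (Polynomial.mem_support_iff.mp ha) (h a (by simpa using hlt))
  · intro a _ ha
    rw [Polynomial.notMem_support_iff.mp ha, mul_zero]

/-- The moment functional, applied coefficientwise. -/
noncomputable def momentSeries (X : ℕ → ℂ) (F : PowerSeries (Polynomial ℂ)) : PowerSeries (Polynomial ℂ) :=
  PowerSeries.mk fun b => Polynomial.C (momentFunctional X (PowerSeries.coeff b F))

lemma IsRootExpansion.coeff_ctilde_series {X : ℤ → ℂ} {c : ℕ → ℕ → ℂ} (hc : IsRootExpansion X c)
    (b : ℕ) : PowerSeries.coeff b (rowSeries (ctilde c)) =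
      (∑ n ∈ Finset.range (b + 1), ∑ q ∈ Finset.range (n + 1),
        ((artanhCoeff n : ℂ) * (n.choose q : ℂ) * (-1) ^ (n - q)) •
          PowerSeries.coeff b (rowSeries (halfCoeff c) ^ q *
            momentSeries (fun a => X a) (rowSeries (halfCoeff c) ^ (n - q))))
      - ∑ n ∈ Finset.range (b + 1), (1 / ((n + 1 : ℕ) : ℂ)) •
          PowerSeries.coeff b (rowSeries (halfCoeff c) ^ (n + 1))
      + ∑ n ∈ Finset.range (b + 1), ((-1) ^ n / ((n + 2 : ℕ) : ℂ)) •
          PowerSeries.coeff b (rowSeries (ctilde c) ^ (n + 2)) := by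
  ext a
  rw [coeff_rowSeries hc.ctilde_support, hc.ctilde_eq]
  simp only [Polynomial.coeff_add, Polynomial.coeff_sub, Polynomial.finsetSum_coeff,
    Polynomial.coeff_smul, smul_eq_mul, coeff_rowSeries_pow hc.halfCoeff_support,
    coeff_rowSeries_pow hc.ctilde_support]
  congr 2
  refine Finset.sum_congr rfl fun n _ => Finset.sum_congr rfl fun q _ => ?_
  rw [Finset.sum_comm, PowerSeries.coeff_mul, Polynomial.finsetSum_coeff, Finset.mul_sum]
  refine Finset.sum_congr rfl fun r hr => ?_
  have := Finset.HasAntidiagonal.mem_antidiagonal.mp hr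
  rw [momentSeries, PowerSeries.coeff_mk, Polynomial.coeff_mul_C,
    momentFunctional_eq_sum _ _ (b + 1), Finset.mul_sum, Finset.mul_sum]
  · refine Finset.sum_congr rfl fun a₂ _ => ?_
    rw [coeff_rowSeries_pow hc.halfCoeff_support, coeff_rowSeries_pow hc.halfCoeff_support]
    ring
  · intro a₂ ha₂
    rw [coeff_rowSeries_pow hc.halfCoeff_support,
      convPow_eq_zero_of_support hc.halfCoeff_support _ _ _ (by omega)]

lemma IsRootExpansion.rowSeries_halfCoeff {X : ℤ → ℂ} {c : ℕ → ℕ → ℂ} (hc : IsRootExpansion X c) :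
    rowSeries (halfCoeff c) =
      PowerSeries.X * (PowerSeries.C Polynomial.X * (1 + rowSeries (ctilde c))) := by
  ext b a
  rw [coeff_rowSeries hc.halfCoeff_support]
  rcases b with _ | b
  · rw [hc.halfCoeff_zero_right, PowerSeries.coeff_zero_X_mul, Polynomial.coeff_zero]
  rw [PowerSeries.coeff_succ_X_mul, PowerSeries.coeff_C_mul]
  rcases a with _ | a
  · rw [halfCoeff, hc.zero_left, mul_zero, Polynomial.coeff_X_mul_zero]
  rw [Polynomial.coeff_X_mul, map_add, Polynomial.coeff_add, coeff_rowSeries hc.ctilde_support,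
    PowerSeries.coeff_one]
  by_cases h : a = 0 ∧ b = 0
  · obtain ⟨rfl, rfl⟩ := h
    simp [hc.halfCoeff_one_one, ctilde]
  · rw [hc.halfCoeff_succ_succ a b h]
    split_ifs with hb
    · rw [Polynomial.coeff_one, if_neg (by tauto), zero_add]
    · simp

/-! ### Norms -/

/-- The `ℓ¹` norm of the coefficients of a polynomial. -/
noncomputable def polyNorm (P : Polynomial ℂ) : ℝ := ∑ i ∈ P.support, ‖P.coeff i‖

lemma polyNorm_eq_sum {P : Polynomial ℂ} {s : Finset ℕ} (h : P.support ⊆ s) :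
    polyNorm P = ∑ i ∈ s, ‖P.coeff i‖ :=
  Finset.sum_subset h fun i _ hi => by rw [Polynomial.notMem_support_iff.mp hi, norm_zero]

lemma polyNorm_nonneg (P : Polynomial ℂ) : 0 ≤ polyNorm P :=
  Finset.sum_nonneg fun _ _ => norm_nonneg _

lemma polyNorm_add_le (P Q : Polynomial ℂ) : polyNorm (P + Q) ≤ polyNorm P + polyNorm Q := by
  rw [polyNorm_eq_sum (s := P.support ∪ Q.support) Polynomial.support_add,
    polyNorm_eq_sum (P := P) (s := P.support ∪ Q.support) Finset.subset_union_left,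
    polyNorm_eq_sum (P := Q) (s := P.support ∪ Q.support) Finset.subset_union_right,
    ← Finset.sum_add_distrib]
  exact Finset.sum_le_sum fun i _ => by rw [Polynomial.coeff_add]; exact norm_add_le _ _

lemma polyNorm_zero : polyNorm 0 = 0 := by simp [polyNorm]

lemma polyNorm_sum_le {ι : Type*} (s : Finset ι) (f : ι → Polynomial ℂ) :
    polyNorm (∑ i ∈ s, f i) ≤ ∑ i ∈ s, polyNorm (f i) :=
  Finset.le_sum_of_subadditive polyNorm polyNorm_zero.le polyNorm_add_le s f

lemma polyNorm_smul (x : ℂ) (P : Polynomial ℂ) : polyNorm (x • P) = ‖x‖ * polyNorm P := by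
  rw [polyNorm_eq_sum (Polynomial.support_smul x P), polyNorm, Finset.mul_sum]
  exact Finset.sum_congr rfl fun i _ => by rw [Polynomial.coeff_smul, smul_eq_mul, norm_mul]

lemma polyNorm_neg (P : Polynomial ℂ) : polyNorm (-P) = polyNorm P := by
  rw [← neg_one_smul ℂ P, polyNorm_smul]; simp

lemma polyNorm_sub_le (P Q : Polynomial ℂ) : polyNorm (P - Q) ≤ polyNorm P + polyNorm Q := by
  rw [sub_eq_add_neg, ← polyNorm_neg Q]; exact polyNorm_add_le _ _

lemma polyNorm_monomial (a : ℕ) (x : ℂ) : polyNorm (Polynomial.monomial a x) = ‖x‖ := by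
  rw [polyNorm_eq_sum (s := {a}) (Polynomial.support_monomial_subset a _)]
  simp

lemma polyNorm_C (x : ℂ) : polyNorm (Polynomial.C x) = ‖x‖ := polyNorm_monomial 0 x

lemma polyNorm_mul_le (P Q : Polynomial ℂ) : polyNorm (P * Q) ≤ polyNorm P * polyNorm Q := by
  rw [Polynomial.mul_eq_sum_sum, polyNorm_eq_sum (P := P) subset_rfl, Finset.sum_mul]
  refine (polyNorm_sum_le _ _).trans (Finset.sum_le_sum fun i _ => ?_)
  rw [Polynomial.sum_def, polyNorm_eq_sum (P := Q) subset_rfl, Finset.mul_sum]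
  refine (polyNorm_sum_le _ _).trans (Finset.sum_le_sum fun j _ => ?_)
  rw [polyNorm_monomial, norm_mul]

lemma polyNorm_one : polyNorm 1 = 1 := by
  rw [← Polynomial.C_1, polyNorm_C, norm_one]

lemma polyNorm_X : polyNorm Polynomial.X = 1 := by
  rw [← Polynomial.monomial_one_one_eq_X, polyNorm_monomial, norm_one]

lemma norm_momentFunctional_le {X : ℕ → ℂ} (hX : ∀ a, ‖X a‖ ≤ 1) (P : Polynomial ℂ) :
    ‖momentFunctional X P‖ ≤ polyNorm P := by
  rw [momentFunctional_eq_sum X P (P.natDegree + 1)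
    fun a ha => Polynomial.coeff_eq_zero_of_natDegree_lt (by omega),
    polyNorm_eq_sum (s := Finset.range (P.natDegree + 1)) Polynomial.supp_subset_range_natDegree_succ]
  refine (norm_sum_le _ _).trans (Finset.sum_le_sum fun a _ => ?_)
  rw [norm_mul]
  exact mul_le_of_le_one_right (norm_nonneg _) (hX a)

lemma norm_eval_le {z : ℂ} (hz : ‖z‖ ≤ 1) (P : Polynomial ℂ) : ‖P.eval z‖ ≤ polyNorm P := by
  rw [Polynomial.eval_eq_sum_range,
    polyNorm_eq_sum (s := Finset.range (P.natDegree + 1)) Polynomial.supp_subset_range_natDegree_succ]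
  refine (norm_sum_le _ _).trans (Finset.sum_le_sum fun a _ => ?_)
  rw [norm_mul, norm_pow]
  exact mul_le_of_le_one_right (norm_nonneg _) (pow_le_one₀ (norm_nonneg _) hz)

/-- The weighted `ℓ¹` norm of the truncation of a series to `t`-degrees at most `B`. -/
noncomputable def truncNorm (ρ : ℝ) (B : ℕ) (F : PowerSeries (Polynomial ℂ)) : ℝ :=
  ∑ b ∈ Finset.range (B + 1), polyNorm (PowerSeries.coeff b F) * ρ ^ b

variable {ρ : ℝ}

lemma truncNorm_nonneg (hρ : 0 ≤ ρ) (B : ℕ) (F : PowerSeries (Polynomial ℂ)) : 0 ≤ truncNorm ρ B F :=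
  Finset.sum_nonneg fun _ _ => mul_nonneg (polyNorm_nonneg _) (pow_nonneg hρ _)

lemma sum_antidiagonal_le_mul {f g : ℕ → ℝ} (hf : ∀ n, 0 ≤ f n) (hg : ∀ n, 0 ≤ g n) (M : ℕ) :
    ∑ b ∈ Finset.range M, ∑ r ∈ Finset.HasAntidiagonal.antidiagonal b, f r.1 * g r.2 ≤
      (∑ b ∈ Finset.range M, f b) * ∑ b ∈ Finset.range M, g b := by
  rw [Finset.sum_mul_sum, ← Finset.sum_product', ← Finset.sum_biUnion]
  · refine Finset.sum_le_sum_of_subset_of_nonneg ?_ fun x _ _ => mul_nonneg (hf _) (hg _)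
    intro x hx
    obtain ⟨b, hb, hx⟩ := Finset.mem_biUnion.mp hx
    have := Finset.HasAntidiagonal.mem_antidiagonal.mp hx
    have := Finset.mem_range.mp hb
    rw [Finset.mem_product, Finset.mem_range, Finset.mem_range]
    omega
  · intro i _ j _ hij
    refine Finset.disjoint_left.mpr fun x hx hx' => hij ?_
    rw [← Finset.HasAntidiagonal.mem_antidiagonal.mp hx, Finset.HasAntidiagonal.mem_antidiagonal.mp hx']

lemma truncNorm_mul_le (hρ : 0 ≤ ρ) (B : ℕ) (F G : PowerSeries (Polynomial ℂ)) :
    truncNorm ρ B (F * G) ≤ truncNorm ρ B F * truncNorm ρ B G := by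
  refine le_trans (Finset.sum_le_sum fun b _ => ?_) (sum_antidiagonal_le_mul
    (fun n => mul_nonneg (polyNorm_nonneg _) (pow_nonneg hρ n))
    (fun n => mul_nonneg (polyNorm_nonneg _) (pow_nonneg hρ n)) (B + 1))
  rw [PowerSeries.coeff_mul]
  refine (mul_le_mul_of_nonneg_right (polyNorm_sum_le _ _) (pow_nonneg hρ b)).trans ?_
  rw [Finset.sum_mul]
  refine Finset.sum_le_sum fun r hr => ?_
  rw [← Finset.HasAntidiagonal.mem_antidiagonal.mp hr, pow_add]
  refine (mul_le_mul_of_nonneg_right (polyNorm_mul_le _ _) (by positivity)).trans_eq ?_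
  ring

lemma truncNorm_one (B : ℕ) : truncNorm ρ B 1 = 1 := by
  rw [truncNorm, Finset.sum_range_succ']
  simp [PowerSeries.coeff_one, polyNorm_zero, polyNorm_one]

lemma truncNorm_pow_le (hρ : 0 ≤ ρ) (B : ℕ) (F : PowerSeries (Polynomial ℂ)) (n : ℕ) :
    truncNorm ρ B (F ^ n) ≤ truncNorm ρ B F ^ n := by
  induction n with
  | zero => rw [pow_zero, pow_zero, truncNorm_one]
  | succ n ih =>
    rw [pow_succ, pow_succ]
    exact (truncNorm_mul_le hρ B _ _).trans
      (mul_le_mul_of_nonneg_right ih (truncNorm_nonneg hρ _ _))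

lemma truncNorm_X_mul (B : ℕ) (F : PowerSeries (Polynomial ℂ)) :
    truncNorm ρ (B + 1) (PowerSeries.X * F) = ρ * truncNorm ρ B F := by
  rw [truncNorm, Finset.sum_range_succ', PowerSeries.coeff_zero_X_mul, polyNorm_zero, zero_mul,
    add_zero, truncNorm, Finset.mul_sum]
  exact Finset.sum_congr rfl fun b _ => by rw [PowerSeries.coeff_succ_X_mul]; ring

lemma truncNorm_add_le (hρ : 0 ≤ ρ) (B : ℕ) (F G : PowerSeries (Polynomial ℂ)) :
    truncNorm ρ B (F + G) ≤ truncNorm ρ B F + truncNorm ρ B G := by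
  rw [truncNorm, truncNorm, truncNorm, ← Finset.sum_add_distrib]
  refine Finset.sum_le_sum fun b _ => ?_
  rw [← add_mul, map_add]
  exact mul_le_mul_of_nonneg_right (polyNorm_add_le _ _) (pow_nonneg hρ b)

lemma truncNorm_C (B : ℕ) (P : Polynomial ℂ) : truncNorm ρ B (PowerSeries.C P) = polyNorm P := by
  rw [truncNorm, Finset.sum_range_succ']
  simp [PowerSeries.coeff_C, polyNorm_zero]

lemma truncNorm_momentSeries_le (hρ : 0 ≤ ρ) {X : ℕ → ℂ} (hX : ∀ a, ‖X a‖ ≤ 1) (B : ℕ)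
    (F : PowerSeries (Polynomial ℂ)) : truncNorm ρ B (momentSeries X F) ≤ truncNorm ρ B F := by
  refine Finset.sum_le_sum fun b _ => mul_le_mul_of_nonneg_right ?_ (pow_nonneg hρ b)
  rw [momentSeries, PowerSeries.coeff_mk, polyNorm_C]
  exact norm_momentFunctional_le hX _

lemma truncNorm_pow_succ_le (hρ : 0 ≤ ρ) (B : ℕ) {F : PowerSeries (Polynomial ℂ)}
    (h0 : PowerSeries.coeff 0 F = 0) (n : ℕ) :
    truncNorm ρ (B + 1) (F ^ (n + 1)) ≤ truncNorm ρ (B + 1) F * truncNorm ρ B F ^ n := by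
  obtain ⟨G, rfl⟩ := PowerSeries.X_dvd_iff.mpr (by simpa using h0)
  rw [pow_succ', mul_assoc, truncNorm_X_mul, truncNorm_X_mul, mul_assoc]
  refine mul_le_mul_of_nonneg_left ((truncNorm_mul_le hρ _ _ _).trans ?_) hρ
  exact mul_le_mul_of_nonneg_left (truncNorm_pow_le hρ _ _ _) (truncNorm_nonneg hρ _ _)

lemma truncNorm_mono (hρ : 0 ≤ ρ) {B B' : ℕ} (h : B ≤ B') (F : PowerSeries (Polynomial ℂ)) :
    truncNorm ρ B F ≤ truncNorm ρ B' F :=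
  Finset.sum_le_sum_of_subset_of_nonneg (Finset.range_mono (by omega))
    fun b _ _ => mul_nonneg (polyNorm_nonneg _) (pow_nonneg hρ b)

lemma truncNorm_le_sum (hρ : 0 ≤ ρ) {ι : Type*} (s : Finset ι) (w : ι → ℝ) (B : ℕ)
    (F : PowerSeries (Polynomial ℂ)) (G : ι → PowerSeries (Polynomial ℂ))
    (h : ∀ b ≤ B, polyNorm (PowerSeries.coeff b F) ≤
      ∑ i ∈ s, w i * polyNorm (PowerSeries.coeff b (G i))) :
    truncNorm ρ B F ≤ ∑ i ∈ s, w i * truncNorm ρ B (G i) := by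
  simp only [truncNorm, Finset.mul_sum]
  rw [Finset.sum_comm]
  refine Finset.sum_le_sum fun b hb => ?_
  have := Finset.mem_range.mp hb
  refine (mul_le_mul_of_nonneg_right (h b (by omega)) (pow_nonneg hρ b)).trans_eq ?_
  rw [Finset.sum_mul]
  exact Finset.sum_congr rfl fun i _ => by ring

/-- The formal composition `∑ g_n F^n` for a power series `F` without constant term. -/
noncomputable def seriesComp {A : Type*} [CommRing A] [Algebra ℂ A] (g : ℕ → ℂ) (F : PowerSeries A) :
    PowerSeries A :=
  PowerSeries.mk fun b => ∑ n ∈ Finset.range (b + 1), g n • PowerSeries.coeff b (F ^ n)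

lemma truncNorm_seriesComp_le (hρ : 0 ≤ ρ) (g : ℕ → ℂ) (B : ℕ) (F : PowerSeries (Polynomial ℂ)) :
    truncNorm ρ B (seriesComp g F) ≤ ∑ n ∈ Finset.range (B + 1), ‖g n‖ * truncNorm ρ B F ^ n := by
  refine (truncNorm_le_sum hρ _ (fun n => ‖g n‖) B _ (fun n => F ^ n) fun b hb => ?_).trans
    (Finset.sum_le_sum fun n _ => mul_le_mul_of_nonneg_left (truncNorm_pow_le hρ _ _ _)
      (norm_nonneg _))
  rw [seriesComp, PowerSeries.coeff_mk]
  refine (polyNorm_sum_le _ _).trans ?_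
  simp only [polyNorm_smul]
  exact Finset.sum_le_sum_of_subset_of_nonneg (Finset.range_mono (by omega))
    fun n _ _ => mul_nonneg (norm_nonneg _) (polyNorm_nonneg _)

lemma sum_range_mul_pow_le {g : ℕ → ℝ} {C x : ℝ} (h0 : g 0 = 0) (hC : 0 ≤ C) (hg : ∀ n, g n ≤ C)
    (hx : 0 ≤ x) (hx1 : x < 1) (M : ℕ) :
    ∑ n ∈ Finset.range M, g n * x ^ n ≤ C * (x / (1 - x)) := by
  have hx2 : 0 < 1 - x := by linarith
  rcases M with _ | M
  · simp only [Finset.range_zero, Finset.sum_empty]; positivity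
  rw [Finset.sum_range_succ', h0, zero_mul, add_zero]
  calc ∑ n ∈ Finset.range M, g (n + 1) * x ^ (n + 1)
      ≤ ∑ n ∈ Finset.range M, C * x * x ^ n := Finset.sum_le_sum fun n _ => by
        rw [pow_succ', ← mul_assoc]
        exact mul_le_mul_of_nonneg_right (mul_le_mul_of_nonneg_right (hg _) hx) (by positivity)
    _ = C * x * ∑ n ∈ Finset.range M, x ^ n := by rw [Finset.mul_sum]
    _ ≤ C * x * (1 - x)⁻¹ := mul_le_mul_of_nonneg_left
        (((summable_geometric_of_lt_one hx hx1).sum_le_tsum _ fun n _ => by positivity).trans_eq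
          (tsum_geometric_of_lt_one hx hx1)) (by positivity)
    _ = C * (x / (1 - x)) := by ring

lemma abs_artanhCoeff_le (n : ℕ) : |(artanhCoeff n : ℝ)| ≤ 2 * 2 ^ n := by
  rw [artanhCoeff]
  split_ifs with h
  · have : (1 : ℝ) ≤ n := by exact_mod_cast h.pos
    push_cast
    rw [abs_div, abs_neg, abs_of_nonneg (by positivity : (0 : ℝ) ≤ 2 ^ (n + 1)), Nat.abs_cast,
      pow_succ, mul_comm (2 : ℝ)]
    exact div_le_self (by positivity) this
  · simp

section Bounds

variable {X : ℤ → ℂ} {c : ℕ → ℕ → ℂ}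

lemma IsRootExpansion.truncNorm_ctilde_le_sum (hc : IsRootExpansion X c) (hX : ∀ a : ℤ, ‖X a‖ ≤ 1)
    (hρ : 0 ≤ ρ) (B : ℕ) :
    truncNorm ρ B (rowSeries (ctilde c)) ≤
      ∑ n ∈ Finset.range (B + 1), (
        |(artanhCoeff n : ℝ)| * (2 * truncNorm ρ B (rowSeries (halfCoeff c))) ^ n
        + 1 / (n + 1) * truncNorm ρ B (rowSeries (halfCoeff c)) ^ (n + 1)
        + 1 / (n + 2) * truncNorm ρ B (rowSeries (ctilde c) ^ (n + 2))) := by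
  set D := rowSeries (halfCoeff c) with hD
  set U := rowSeries (ctilde c) with hU
  have h1 : truncNorm ρ B U ≤ ∑ b ∈ Finset.range (B + 1), (∑ n ∈ Finset.range (B + 1),
      (∑ q ∈ Finset.range (n + 1), |(artanhCoeff n : ℝ)| * (n.choose q : ℝ) *
          polyNorm (PowerSeries.coeff b (D ^ q * momentSeries (fun a => X a) (D ^ (n - q))))
        + 1 / (n + 1) * polyNorm (PowerSeries.coeff b (D ^ (n + 1)))
        + 1 / (n + 2) * polyNorm (PowerSeries.coeff b (U ^ (n + 2))))) * ρ ^ b := by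
    refine Finset.sum_le_sum fun b hb => mul_le_mul_of_nonneg_right ?_ (pow_nonneg hρ b)
    have hb' := Finset.mem_range.mp hb
    rw [hU, hc.coeff_ctilde_series]
    refine (polyNorm_add_le _ _).trans ((add_le_add_left (polyNorm_sub_le _ _) _).trans ?_)
    refine (add_le_add (add_le_add (polyNorm_sum_le _ _) (polyNorm_sum_le _ _))
      (polyNorm_sum_le _ _)).trans ?_
    rw [← Finset.sum_add_distrib, ← Finset.sum_add_distrib]
    refine le_trans (Finset.sum_le_sum fun n _ => ?_) (Finset.sum_le_sum_of_subset_of_nonneg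
      (Finset.range_mono hb') fun n _ _ => ?_)
    · refine add_le_add (add_le_add ((polyNorm_sum_le _ _).trans
        (Finset.sum_le_sum fun q _ => ?_)) ?_) ?_
      · rw [polyNorm_smul, norm_mul, norm_mul, norm_pow, norm_neg, norm_one, one_pow, mul_one,
          Complex.norm_natCast]
        apply le_of_eq
        congr 2
        rw [← Complex.ofReal_ratCast, Complex.norm_real, Real.norm_eq_abs]
      · rw [polyNorm_smul, norm_div, norm_one, Complex.norm_natCast]
        push_cast; rfl
      · rw [polyNorm_smul, norm_div, norm_pow, norm_neg, norm_one, one_pow, Complex.norm_natCast]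
        push_cast; rfl
    · have := polyNorm_nonneg
      exact add_nonneg (add_nonneg (Finset.sum_nonneg fun q _ => mul_nonneg (by positivity)
        (this _)) (mul_nonneg (by positivity) (this _))) (mul_nonneg (by positivity) (this _))
  refine h1.trans ?_
  simp only [Finset.sum_mul]
  rw [Finset.sum_comm]
  refine Finset.sum_le_sum fun n _ => ?_
  simp only [add_mul, Finset.sum_add_distrib, Finset.sum_mul]
  refine add_le_add (add_le_add ?_ ?_) ?_
  · rw [Finset.sum_comm]
    have h2 : (2 * truncNorm ρ B D) ^ n =
        ∑ q ∈ Finset.range (n + 1), truncNorm ρ B D ^ q * truncNorm ρ B D ^ (n - q) * n.choose q := by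
      rw [two_mul, add_pow]
    rw [h2, Finset.mul_sum]
    refine Finset.sum_le_sum fun q _ => ?_
    have h3 := (truncNorm_mul_le hρ B (D ^ q) (momentSeries (fun a => X a) (D ^ (n - q)))).trans
      (mul_le_mul (truncNorm_pow_le hρ B D q) ((truncNorm_momentSeries_le hρ (fun a => hX a) B _).trans
        (truncNorm_pow_le hρ B D (n - q))) (truncNorm_nonneg hρ _ _)
        (pow_nonneg (truncNorm_nonneg hρ _ _) _))
    simp only [mul_assoc (|(artanhCoeff n : ℝ)| * (n.choose q : ℝ)), ← Finset.mul_sum]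
    rw [mul_comm _ (n.choose q : ℝ), mul_assoc, mul_left_comm, mul_comm (_ * _) (n.choose q : ℝ)]
    have := mul_le_mul_of_nonneg_left h3 (by positivity : 0 ≤ |(artanhCoeff n : ℝ)| * (n.choose q : ℝ))
    rw [mul_assoc, mul_assoc] at this
    exact this
  · simp only [mul_assoc, ← Finset.mul_sum]
    exact mul_le_mul_of_nonneg_left (truncNorm_pow_le hρ B D (n + 1)) (by positivity)
  · simp only [mul_assoc, ← Finset.mul_sum]
    exact le_rfl

lemma IsRootExpansion.coeff_zero_ctilde_series (hc : IsRootExpansion X c) :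
    PowerSeries.coeff 0 (rowSeries (ctilde c)) = 0 := by
  ext a
  rw [coeff_rowSeries hc.ctilde_support, hc.isTriangular.first_row, Polynomial.coeff_zero]

lemma IsRootExpansion.truncNorm_halfCoeff_succ_le (hc : IsRootExpansion X c) (hρ : 0 ≤ ρ) (B : ℕ) :
    truncNorm ρ (B + 1) (rowSeries (halfCoeff c)) ≤
      ρ * (1 + truncNorm ρ B (rowSeries (ctilde c))) := by
  rw [hc.rowSeries_halfCoeff, truncNorm_X_mul]
  refine mul_le_mul_of_nonneg_left ((truncNorm_mul_le hρ _ _ _).trans ?_) hρ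
  rw [truncNorm_C, polyNorm_X, one_mul]
  exact (truncNorm_add_le hρ _ _ _).trans_eq (by rw [truncNorm_one])

lemma IsRootExpansion.truncNorm_ctilde_le (hc : IsRootExpansion X c) (hX : ∀ a : ℤ, ‖X a‖ ≤ 1)
    (B : ℕ) : truncNorm (1 / 100) B (rowSeries (ctilde c)) ≤ 1 / 4 := by
  have hρ : (0 : ℝ) ≤ 1 / 100 := by norm_num
  induction B with
  | zero =>
    rw [truncNorm, Finset.sum_range_one, hc.coeff_zero_ctilde_series, polyNorm_zero]
    norm_num
  | succ B ih =>
    have hs := hc.truncNorm_halfCoeff_succ_le hρ B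
    have hx := hc.truncNorm_ctilde_le_sum hX hρ (B + 1)
    have hs0 := truncNorm_nonneg hρ (B + 1) (rowSeries (halfCoeff c))
    have hx0 := truncNorm_nonneg hρ (B + 1) (rowSeries (ctilde c))
    have hy0 := truncNorm_nonneg hρ B (rowSeries (ctilde c))
    have hp := fun n => truncNorm_pow_succ_le hρ B hc.coeff_zero_ctilde_series (n + 1)
    generalize truncNorm (1 / 100) (B + 1) (rowSeries (halfCoeff c)) = s at *
    generalize truncNorm (1 / 100) (B + 1) (rowSeries (ctilde c)) = x at *
    generalize truncNorm (1 / 100) B (rowSeries (ctilde c)) = y at *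
    have hs1 : s ≤ 1 / 80 := by linarith
    rw [Finset.sum_add_distrib, Finset.sum_add_distrib] at hx
    have b1 : ∑ n ∈ Finset.range (B + 1 + 1), |(artanhCoeff n : ℝ)| * (2 * s) ^ n ≤ 2 / 19 := by
      have h := sum_range_mul_pow_le (g := fun n => |(artanhCoeff n : ℝ)| / 2 ^ n) (C := 2)
        (x := 4 * s) (by simp [artanhCoeff]) (by norm_num) (fun n => by
          rw [div_le_iff₀ (by positivity)]; exact abs_artanhCoeff_le n) (by linarith) (by linarith)
        (B + 1 + 1)
      have h' : 2 * (4 * s / (1 - 4 * s)) ≤ 2 / 19 := by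
        rw [← mul_div_assoc, div_le_div_iff₀ (by linarith) (by norm_num)]; linarith
      refine le_trans (le_of_eq (Finset.sum_congr rfl fun n _ => ?_)) (h.trans h')
      rw [show 4 * s = 2 * (2 * s) by ring, mul_pow 2 (2 * s)]
      field_simp
    have b2 : ∑ n ∈ Finset.range (B + 1 + 1), 1 / ((n : ℝ) + 1) * s ^ (n + 1) ≤ 1 / 79 := by
      have h := sum_range_mul_pow_le (g := fun n => 1 / (n : ℝ)) (C := 1)
        (x := s) (by simp) (by norm_num) (fun n => by
          rcases Nat.eq_zero_or_pos n with rfl | hn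
          · simp
          · have : (1 : ℝ) ≤ n := by exact_mod_cast hn
            rw [div_le_iff₀ (by linarith)]; linarith) hs0 (by linarith) (B + 1 + 1 + 1)
      rw [Finset.sum_range_succ'] at h
      simp only [Nat.cast_zero, div_zero, zero_mul, add_zero, Nat.cast_succ] at h
      have h' : 1 * (s / (1 - s)) ≤ 1 / 79 := by
        rw [one_mul, div_le_div_iff₀ (by linarith) (by norm_num)]; linarith
      exact h.trans h'
    have b3 : ∑ n ∈ Finset.range (B + 1 + 1), 1 / ((n : ℝ) + 2) *
        truncNorm (1 / 100) (B + 1) (rowSeries (ctilde c) ^ (n + 2)) ≤ x / 6 := by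
      have h := sum_range_mul_pow_le (g := fun n => if n = 0 then 0 else 1 / ((n : ℝ) + 1))
        (C := 1 / 2) (x := y) (by simp) (by norm_num) (fun n => by
          split_ifs with hn
          · norm_num
          · have : (1 : ℝ) ≤ n := by exact_mod_cast Nat.one_le_iff_ne_zero.mpr hn
            rw [div_le_div_iff₀ (by linarith) (by norm_num)]; linarith) hy0 (by linarith)
          (B + 1 + 1 + 1)
      rw [Finset.sum_range_succ'] at h
      simp only [if_true, zero_mul, add_zero, Nat.cast_succ, Nat.succ_ne_zero, if_false] at h
      have h' : 1 / 2 * (y / (1 - y)) ≤ 1 / 6 := by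
        rw [one_div_mul_eq_div, div_div, div_le_div_iff₀ (by linarith) (by norm_num)]; linarith
      calc _ ≤ ∑ n ∈ Finset.range (B + 1 + 1), x * (1 / ((n : ℝ) + 1 + 1) * y ^ (n + 1)) := by
            refine Finset.sum_le_sum fun n _ => ?_
            have := mul_le_mul_of_nonneg_left (hp n) (by positivity : (0 : ℝ) ≤ 1 / ((n : ℝ) + 2))
            refine this.trans (le_of_eq ?_)
            ring
        _ ≤ x * (1 / 6) := by
            rw [← Finset.mul_sum]
            exact mul_le_mul_of_nonneg_left (h.trans h') hx0
        _ = x / 6 := by ring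
    linarith

lemma IsRootExpansion.truncNorm_halfCoeff_le (hc : IsRootExpansion X c) (hX : ∀ a : ℤ, ‖X a‖ ≤ 1)
    (B : ℕ) : truncNorm (1 / 100) B (rowSeries (halfCoeff c)) ≤ 1 / 80 := by
  have hρ : (0 : ℝ) ≤ 1 / 100 := by norm_num
  have h1 := truncNorm_mono hρ (Nat.le_succ B) (rowSeries (halfCoeff c))
  have h2 := hc.truncNorm_halfCoeff_succ_le hρ B
  have h3 := hc.truncNorm_ctilde_le hX B
  rw [← Nat.succ_eq_add_one] at h2
  linarith

end Bounds

end TwistedBethe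

namespace TwistedBethe

/-! ### Evaluation of power series -/

/-- The power series `F` converges absolutely at `t`, with sum of absolute values at most `s`. -/
def AbsEval (t : ℂ) (s : ℝ) (F : PowerSeries ℂ) : Prop :=
  Summable (fun b => ‖PowerSeries.coeff b F * t ^ b‖) ∧
    ∑' b, ‖PowerSeries.coeff b F * t ^ b‖ ≤ s

/-- The value of a power series at `t`. -/
noncomputable def seriesEval (t : ℂ) (F : PowerSeries ℂ) : ℂ :=
  ∑' b, PowerSeries.coeff b F * t ^ b

section Eval

variable {t : ℂ} {s s' : ℝ} {F G : PowerSeries ℂ}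

lemma AbsEval.hasSum (h : AbsEval t s F) :
    HasSum (fun b => PowerSeries.coeff b F * t ^ b) (seriesEval t F) := h.1.of_norm.hasSum

lemma AbsEval.norm_le (h : AbsEval t s F) : ‖seriesEval t F‖ ≤ s :=
  (norm_tsum_le_tsum_norm h.1).trans h.2

lemma AbsEval.nonneg (h : AbsEval t s F) : 0 ≤ s :=
  (tsum_nonneg fun _ => norm_nonneg _).trans h.2

lemma coeff_mul_mul_pow (F G : PowerSeries ℂ) (b : ℕ) :
    PowerSeries.coeff b (F * G) * t ^ b = ∑ r ∈ Finset.HasAntidiagonal.antidiagonal b,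
      (PowerSeries.coeff r.1 F * t ^ r.1) * (PowerSeries.coeff r.2 G * t ^ r.2) := by
  rw [PowerSeries.coeff_mul, Finset.sum_mul]
  refine Finset.sum_congr rfl fun r hr => ?_
  rw [← Finset.HasAntidiagonal.mem_antidiagonal.mp hr, pow_add]
  ring

lemma AbsEval.mul (hF : AbsEval t s F) (hG : AbsEval t s' G) :
    AbsEval t (s * s') (F * G) ∧ seriesEval t (F * G) = seriesEval t F * seriesEval t G := by
  have h1 := summable_norm_sum_mul_antidiagonal_of_summable_norm hF.1 hG.1
  refine ⟨⟨?_, ?_⟩, ?_⟩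
  · simpa only [coeff_mul_mul_pow] using h1
  · have hF' : Summable fun b => ‖‖PowerSeries.coeff b F * t ^ b‖‖ := by simpa using hF.1
    have hG' : Summable fun b => ‖‖PowerSeries.coeff b G * t ^ b‖‖ := by simpa using hG.1
    have h2 := tsum_mul_tsum_eq_tsum_sum_antidiagonal_of_summable_norm hF' hG'
    have h3 := (summable_norm_sum_mul_antidiagonal_of_summable_norm hF' hG').of_norm
    refine le_trans ?_ (mul_le_mul hF.2 hG.2 (tsum_nonneg fun _ => norm_nonneg _) hF.nonneg)
    rw [h2]
    simp only [coeff_mul_mul_pow]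
    refine h1.tsum_le_tsum (fun b => ?_) h3
    refine (norm_sum_le _ _).trans_eq (Finset.sum_congr rfl fun r _ => norm_mul _ _)
  · rw [seriesEval, seriesEval, seriesEval,
      tsum_mul_tsum_eq_tsum_sum_antidiagonal_of_summable_norm hF.1 hG.1]
    simp only [coeff_mul_mul_pow]

lemma AbsEval.sub (hF : AbsEval t s F) (hG : AbsEval t s' G) :
    AbsEval t (s + s') (F - G) ∧ seriesEval t (F - G) = seriesEval t F - seriesEval t G := by
  have h1 : ∀ b, ‖PowerSeries.coeff b (F - G) * t ^ b‖ ≤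
      ‖PowerSeries.coeff b F * t ^ b‖ + ‖PowerSeries.coeff b G * t ^ b‖ := fun b => by
    rw [map_sub, sub_mul]; exact norm_sub_le _ _
  have h2 : Summable (fun b => ‖PowerSeries.coeff b (F - G) * t ^ b‖) :=
    Summable.of_nonneg_of_le (fun _ => norm_nonneg _) h1 (hF.1.add hG.1)
  refine ⟨⟨h2, ?_⟩, ?_⟩
  · exact (h2.tsum_le_tsum h1 (hF.1.add hG.1)).trans
      ((hF.1.tsum_add hG.1).trans_le (add_le_add hF.2 hG.2))
  · rw [seriesEval, seriesEval, seriesEval, ← hF.1.of_norm.tsum_sub hG.1.of_norm]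
    simp only [map_sub, sub_mul]

lemma absEval_C (x : ℂ) : AbsEval t ‖x‖ (PowerSeries.C x) ∧ seriesEval t (PowerSeries.C x) = x := by
  have h0 : ∀ b, b ≠ 0 → PowerSeries.coeff b (PowerSeries.C x) * t ^ b = 0 := fun b hb => by
    rw [PowerSeries.coeff_C, if_neg hb, zero_mul]
  have h1 := hasSum_single (f := fun b => ‖PowerSeries.coeff b (PowerSeries.C x) * t ^ b‖) 0
    fun b hb => by rw [h0 b hb, norm_zero]
  have h2 := hasSum_single (f := fun b => PowerSeries.coeff b (PowerSeries.C x) * t ^ b) 0 h0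
  simp only [PowerSeries.coeff_zero_C, pow_zero, mul_one] at h1 h2
  exact ⟨⟨h1.summable, h1.tsum_eq.le⟩, h2.tsum_eq⟩

lemma seriesEval_X_mul (h : AbsEval t s F) :
    seriesEval t (PowerSeries.X * F) = t * seriesEval t F := by
  have h1 : HasSum (fun b => PowerSeries.coeff (b + 1) (PowerSeries.X * F) * t ^ (b + 1))
      (t * seriesEval t F) := by
    refine hasSum_of_forall_eq (h.hasSum.mul_left t) fun b => ?_
    rw [PowerSeries.coeff_succ_X_mul]; ring
  have h2 := (hasSum_nat_add_iff (f := fun b => PowerSeries.coeff b (PowerSeries.X * F) * t ^ b) 1).mp h1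
  simp only [Finset.sum_range_one, PowerSeries.coeff_zero_X_mul, zero_mul, add_zero] at h2
  exact h2.tsum_eq

lemma AbsEval.pow (hF : AbsEval t s F) (n : ℕ) :
    AbsEval t (s ^ n) (F ^ n) ∧ seriesEval t (F ^ n) = seriesEval t F ^ n := by
  induction n with
  | zero =>
    have := absEval_C (t := t) 1
    rw [norm_one, map_one] at this
    simpa using this
  | succ n ih =>
    have := ih.1.mul hF
    rw [ih.2] at this
    simpa only [pow_succ] using this

lemma coeff_pow_eq_zero {A : Type*} [CommRing A] {F : PowerSeries A}
    (h0 : PowerSeries.coeff 0 F = 0) {n b : ℕ} (h : b < n) : PowerSeries.coeff b (F ^ n) = 0 :=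
  PowerSeries.X_pow_dvd_iff.mp (pow_dvd_pow_of_dvd
    (PowerSeries.X_dvd_iff.mpr (by simpa using h0)) n) b h

lemma coeff_seriesComp {A : Type*} [CommRing A] [Algebra ℂ A] {F : PowerSeries A}
    (h0 : PowerSeries.coeff 0 F = 0) (g : ℕ → ℂ) {b M : ℕ} (h : b < M) :
    PowerSeries.coeff b (seriesComp g F) =
      ∑ n ∈ Finset.range M, g n • PowerSeries.coeff b (F ^ n) := by
  rw [seriesComp, PowerSeries.coeff_mk]
  refine Finset.sum_subset (Finset.range_mono h) fun n _ hn => ?_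
  rw [coeff_pow_eq_zero h0 (by simpa using hn), smul_zero]

lemma AbsEval.seriesComp (hF : AbsEval t s F) (h0 : PowerSeries.coeff 0 F = 0) {g : ℕ → ℂ}
    (hg : Summable fun n => ‖g n‖ * s ^ n) :
    HasSum (fun b => PowerSeries.coeff b (seriesComp g F) * t ^ b)
      (∑' n, g n * seriesEval t F ^ n) := by
  let f : ℕ × ℕ → ℂ := fun p => g p.1 * (PowerSeries.coeff p.2 (F ^ p.1) * t ^ p.2)
  have hrow : ∀ n, HasSum (fun b => f (n, b)) (g n * seriesEval t F ^ n) := fun n => by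
    rw [← (hF.pow n).2]
    exact (hF.pow n).1.hasSum.mul_left (g n)
  have hs : Summable fun p => ‖f p‖ := by
    rw [summable_prod_of_nonneg fun p => norm_nonneg _]
    constructor
    · intro n
      simp only [f, norm_mul (g n)]
      exact (hF.pow n).1.1.mul_left _
    · refine Summable.of_nonneg_of_le (fun n => tsum_nonneg fun _ => norm_nonneg _) (fun n => ?_) hg
      simp only [f, norm_mul (g n), tsum_mul_left]
      exact mul_le_mul_of_nonneg_left (hF.pow n).1.2 (norm_nonneg _)
  have h1 := hs.of_norm.hasSum
  have h2 := h1.prod_fiberwise hrow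
  rw [h2.tsum_eq]
  have h3 := (Equiv.prodComm ℕ ℕ).hasSum_iff.mpr h1
  refine h3.prod_fiberwise fun b => ?_
  rw [coeff_seriesComp h0 g (Nat.lt_succ_self b), Finset.sum_mul]
  refine hasSum_of_forall_eq (hasSum_sum_of_ne_finset_zero
    (f := fun n => g n • PowerSeries.coeff b (F ^ n) * t ^ b) fun n hn => ?_) fun n => ?_
  · rw [coeff_pow_eq_zero h0 (by simpa using hn), smul_zero, zero_mul]
  · simp [f, mul_assoc]

end Eval

/-- Evaluation of the coefficients of a series at `z`. -/
noncomputable def evalCoeff (z : ℂ) : PowerSeries (Polynomial ℂ) →+* PowerSeries ℂ :=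
  PowerSeries.map (Polynomial.evalRingHom z)

lemma coeff_evalCoeff (z : ℂ) (F : PowerSeries (Polynomial ℂ)) (b : ℕ) :
    PowerSeries.coeff b (evalCoeff z F) = (PowerSeries.coeff b F).eval z := by
  rw [evalCoeff, PowerSeries.coeff_map]; rfl

lemma evalCoeff_seriesComp (z : ℂ) (g : ℕ → ℂ) (F : PowerSeries (Polynomial ℂ)) :
    evalCoeff z (seriesComp g F) = seriesComp g (evalCoeff z F) := by
  ext b
  rw [coeff_evalCoeff, seriesComp, seriesComp, PowerSeries.coeff_mk, PowerSeries.coeff_mk,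
    Polynomial.eval_finsetSum]
  refine Finset.sum_congr rfl fun n _ => ?_
  rw [Polynomial.eval_smul, ← map_pow, coeff_evalCoeff]

lemma absEval_evalCoeff {ρ s : ℝ} {F : PowerSeries (Polynomial ℂ)}
    (hF : ∀ B, truncNorm ρ B F ≤ s) {z t : ℂ} (hz : ‖z‖ ≤ 1) (ht : ‖t‖ ≤ ρ) :
    AbsEval t s (evalCoeff z F) := by
  have hρ : 0 ≤ ρ := (norm_nonneg _).trans ht
  have h1 : ∀ b, ‖PowerSeries.coeff b (evalCoeff z F) * t ^ b‖ ≤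
      polyNorm (PowerSeries.coeff b F) * ρ ^ b := fun b => by
    rw [norm_mul, norm_pow, coeff_evalCoeff]
    exact mul_le_mul (norm_eval_le hz _) (pow_le_pow_left₀ (norm_nonneg _) ht b) (by positivity)
      (polyNorm_nonneg _)
  have h2 : ∀ B, ∑ b ∈ Finset.range B, ‖PowerSeries.coeff b (evalCoeff z F) * t ^ b‖ ≤ s := fun B =>
    (Finset.sum_le_sum fun b _ => h1 b).trans ((Finset.sum_le_sum_of_subset_of_nonneg
      (Finset.range_mono (Nat.le_succ B)) fun b _ _ => mul_nonneg (polyNorm_nonneg _)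
        (pow_nonneg hρ b)).trans (hF B))
  have h3 := summable_of_sum_range_le (fun _ => norm_nonneg _) h2
  exact ⟨h3, h3.tsum_le_of_sum_range_le h2⟩

/-! ### The equation solved by the generating series for empirical moments -/

/-- The moments of the empirical measure `(1 / L) ∑ δ_{z_k}`. -/
noncomputable def empiricalMoment (L : ℕ) {N : ℕ} (z : Fin N → ℂ) (a : ℤ) : ℂ :=
  1 / (L : ℂ) * ∑ k, z k ^ a

lemma norm_empiricalMoment_le {L N : ℕ} {z : Fin N → ℂ} (hz : ∀ k, ‖z k‖ = 1) (hNL : N ≤ L) (a : ℤ) :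
    ‖empiricalMoment L z a‖ ≤ 1 := by
  rw [empiricalMoment, norm_mul, norm_div, norm_one, Complex.norm_natCast, one_div_mul_eq_div]
  refine div_le_one_of_le₀ ((norm_sum_le _ _).trans ?_) (Nat.cast_nonneg _)
  simp only [norm_zpow, hz, one_zpow, Finset.sum_const, Finset.card_univ, Fintype.card_fin,
    nsmul_eq_mul, mul_one]
  exact_mod_cast hNL

lemma momentFunctional_empiricalMoment (L : ℕ) {N : ℕ} (z : Fin N → ℂ) (P : Polynomial ℂ) :
    momentFunctional (fun a : ℕ => empiricalMoment L z a) P = 1 / (L : ℂ) * ∑ k, P.eval (z k) := by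
  rw [momentFunctional_eq_sum _ _ (P.natDegree + 1)
    fun a ha => Polynomial.coeff_eq_zero_of_natDegree_lt (by omega)]
  simp only [Polynomial.eval_eq_sum_range, empiricalMoment, zpow_natCast, Finset.mul_sum]
  rw [Finset.sum_comm]
  exact Finset.sum_congr rfl fun k _ => Finset.sum_congr rfl fun a _ => by ring

/-- The Taylor coefficients of `log (1 + x)`. -/
noncomputable def logCoeff (n : ℕ) : ℂ := (-1) ^ (n + 1) / n

section Empirical

variable {L N : ℕ} {z : Fin N → ℂ} {c : ℕ → ℕ → ℂ}

lemma IsRootExpansion.coeff_zero_halfCoeff_series {X : ℤ → ℂ} (hc : IsRootExpansion X c) :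
    PowerSeries.coeff 0 (rowSeries (halfCoeff c)) = 0 := by
  ext a
  rw [coeff_rowSeries hc.halfCoeff_support, hc.halfCoeff_zero_right, Polynomial.coeff_zero]

lemma coeff_zero_evalCoeff {F : PowerSeries (Polynomial ℂ)} (h : PowerSeries.coeff 0 F = 0) (w : ℂ) :
    PowerSeries.coeff 0 (evalCoeff w F) = 0 := by
  rw [coeff_evalCoeff, h, Polynomial.eval_zero]

lemma coeff_sub_pow (F G : PowerSeries ℂ) (n b : ℕ) :
    PowerSeries.coeff b ((F - G) ^ n) = ∑ q ∈ Finset.range (n + 1),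
      ((n.choose q : ℂ) * (-1) ^ (n - q)) * PowerSeries.coeff b (F ^ q * G ^ (n - q)) := by
  rw [sub_eq_add_neg, add_pow, map_sum]
  refine Finset.sum_congr rfl fun q _ => ?_
  have : F ^ q * (-G) ^ (n - q) * (n.choose q : PowerSeries ℂ) =
      PowerSeries.C ((n.choose q : ℂ) * (-1) ^ (n - q)) * (F ^ q * G ^ (n - q)) := by
    rw [neg_pow, map_mul, map_pow, map_neg, map_one, map_natCast]
    ring
  rw [this, PowerSeries.coeff_C_mul]

lemma IsRootExpansion.coeff_log_eq (hc : IsRootExpansion (empiricalMoment L z) c) (w : ℂ) (b : ℕ) :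
    PowerSeries.coeff b (seriesComp logCoeff (evalCoeff w (rowSeries (ctilde c)))) =
      1 / (L : ℂ) * ∑ l, PowerSeries.coeff b (seriesComp (fun n => (artanhCoeff n : ℂ))
          (evalCoeff w (rowSeries (halfCoeff c)) - evalCoeff (z l) (rowSeries (halfCoeff c))))
      - PowerSeries.coeff b (seriesComp (fun n => 1 / (n : ℂ))
          (evalCoeff w (rowSeries (halfCoeff c)))) := by
  have hU := congrArg (Polynomial.eval w) (hc.coeff_ctilde_series b)
  rw [← coeff_evalCoeff] at hU
  have hU0 := coeff_zero_evalCoeff hc.coeff_zero_ctilde_series w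
  have hD0 := coeff_zero_evalCoeff hc.coeff_zero_halfCoeff_series
  have hA := coeff_seriesComp hU0 logCoeff (by omega : b < b + 1 + 1 + 1)
  rw [Finset.sum_range_succ', Finset.sum_range_succ'] at hA
  have hB := coeff_seriesComp (hD0 w) (fun n => 1 / (n : ℂ)) (by omega : b < b + 1 + 1)
  rw [Finset.sum_range_succ'] at hB
  rw [hA, hB]
  simp only [Polynomial.eval_add, Polynomial.eval_sub, Polynomial.eval_finsetSum,
    Polynomial.eval_smul, ← coeff_evalCoeff, map_mul, map_pow, smul_eq_mul] at hU
  simp only [zero_add, pow_one, logCoeff, smul_eq_mul, Nat.cast_zero, div_zero, zero_mul, add_zero]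
  rw [hU]
  have e1 : ∀ n q : ℕ, PowerSeries.coeff b (evalCoeff w (rowSeries (halfCoeff c)) ^ q *
      evalCoeff w (momentSeries (fun a : ℕ => empiricalMoment L z a)
        (rowSeries (halfCoeff c) ^ (n - q)))) =
      1 / (L : ℂ) * ∑ l, PowerSeries.coeff b (evalCoeff w (rowSeries (halfCoeff c)) ^ q *
        evalCoeff (z l) (rowSeries (halfCoeff c)) ^ (n - q)) := by
    intro n q
    simp only [PowerSeries.coeff_mul]
    rw [Finset.sum_comm, Finset.mul_sum]
    refine Finset.sum_congr rfl fun r _ => ?_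
    rw [coeff_evalCoeff w (momentSeries _ _), momentSeries, PowerSeries.coeff_mk, Polynomial.eval_C,
      momentFunctional_empiricalMoment, mul_left_comm, Finset.mul_sum]
    simp only [← coeff_evalCoeff, map_pow]
  have e2 : ∀ l, PowerSeries.coeff b (seriesComp (fun n => (artanhCoeff n : ℂ))
          (evalCoeff w (rowSeries (halfCoeff c)) - evalCoeff (z l) (rowSeries (halfCoeff c)))) =
      ∑ n ∈ Finset.range (b + 1), ∑ q ∈ Finset.range (n + 1),
        (artanhCoeff n : ℂ) * (n.choose q : ℂ) * (-1) ^ (n - q) *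
          PowerSeries.coeff b (evalCoeff w (rowSeries (halfCoeff c)) ^ q *
            evalCoeff (z l) (rowSeries (halfCoeff c)) ^ (n - q)) := by
    intro l
    rw [seriesComp, PowerSeries.coeff_mk]
    refine Finset.sum_congr rfl fun n _ => ?_
    rw [coeff_sub_pow, Finset.smul_sum]
    refine Finset.sum_congr rfl fun q _ => ?_
    rw [smul_eq_mul]; ring
  simp only [e1, e2]
  have e3 : 1 / (L : ℂ) * ∑ l, ∑ n ∈ Finset.range (b + 1), ∑ q ∈ Finset.range (n + 1),
        (artanhCoeff n : ℂ) * (n.choose q : ℂ) * (-1) ^ (n - q) *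
          PowerSeries.coeff b (evalCoeff w (rowSeries (halfCoeff c)) ^ q *
            evalCoeff (z l) (rowSeries (halfCoeff c)) ^ (n - q)) =
      ∑ n ∈ Finset.range (b + 1), ∑ q ∈ Finset.range (n + 1),
        (artanhCoeff n : ℂ) * (n.choose q : ℂ) * (-1) ^ (n - q) *
          (1 / (L : ℂ) * ∑ l, PowerSeries.coeff b (evalCoeff w (rowSeries (halfCoeff c)) ^ q *
            evalCoeff (z l) (rowSeries (halfCoeff c)) ^ (n - q))) := by
    rw [Finset.sum_comm, Finset.mul_sum]
    refine Finset.sum_congr rfl fun n _ => ?_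
    rw [Finset.sum_comm, Finset.mul_sum]
    refine Finset.sum_congr rfl fun q _ => ?_
    rw [← Finset.mul_sum]; ring
  rw [e3]
  have e4 : ∀ n : ℕ, (-1 : ℂ) ^ (n + 1 + 1 + 1) / ((n + 1 + 1 : ℕ) : ℂ) *
      PowerSeries.coeff b (evalCoeff w (rowSeries (ctilde c)) ^ (n + 1 + 1)) =
      - ((-1 : ℂ) ^ n / ((n + 2 : ℕ) : ℂ) *
        PowerSeries.coeff b (evalCoeff w (rowSeries (ctilde c)) ^ (n + 2))) := by
    intro n
    rw [show n + 1 + 1 = n + 2 by ring, show n + 2 + 1 = n + 1 + 2 by ring, pow_add, pow_add]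
    ring
  simp only [e4, Finset.sum_neg_distrib]
  norm_num

end Empirical

/-! ### Elementary functions -/

/-- The function `s ↦ -2 i arctan (-2 i s)`, that is `-2 artanh (2 s)`. -/
noncomputable def phase (s : ℂ) : ℂ := -(2 * Complex.I) * Complex.arctan (-2 * Complex.I * s)

lemma norm_neg_two_I_mul (s : ℂ) : ‖-2 * Complex.I * s‖ = 2 * ‖s‖ := by
  rw [norm_mul, norm_mul, norm_neg, Complex.norm_I]; simp

lemma hasSum_phase {s : ℂ} (hs : 2 * ‖s‖ < 1) :
    HasSum (fun n => (artanhCoeff n : ℂ) * s ^ n) (phase s) := by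
  rw [phase, ← hasSum_odd_iff]
  · refine hasSum_of_forall_eq ((Complex.hasSum_arctan (z := -2 * Complex.I * s)
      (by rwa [norm_neg_two_I_mul])).mul_left (-(2 * Complex.I))) fun k => ?_
    have h1 : Odd (2 * k + 1) := ⟨k, rfl⟩
    have h2 : (2 * k + 1) / 2 = k := by omega
    rw [← artanhCoeff_eq, arctanCoeff, if_pos h1, h2]
    push_cast
    ring
  · intro n hn
    simp [artanhCoeff, if_neg hn]

lemma tsum_logCoeff {u : ℂ} (hu : ‖u‖ < 1) : ∑' n, logCoeff n * u ^ n = Complex.log (1 + u) := by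
  rw [← (Complex.hasSum_taylorSeries_log hu).tsum_eq]
  exact tsum_congr fun n => by rw [logCoeff]; ring

lemma tsum_neg_log {u : ℂ} (hu : ‖u‖ < 1) :
    ∑' n : ℕ, 1 / (n : ℂ) * u ^ n = -Complex.log (1 - u) := by
  rw [← (Complex.hasSum_taylorSeries_neg_log hu).tsum_eq]
  exact tsum_congr fun n => by ring

lemma summable_of_norm_le_one {g : ℕ → ℂ} (hg : ∀ n, ‖g n‖ ≤ 1) {s : ℝ} (hs : 0 ≤ s) (hs1 : s < 1) :
    Summable fun n => ‖g n‖ * s ^ n :=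
  Summable.of_nonneg_of_le (fun n => by positivity)
    (fun n => mul_le_of_le_one_left (by positivity) (hg n)) (summable_geometric_of_lt_one hs hs1)

lemma norm_one_div_natCast_le (n : ℕ) : ‖1 / (n : ℂ)‖ ≤ 1 := by
  rw [norm_div, norm_one, Complex.norm_natCast]
  rcases Nat.eq_zero_or_pos n with rfl | hn
  · simp
  · exact div_le_one_of_le₀ (by exact_mod_cast hn) (by positivity)

lemma norm_logCoeff_le (n : ℕ) : ‖logCoeff n‖ ≤ 1 := by
  have := norm_one_div_natCast_le n
  rw [norm_div, norm_one] at this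
  rw [logCoeff, norm_div, norm_pow, norm_neg, norm_one, one_pow]
  exact this

section Equation

variable {L N : ℕ} {z : Fin N → ℂ} {c : ℕ → ℕ → ℂ}

lemma IsRootExpansion.absEval_ctilde {X : ℤ → ℂ} (hc : IsRootExpansion X c) (hX : ∀ a, ‖X a‖ ≤ 1)
    {w t : ℂ} (hw : ‖w‖ ≤ 1) (ht : ‖t‖ ≤ 1 / 100) :
    AbsEval t (1 / 4) (evalCoeff w (rowSeries (ctilde c))) :=
  absEval_evalCoeff (hc.truncNorm_ctilde_le hX) hw ht

lemma IsRootExpansion.absEval_halfCoeff {X : ℤ → ℂ} (hc : IsRootExpansion X c) (hX : ∀ a, ‖X a‖ ≤ 1)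
    {w t : ℂ} (hw : ‖w‖ ≤ 1) (ht : ‖t‖ ≤ 1 / 100) :
    AbsEval t (1 / 80) (evalCoeff w (rowSeries (halfCoeff c))) :=
  absEval_evalCoeff (hc.truncNorm_halfCoeff_le hX) hw ht

/-- The generating series `∑ d_{ab} w^a t^b`. -/
noncomputable def rootFun (c : ℕ → ℕ → ℂ) (t w : ℂ) : ℂ :=
  seriesEval t (evalCoeff w (rowSeries (halfCoeff c)))

/-- The generating series `∑ c̃_{ab} w^a t^b`. -/
noncomputable def tildeFun (c : ℕ → ℕ → ℂ) (t w : ℂ) : ℂ :=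
  seriesEval t (evalCoeff w (rowSeries (ctilde c)))

lemma IsRootExpansion.rootFun_eq {X : ℤ → ℂ} (hc : IsRootExpansion X c) (hX : ∀ a, ‖X a‖ ≤ 1)
    {w t : ℂ} (hw : ‖w‖ ≤ 1) (ht : ‖t‖ ≤ 1 / 100) :
    rootFun c t w = t * w * (1 + tildeFun c t w) := by
  have hU := hc.absEval_ctilde hX hw ht
  have h1 := (absEval_C (t := t) (-1)).1.sub hU
  have h2 : (1 : PowerSeries ℂ) + evalCoeff w (rowSeries (ctilde c)) =
      PowerSeries.C (-1) * (PowerSeries.C (-1) - evalCoeff w (rowSeries (ctilde c))) := by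
    rw [map_neg, map_one]; ring
  have h3 := (absEval_C (t := t) (-1)).1.mul h1.1
  rw [← h2, h1.2, (absEval_C (t := t) (-1)).2] at h3
  have h4 := (absEval_C (t := t) w).1.mul h3.1
  rw [h3.2, (absEval_C (t := t) w).2] at h4
  rw [rootFun, hc.rowSeries_halfCoeff, map_mul, map_mul, map_add, map_one]
  have h5 : evalCoeff w PowerSeries.X = PowerSeries.X := PowerSeries.map_X _
  have h6 : evalCoeff w (PowerSeries.C Polynomial.X) = PowerSeries.C w := by
    rw [evalCoeff, PowerSeries.map_C]; simp
  rw [h5, h6, seriesEval_X_mul h4.1, h4.2, tildeFun]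
  ring

lemma IsRootExpansion.log_equation (hc : IsRootExpansion (empiricalMoment L z) c)
    (hz : ∀ k, ‖z k‖ = 1) (hNL : N ≤ L) {w t : ℂ} (hw : ‖w‖ ≤ 1) (ht : ‖t‖ ≤ 1 / 100) :
    Complex.log (1 + tildeFun c t w) =
      1 / (L : ℂ) * ∑ l, phase (rootFun c t w - rootFun c t (z l))
        + Complex.log (1 - rootFun c t w) := by
  have hX := norm_empiricalMoment_le hz hNL
  have hU := hc.absEval_ctilde hX hw ht
  have hD := fun w (hw : ‖w‖ ≤ 1) => hc.absEval_halfCoeff hX hw ht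
  have hU0 := coeff_zero_evalCoeff hc.coeff_zero_ctilde_series w
  have hD0 := coeff_zero_evalCoeff hc.coeff_zero_halfCoeff_series
  have s1 := hU.seriesComp hU0 (summable_of_norm_le_one norm_logCoeff_le (by norm_num) (by norm_num))
  have s2 := (hD w hw).seriesComp (hD0 w)
    (summable_of_norm_le_one norm_one_div_natCast_le (by norm_num) (by norm_num))
  have s3 : ∀ l, HasSum (fun b => PowerSeries.coeff b (seriesComp (fun n => (artanhCoeff n : ℂ))
      (evalCoeff w (rowSeries (halfCoeff c)) - evalCoeff (z l) (rowSeries (halfCoeff c)))) * t ^ b)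
      (phase (rootFun c t w - rootFun c t (z l))) := by
    intro l
    have hs := (hD w hw).sub (hD (z l) (hz l).le)
    have h := hs.1.seriesComp (by rw [map_sub, hD0, hD0, sub_zero])
      (g := fun n => (artanhCoeff n : ℂ)) (by
        refine Summable.of_nonneg_of_le (fun n => mul_nonneg (norm_nonneg _) (by positivity))
          (fun n => ?_) ((summable_geometric_of_lt_one (r := 1 / 20) (by norm_num)
            (by norm_num)).mul_left 2)
        have h1 : ‖(artanhCoeff n : ℂ)‖ = |(artanhCoeff n : ℝ)| := by
          rw [← Complex.ofReal_ratCast, Complex.norm_real, Real.norm_eq_abs]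
        rw [h1]
        calc _ ≤ 2 * 2 ^ n * (1 / 80 + 1 / 80 : ℝ) ^ n :=
              mul_le_mul_of_nonneg_right (abs_artanhCoeff_le n) (by positivity)
          _ = 2 * (1 / 20) ^ n := by rw [mul_assoc, ← mul_pow]; norm_num)
    rw [hs.2] at h
    have h2 : 2 * ‖rootFun c t w - rootFun c t (z l)‖ < 1 := by
      have h3 := hs.1.norm_le
      rw [hs.2] at h3
      rw [rootFun, rootFun]
      linarith
    rw [← (hasSum_phase h2).tsum_eq]
    exact h
  rw [tsum_logCoeff (hU.norm_le.trans_lt (by norm_num))] at s1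
  rw [tsum_neg_log ((hD w hw).norm_le.trans_lt (by norm_num))] at s2
  have s4 := ((hasSum_sum (s := Finset.univ) fun l _ => s3 l).mul_left (1 / (L : ℂ))).sub s2
  have s5 := s1.unique (hasSum_of_forall_eq s4 fun b => by
    rw [hc.coeff_log_eq, sub_mul, mul_assoc, Finset.sum_mul])
  rw [tildeFun, s5, rootFun]
  ring

lemma IsRootExpansion.rootFun_equation (hc : IsRootExpansion (empiricalMoment L z) c)
    (hz : ∀ k, ‖z k‖ = 1) (hNL : N ≤ L) {w t : ℂ} (hw : ‖w‖ ≤ 1) (ht : ‖t‖ ≤ 1 / 100) :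
    rootFun c t w = t * w * (1 - rootFun c t w) *
      Complex.exp (1 / (L : ℂ) * ∑ l, phase (rootFun c t w - rootFun c t (z l))) := by
  have hX := norm_empiricalMoment_le hz hNL
  have hu : ‖tildeFun c t w‖ ≤ 1 / 4 := (hc.absEval_ctilde hX hw ht).norm_le
  have hd : ‖rootFun c t w‖ ≤ 1 / 80 := (hc.absEval_halfCoeff hX hw ht).norm_le
  have h1 : 1 + tildeFun c t w ≠ 0 := fun h => by
    rw [← eq_neg_iff_add_eq_zero] at h
    have := congrArg norm h
    rw [norm_one, norm_neg] at this
    linarith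
  have h2 : 1 - rootFun c t w ≠ 0 := fun h => by
    rw [← sub_eq_zero.mp h, norm_one] at hd
    norm_num at hd
  have h3 := congrArg Complex.exp (hc.log_equation hz hNL hw ht)
  rw [Complex.exp_log h1, Complex.exp_add, Complex.exp_log h2] at h3
  conv_lhs => rw [hc.rootFun_eq hX hw ht, h3]
  ring

end Equation

end TwistedBethe

namespace TwistedBethe

/-! ### Bethe numbers -/

section BetheNumbers

variable {L N : ℕ} {I : Fin N → ℝ}

lemma IsFirstLevelBetheNumbers.card_le (h : IsFirstLevelBetheNumbers L N I) : N ≤ L := by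
  obtain ⟨M, hM⟩ := h.size_even
  have hLM : (L : ℝ) = M + M := by exact_mod_cast hM
  have key : ∀ (f : Fin N → ℤ) (s : Finset ℤ), s.card = M + M → (∀ k, f k ∈ s) →
      Function.Injective f → N ≤ L := by
    intro f s hs hf hinj
    have := Finset.card_le_card_of_injOn (s := Finset.univ) (t := s) f (fun k _ => hf k)
      (fun a _ b _ hab => hinj hab)
    rw [Finset.card_univ, Fintype.card_fin] at this
    omega
  rcases Nat.even_or_odd N with hN | hN
  · choose f hf using h.half_integer_of_even hN
    refine key f (Finset.Ico (-(M : ℤ)) M) (by simp; omega) (fun k => ?_) fun a b hab =>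
      h.injective (by rw [hf, hf, hab])
    have hr := h.range k
    rw [hf k, hLM] at hr
    rw [Finset.mem_Ico]
    constructor
    · have : (-(M : ℤ) : ℝ) < (f k : ℝ) + 1 := by push_cast; linarith
      have : -(M : ℤ) < f k + 1 := by exact_mod_cast this
      omega
    · have : (f k : ℝ) < (M : ℤ) := by push_cast; linarith
      exact_mod_cast this
  · choose f hf using h.integer_of_odd hN
    refine key f (Finset.Ioc (-(M : ℤ)) M) (by simp; omega) (fun k => ?_) fun a b hab =>
      h.injective (by rw [hf, hf, hab])
    have hr := h.range k
    rw [hf k, hLM] at hr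
    rw [Finset.mem_Ioc]
    constructor
    · have : (-(M : ℤ) : ℝ) < (f k : ℝ) := by push_cast; linarith
      exact_mod_cast this
    · have : (f k : ℝ) ≤ (M : ℤ) := by push_cast; linarith
      exact_mod_cast this

/-- The phases `e^{2 i π I_k / L}`. -/
noncomputable def unitPhase (L : ℕ) {N : ℕ} (I : Fin N → ℝ) (k : Fin N) : ℂ :=
  Complex.exp (2 * Complex.I * Real.pi * ((I k : ℂ) / L))

lemma norm_unitPhase (L : ℕ) (I : Fin N → ℝ) (k : Fin N) : ‖unitPhase L I k‖ = 1 := by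
  have : 2 * Complex.I * Real.pi * ((I k : ℂ) / L) = ((2 * Real.pi * (I k / L) : ℝ) : ℂ) * Complex.I := by
    push_cast; ring
  rw [unitPhase, this, Complex.norm_exp_ofReal_mul_I]

lemma unitPhase_zpow (L : ℕ) (I : Fin N → ℝ) (k : Fin N) (a : ℤ) :
    unitPhase L I k ^ a = Complex.exp (2 * Complex.I * Real.pi * a * ((I k : ℂ) / L)) := by
  rw [unitPhase, ← Complex.exp_int_mul]
  congr 1; ring

lemma IsFirstLevelBetheNumbers.unitPhase_injective (h : IsFirstLevelBetheNumbers L N I) :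
    Function.Injective (unitPhase L I) := by
  intro k l hkl
  have hL : (0 : ℝ) < L := by exact_mod_cast h.size_pos
  obtain ⟨n, hn⟩ := Complex.exp_eq_exp_iff_exists_int.mp hkl
  have h1 : ((I k / L : ℝ) : ℂ) = ((I l / L + n : ℝ) : ℂ) := by
    have h2 : (2 * Complex.I * Real.pi : ℂ) ≠ 0 := by simp [Complex.I_ne_zero, Real.pi_ne_zero]
    apply mul_left_cancel₀ h2
    push_cast
    rw [hn]; ring
  have h3 : I k / L = I l / L + n := by exact_mod_cast h1
  have h4 : I k - I l = n * L := by field_simp at h3; linarith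
  have hk := h.range k
  have hl := h.range l
  have h5 : n = 0 := by
    have a1 : (n : ℝ) < 1 := by
      by_contra hcon
      have : 1 * (L : ℝ) ≤ n * L := mul_le_mul_of_nonneg_right (not_lt.mp hcon) hL.le
      linarith
    have a2 : (-1 : ℝ) < n := by
      by_contra hcon
      have : n * (L : ℝ) ≤ -1 * L := mul_le_mul_of_nonneg_right (not_lt.mp hcon) hL.le
      linarith
    have b1 : n < 1 := by exact_mod_cast a1
    have b2 : -1 < n := by exact_mod_cast a2
    omega
  rw [h5] at h4
  exact h.injective (by simpa [sub_eq_zero] using h4)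

lemma IsFirstLevelBetheNumbers.unitPhase_pow (h : IsFirstLevelBetheNumbers L N I) (k : Fin N) :
    unitPhase L I k ^ L = (-1) ^ (N - 1) := by
  have hL : (L : ℂ) ≠ 0 := by exact_mod_cast h.size_pos.ne'
  have hN : 0 < N := k.pos
  have h1 : unitPhase L I k ^ L = Complex.exp (2 * Complex.I * Real.pi * I k) := by
    rw [unitPhase, ← Complex.exp_nat_mul]
    congr 1
    field_simp
  rw [h1]
  rcases Nat.even_or_odd N with hN' | hN'
  · obtain ⟨n, hn⟩ := h.half_integer_of_even hN' k
    have h2 : Odd (N - 1) := Nat.Even.sub_odd hN hN' odd_one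
    rw [h2.neg_one_pow, hn]
    have : 2 * Complex.I * Real.pi * ((n + 1 / 2 : ℝ) : ℂ) =
        n * (2 * Real.pi * Complex.I) + Real.pi * Complex.I := by push_cast; ring
    rw [this, Complex.exp_add, Complex.exp_int_mul_two_pi_mul_I, Complex.exp_pi_mul_I, one_mul]
  · obtain ⟨n, hn⟩ := h.integer_of_odd hN' k
    have h2 : Even (N - 1) := Nat.Odd.sub_odd hN' odd_one
    rw [h2.neg_one_pow, hn]
    have : 2 * Complex.I * Real.pi * ((n : ℝ) : ℂ) = n * (2 * Real.pi * Complex.I) := by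
      push_cast; ring
    rw [this, Complex.exp_int_mul_two_pi_mul_I]

end BetheNumbers

/-! ### The phase function near the origin -/

lemma phase_eq_neg_log (s : ℂ) : phase s = -Complex.log ((1 + 2 * s) / (1 - 2 * s)) := by
  have h : -2 * Complex.I * s * Complex.I = 2 * s := by linear_combination (-2 * s) * Complex.I_mul_I
  rw [phase, Complex.arctan, h]
  linear_combination (Complex.log ((1 + 2 * s) / (1 - 2 * s))) * Complex.I_mul_I

lemma one_add_ne_zero_of_norm_lt {x : ℂ} (hx : ‖x‖ < 1) : 1 + x ≠ 0 := fun h => by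
  rw [eq_neg_of_add_eq_zero_right h, norm_neg, norm_one] at hx
  exact lt_irrefl _ hx

lemma one_sub_ne_zero_of_norm_lt {x : ℂ} (hx : ‖x‖ < 1) : 1 - x ≠ 0 := fun h => by
  rw [← sub_eq_zero.mp h, norm_one] at hx
  exact lt_irrefl _ hx

lemma norm_two_mul (s : ℂ) : ‖2 * s‖ = 2 * ‖s‖ := by rw [norm_mul]; simp

lemma exp_phase {s : ℂ} (hs : ‖s‖ < 1 / 2) :
    Complex.exp (phase s) = (1 - 2 * s) / (1 + 2 * s) := by
  have h : ‖2 * s‖ < 1 := by rw [norm_two_mul]; linarith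
  rw [phase_eq_neg_log, Complex.exp_neg, Complex.exp_log (div_ne_zero
    (one_add_ne_zero_of_norm_lt h) (one_sub_ne_zero_of_norm_lt h)), inv_div]

lemma phase_zero : phase 0 = 0 := by rw [phase_eq_neg_log]; simp

lemma hasDerivAt_phase {s : ℂ} (hs : ‖s‖ ≤ 1 / 8) :
    HasDerivAt phase (-(4 / ((1 - 2 * s) * (1 + 2 * s)))) s := by
  have h : ‖2 * s‖ < 1 := by rw [norm_two_mul]; linarith
  have n1 := one_add_ne_zero_of_norm_lt h
  have n2 := one_sub_ne_zero_of_norm_lt h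
  have h0 : HasDerivAt (fun s : ℂ => 2 * s) 2 s := by
    simpa using (hasDerivAt_id s).const_mul 2
  have h1 := (h0.const_add 1).div (h0.const_sub 1) n2
  have h2 : (1 + 2 * s) / (1 - 2 * s) ∈ Complex.slitPlane := by
    have : (1 + 2 * s) / (1 - 2 * s) = 1 + 4 * s / (1 - 2 * s) := by field_simp; ring
    rw [this]
    apply Complex.mem_slitPlane_of_norm_lt_one
    have h3 : 3 / 4 ≤ ‖1 - 2 * s‖ := by
      have := norm_sub_norm_le 1 (2 * s)
      rw [norm_one, norm_two_mul] at this
      linarith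
    rw [norm_div, div_lt_one (by linarith), norm_mul]
    have : ‖(4 : ℂ)‖ = 4 := by simp
    rw [this]; linarith
  have h3 := (h1.clog h2).neg
  have h4 : phase = fun s => -Complex.log ((1 + 2 * s) / (1 - 2 * s)) := funext phase_eq_neg_log
  rw [h4]
  refine h3.congr_deriv ?_
  simp only [Pi.div_apply]
  field_simp
  ring

lemma norm_phase_sub_le {s s' : ℂ} (hs : ‖s‖ ≤ 1 / 8) (hs' : ‖s'‖ ≤ 1 / 8) :
    ‖phase s - phase s'‖ ≤ 5 * ‖s - s'‖ := by
  refine Convex.norm_image_sub_le_of_norm_hasDerivWithin_le (s := Metric.closedBall 0 (1 / 8))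
    (fun x hx => (hasDerivAt_phase (by simpa using hx)).hasDerivWithinAt) (fun x hx => ?_)
    (convex_closedBall _ _) (by simpa using hs') (by simpa using hs)
  have hx' : ‖x‖ ≤ 1 / 8 := by simpa using hx
  have h1 : 3 / 4 ≤ ‖1 - 2 * x‖ := by
    have := norm_sub_norm_le 1 (2 * x)
    rw [norm_one, norm_two_mul] at this
    linarith
  have h2 : ‖(1 - 2 * x) * (1 + 2 * x)‖ ≥ 15 / 16 := by
    have h3 : (1 - 2 * x) * (1 + 2 * x) = 1 - 4 * (x * x) := by ring
    have := norm_sub_norm_le 1 (4 * (x * x))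
    rw [norm_one, norm_mul, norm_mul] at this
    have h4 : ‖(4 : ℂ)‖ = 4 := by simp
    rw [h4] at this
    rw [h3]
    nlinarith [norm_nonneg x]
  rw [norm_neg, norm_div]
  have h4 : ‖(4 : ℂ)‖ = 4 := by simp
  rw [h4, div_le_iff₀ (by linarith)]
  linarith

lemma norm_phase_le {s : ℂ} (hs : ‖s‖ ≤ 1 / 8) : ‖phase s‖ ≤ 5 / 8 := by
  have := norm_phase_sub_le hs (s' := 0) (by norm_num)
  rw [phase_zero, sub_zero, sub_zero] at this
  linarith

lemma exp_five_eighths_le : Real.exp (5 / 8) ≤ 2 := by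
  rw [← Real.le_log_iff_exp_le (by norm_num)]
  linarith [Real.log_two_gt_d9]

lemma norm_exp_le_two {x : ℂ} (hx : ‖x‖ ≤ 5 / 8) : ‖Complex.exp x‖ ≤ 2 := by
  rw [Complex.norm_exp]
  exact (Real.exp_le_exp.mpr ((Complex.re_le_norm x).trans hx)).trans exp_five_eighths_le

lemma norm_exp_sub_exp_le {x y : ℂ} (hx : ‖x‖ ≤ 5 / 8) (hy : ‖y‖ ≤ 5 / 8) :
    ‖Complex.exp x - Complex.exp y‖ ≤ 2 * ‖x - y‖ :=
  Convex.norm_image_sub_le_of_norm_hasDerivWithin_le (s := Metric.closedBall 0 (5 / 8))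
    (fun x _ => (Complex.hasDerivAt_exp x).hasDerivWithinAt)
    (fun x hx => norm_exp_le_two (by simpa using hx))
    (convex_closedBall _ _) (by simpa using hy) (by simpa using hx)

/-! ### The fixed point equation -/

/-- The Bethe equations in the variables `d_k = (λ_k - i) / (-2 i)`, with `z_k = e^{2 i π I_k / L}`
and `t = e^{-2 φ}`. -/
def IsFixedPoint (L : ℕ) {N : ℕ} (z : Fin N → ℂ) (t : ℂ) (d : Fin N → ℂ) : Prop :=
  ∀ k, d k = t * z k * (1 - d k) * Complex.exp (1 / (L : ℂ) * ∑ l, phase (d k - d l))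

section FixedPoint

variable {L N : ℕ} {z d d' : Fin N → ℂ} {t : ℂ}

lemma norm_average_le (hNL : N ≤ L) {f : Fin N → ℂ} {C : ℝ} (hC : 0 ≤ C) (hf : ∀ l, ‖f l‖ ≤ C) :
    ‖1 / (L : ℂ) * ∑ l, f l‖ ≤ C := by
  rw [norm_mul, norm_div, norm_one, Complex.norm_natCast, one_div_mul_eq_div]
  refine div_le_of_le_mul₀ (Nat.cast_nonneg _) hC ((norm_sum_le _ _).trans
    ((Finset.sum_le_sum fun l _ => hf l).trans ?_))
  rw [Finset.sum_const, Finset.card_univ, Fintype.card_fin, nsmul_eq_mul, mul_comm]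
  exact mul_le_mul_of_nonneg_left (by exact_mod_cast hNL) hC

lemma norm_sub_le_of_le {x y : ℂ} (hx : ‖x‖ ≤ 1 / 16) (hy : ‖y‖ ≤ 1 / 16) : ‖x - y‖ ≤ 1 / 8 :=
  (norm_sub_le _ _).trans (by linarith)

lemma IsFixedPoint.norm_le (h : IsFixedPoint L z t d) (hz : ∀ k, ‖z k‖ = 1) (hNL : N ≤ L)
    (ht : ‖t‖ ≤ 1 / 200) (hd : ∀ k, ‖d k‖ ≤ 1 / 16) (k : Fin N) : ‖d k‖ ≤ 1 / 32 := by
  have h1 : ‖Complex.exp (1 / (L : ℂ) * ∑ l, phase (d k - d l))‖ ≤ 2 :=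
    norm_exp_le_two (norm_average_le hNL (by norm_num)
      fun l => norm_phase_le (norm_sub_le_of_le (hd k) (hd l)))
  have h2 : ‖1 - d k‖ ≤ 17 / 16 := (norm_sub_le _ _).trans (by
    rw [norm_one]; linarith [hd k])
  rw [h k, norm_mul, norm_mul, norm_mul, hz, mul_one]
  calc _ ≤ (1 / 200 : ℝ) * (17 / 16) * 2 :=
        mul_le_mul (mul_le_mul ht h2 (norm_nonneg _) (by norm_num)) h1 (norm_nonneg _) (by norm_num)
    _ ≤ 1 / 32 := by norm_num

lemma IsFixedPoint.eq (h : IsFixedPoint L z t d) (h' : IsFixedPoint L z t d')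
    (hz : ∀ k, ‖z k‖ = 1) (hNL : N ≤ L) (ht : ‖t‖ ≤ 1 / 200) (hd : ∀ k, ‖d k‖ ≤ 1 / 16)
    (hd' : ∀ k, ‖d' k‖ ≤ 1 / 16) : d = d' := by
  set δ := ‖d - d'‖ with hδ
  have hδ0 : 0 ≤ δ := norm_nonneg _
  have hk : ∀ k, ‖d k - d' k‖ ≤ δ := fun k => norm_le_pi_norm (d - d') k
  have key : δ ≤ 1 / 2 * δ := by
    refine (pi_norm_le_iff_of_nonneg (by positivity)).mpr fun k => ?_
    rw [Pi.sub_apply]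
    set E := 1 / (L : ℂ) * ∑ l, phase (d k - d l) with hE
    set E' := 1 / (L : ℂ) * ∑ l, phase (d' k - d' l) with hE'
    have b1 : ‖E‖ ≤ 5 / 8 := norm_average_le hNL (by norm_num)
      fun l => norm_phase_le (norm_sub_le_of_le (hd k) (hd l))
    have b2 : ‖E'‖ ≤ 5 / 8 := norm_average_le hNL (by norm_num)
      fun l => norm_phase_le (norm_sub_le_of_le (hd' k) (hd' l))
    have b3 : ‖E - E'‖ ≤ 10 * δ := by
      rw [hE, hE', ← mul_sub, ← Finset.sum_sub_distrib]
      refine norm_average_le hNL (by positivity) fun l => ?_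
      refine (norm_phase_sub_le (norm_sub_le_of_le (hd k) (hd l))
        (norm_sub_le_of_le (hd' k) (hd' l))).trans ?_
      have : d k - d l - (d' k - d' l) = (d k - d' k) - (d l - d' l) := by ring
      rw [this]
      linarith [norm_sub_le (d k - d' k) (d l - d' l), hk k, hk l]
    have b4 := (norm_exp_sub_exp_le b1 b2).trans (mul_le_mul_of_nonneg_left b3 zero_le_two)
    have b5 : ‖1 - d k‖ ≤ 17 / 16 := (norm_sub_le _ _).trans (by
      rw [norm_one]; linarith [hd k])
    have b6 : d k - d' k = t * z k * ((1 - d k) * (Complex.exp E - Complex.exp E')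
        - (d k - d' k) * Complex.exp E') := by
      linear_combination h k - h' k
    rw [b6, norm_mul, norm_mul, hz, mul_one]
    have b7 : ‖(1 - d k) * (Complex.exp E - Complex.exp E') - (d k - d' k) * Complex.exp E'‖ ≤
        17 / 16 * (2 * (10 * δ)) + δ * 2 := by
      refine (norm_sub_le _ _).trans (add_le_add ?_ ?_)
      · rw [norm_mul]; exact mul_le_mul b5 b4 (norm_nonneg _) (by norm_num)
      · rw [norm_mul]; exact mul_le_mul (hk k) (norm_exp_le_two b2) (norm_nonneg _) hδ0
    have b8 := mul_le_mul ht b7 (norm_nonneg _) (by norm_num)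
    linarith
  have : δ = 0 := by linarith
  exact sub_eq_zero.mp (norm_eq_zero.mp this)

end FixedPoint

/-! ### Bethe solutions as fixed points -/

lemma sin_eq_mul_cos_iff (θ d : ℂ) :
    Complex.sin θ = (Complex.I - 2 * Complex.I * d) * Complex.cos θ ↔
      d = Complex.exp (2 * Complex.I * θ) * (1 - d) := by
  have h1 : Complex.exp (2 * Complex.I * θ) = Complex.exp (θ * Complex.I) * Complex.exp (θ * Complex.I) := by
    rw [← Complex.exp_add]; congr 1; ring
  have h2 : Complex.exp (-θ * Complex.I) * Complex.exp (θ * Complex.I) = 1 := by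
    rw [← Complex.exp_add]; simp
  rw [h1, ← sub_eq_zero, ← sub_eq_zero (a := d), Complex.sin, Complex.cos]
  have h4 : (Complex.exp (-θ * Complex.I) - Complex.exp (θ * Complex.I)) * Complex.I / 2 -
      (Complex.I - 2 * Complex.I * d) * ((Complex.exp (θ * Complex.I) + Complex.exp (-θ * Complex.I)) / 2) =
      (Complex.exp (-θ * Complex.I) * Complex.I) *
        (d - Complex.exp (θ * Complex.I) * Complex.exp (θ * Complex.I) * (1 - d)) := by
    linear_combination (Complex.exp (θ * Complex.I) * Complex.I * (1 - d)) * h2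
  rw [h4, mul_eq_zero, or_iff_right (mul_ne_zero (Complex.exp_ne_zero _) Complex.I_ne_zero)]

section Solutions

variable {L N : ℕ} {I : Fin N → ℝ} {φ : ℝ} {d : Fin N → ℂ}

lemma exp_two_I_mul_counting (hL : 0 < L) (k : Fin N) (d : Fin N → ℂ) (lam : Fin N → ℂ)
    (hlam : ∀ k, lam k = Complex.I - 2 * Complex.I * d k) (θ : ℂ)
    (hθ : 1 / (Real.pi : ℂ) * θ = (I k : ℂ) / L + Complex.I * φ / Real.pi
      - 1 / ((Real.pi : ℂ) * L) * ∑ l, Complex.arctan (lam k - lam l)) :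
    Complex.exp (2 * Complex.I * θ) = (Real.exp (-2 * φ) : ℂ) * unitPhase L I k *
      Complex.exp (1 / (L : ℂ) * ∑ l, phase (d k - d l)) := by
  have hp : (Real.pi : ℂ) ≠ 0 := by exact_mod_cast Real.pi_ne_zero
  have hL' : (L : ℂ) ≠ 0 := by exact_mod_cast hL.ne'
  have h1 : ∀ l, phase (d k - d l) = -(2 * Complex.I) * Complex.arctan (lam k - lam l) := fun l => by
    rw [phase, hlam, hlam]; congr 2; ring
  have h2 : θ = Real.pi * ((I k : ℂ) / L) + Complex.I * φ
      - 1 / (L : ℂ) * ∑ l, Complex.arctan (lam k - lam l) := by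
    have : θ = Real.pi * (1 / (Real.pi : ℂ) * θ) := by field_simp
    rw [this, hθ]
    field_simp
  rw [unitPhase, Complex.ofReal_exp, ← Complex.exp_add, ← Complex.exp_add]
  congr 1
  simp only [h1, ← Finset.mul_sum]
  rw [h2]
  push_cast
  linear_combination (2 * (φ : ℂ)) * Complex.I_mul_I

lemma IsBetheSolution.isFixedPoint (hL : 0 < L) {lam : Fin N → ℂ}
    (h : IsBetheSolution L N I φ lam) (hlam : ∀ k, lam k = Complex.I - 2 * Complex.I * d k) :
    IsFixedPoint L (unitPhase L I) (Real.exp (-2 * φ) : ℂ) d := by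
  intro k
  obtain ⟨θ, h1, h2⟩ := h.log_form k
  rw [hlam k, sin_eq_mul_cos_iff, exp_two_I_mul_counting hL k d lam hlam θ h2] at h1
  linear_combination h1

lemma prod_neg_exp_phase {k : Fin N} (f : Fin N → ℂ) (hf : f k = 0) :
    ∏ l ∈ Finset.univ.erase k, -Complex.exp (f l) = (-1) ^ (N - 1) * Complex.exp (∑ l, f l) := by
  have h1 : ∏ l ∈ Finset.univ.erase k, -Complex.exp (f l) =
      ∏ l ∈ Finset.univ.erase k, (-1) * Complex.exp (f l) :=
    Finset.prod_congr rfl fun l _ => by ring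
  rw [h1, Finset.prod_mul_distrib, Finset.prod_const, Finset.card_erase_of_mem (Finset.mem_univ _),
    Finset.card_univ, Fintype.card_fin, ← Complex.exp_sum,
    ← Finset.add_sum_erase _ _ (Finset.mem_univ k), hf, zero_add]

lemma IsFixedPoint.isBetheSolution (hI : IsFirstLevelBetheNumbers L N I)
    (h : IsFixedPoint L (unitPhase L I) (Real.exp (-2 * φ) : ℂ) d) (hd : ∀ k, ‖d k‖ ≤ 1 / 16) :
    IsBetheSolution L N I φ (fun k => Complex.I - 2 * Complex.I * d k) := by
  have hI0 := Complex.I_ne_zero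
  have hL' : (L : ℂ) ≠ 0 := by exact_mod_cast hI.size_pos.ne'
  have ht : (Real.exp (-2 * φ) : ℂ) ≠ 0 := by exact_mod_cast (Real.exp_pos _).ne'
  have hne : ∀ k, 1 - d k ≠ 0 := fun k => one_sub_ne_zero_of_norm_lt ((hd k).trans_lt (by norm_num))
  have hs : ∀ k l, ‖d k - d l‖ < 1 / 2 := fun k l =>
    (norm_sub_le_of_le (hd k) (hd l)).trans_lt (by norm_num)
  have hs1 : ∀ k l, 1 + 2 * (d k - d l) ≠ 0 := fun k l => one_add_ne_zero_of_norm_lt (by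
    rw [norm_two_mul]; linarith [hs k l])
  refine ⟨?_, ?_, ?_, ?_, ?_⟩
  · intro k l hkl
    have hdkl : d k = d l := by
      have h1 : 2 * Complex.I * d k = 2 * Complex.I * d l := sub_right_injective hkl
      exact mul_left_cancel₀ (mul_ne_zero two_ne_zero hI0) h1
    have h1 := (h k).symm.trans (hdkl.trans (h l))
    rw [hdkl] at h1
    have h2 : (Real.exp (-2 * φ) : ℂ) * (1 - d l) *
        Complex.exp (1 / (L : ℂ) * ∑ i, phase (d l - d i)) * unitPhase L I k =
        (Real.exp (-2 * φ) : ℂ) * (1 - d l) *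
        Complex.exp (1 / (L : ℂ) * ∑ i, phase (d l - d i)) * unitPhase L I l := by
      linear_combination h1
    exact hI.unitPhase_injective
      (mul_left_cancel₀ (mul_ne_zero (mul_ne_zero ht (hne l)) (Complex.exp_ne_zero _)) h2)
  · intro k hk
    apply hne k
    have : 2 * Complex.I * (1 - d k) = 0 := by linear_combination hk
    exact (mul_eq_zero.mp this).resolve_left (mul_ne_zero two_ne_zero hI0)
  · intro k l hkl
    apply hs1 k l
    have : Complex.I * (1 + 2 * (d k - d l)) = 0 := by linear_combination -hkl
    exact (mul_eq_zero.mp this).resolve_left hI0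
  · intro k
    have h1 : (Complex.I - 2 * Complex.I * d k - Complex.I) / (Complex.I - 2 * Complex.I * d k + Complex.I) =
        -((Real.exp (-2 * φ) : ℂ) * unitPhase L I k *
          Complex.exp (1 / (L : ℂ) * ∑ l, phase (d k - d l))) := by
      have h2 : Complex.I - 2 * Complex.I * d k + Complex.I = 2 * Complex.I * (1 - d k) := by ring
      rw [h2, div_eq_iff (mul_ne_zero (mul_ne_zero two_ne_zero hI0) (hne k))]
      linear_combination (-2 * Complex.I) * h k
    have h3 : ∀ l, (Complex.I - 2 * Complex.I * d k - (Complex.I - 2 * Complex.I * d l) + Complex.I) /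
        (Complex.I - 2 * Complex.I * d k - (Complex.I - 2 * Complex.I * d l) - Complex.I) =
        -Complex.exp (phase (d k - d l)) := by
      intro l
      rw [exp_phase (hs k l)]
      have h4 : Complex.I - 2 * Complex.I * d k - (Complex.I - 2 * Complex.I * d l) - Complex.I =
          -Complex.I * (1 + 2 * (d k - d l)) := by ring
      rw [h4, div_eq_iff (mul_ne_zero (neg_ne_zero.mpr hI0) (hs1 k l)), neg_mul, neg_mul, mul_neg,
        neg_neg, mul_left_comm, div_mul_cancel₀ _ (hs1 k l)]
      ring
    simp only [h3]
    rw [h1, hI.size_even.neg_pow, mul_pow, mul_pow, hI.unitPhase_pow, ← Complex.exp_nat_mul,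
      prod_neg_exp_phase (fun l => phase (d k - d l)) (by rw [sub_self, phase_zero]),
      ← mul_assoc (L : ℂ), mul_one_div_cancel hL', one_mul, mul_assoc]
    congr 1
    rw [← Complex.ofReal_pow, ← Real.exp_nat_mul]
    congr 2
    ring
  · intro k
    have hp : (Real.pi : ℂ) ≠ 0 := by exact_mod_cast Real.pi_ne_zero
    let lam : Fin N → ℂ := fun k => Complex.I - 2 * Complex.I * d k
    let θ : ℂ := Real.pi * ((I k : ℂ) / L + Complex.I * φ / Real.pi
      - 1 / ((Real.pi : ℂ) * L) * ∑ l, Complex.arctan (lam k - lam l))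
    have hθ : 1 / (Real.pi : ℂ) * θ = (I k : ℂ) / L + Complex.I * φ / Real.pi
      - 1 / ((Real.pi : ℂ) * L) * ∑ l, Complex.arctan (lam k - lam l) := by
      rw [← mul_assoc, one_div_mul_cancel hp, one_mul]
    refine ⟨θ, ?_, hθ⟩
    rw [sin_eq_mul_cos_iff, exp_two_I_mul_counting hI.size_pos k d lam (fun _ => rfl) θ hθ]
    linear_combination h k

end Solutions

/-! ### The branch of solutions -/

/-- The twist beyond which the expansions are shown to converge. -/
noncomputable def twistBound : ℝ := Real.log 200 / 2

lemma twistBound_nonneg : 0 ≤ twistBound :=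
  div_nonneg (Real.log_nonneg (by norm_num)) zero_le_two

lemma exp_le_of_twistBound_le {φ : ℝ} (h : twistBound ≤ φ) : Real.exp (-2 * φ) ≤ 1 / 200 := by
  rw [← Real.le_log_iff_exp_le (by norm_num), one_div, Real.log_inv]
  rw [twistBound] at h
  linarith

lemma norm_exp_le_of_twistBound_le {φ : ℝ} (h : twistBound ≤ φ) :
    ‖(Real.exp (-2 * φ) : ℂ)‖ ≤ 1 / 200 := by
  rw [Complex.norm_real, Real.norm_of_nonneg (Real.exp_pos _).le]
  exact exp_le_of_twistBound_le h

lemma continuousOn_seriesEval {ρ s : ℝ} {F : PowerSeries (Polynomial ℂ)}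
    (hF : ∀ B, truncNorm ρ B F ≤ s) (hρ : 0 ≤ ρ) {z : ℂ} (hz : ‖z‖ ≤ 1) :
    ContinuousOn (fun t => seriesEval t (evalCoeff z F)) (Metric.closedBall 0 ρ) := by
  have h0 : Summable fun b => polyNorm (PowerSeries.coeff b F) * ρ ^ b :=
    summable_of_sum_range_le (c := s)
      (fun b => mul_nonneg (polyNorm_nonneg _) (pow_nonneg hρ b)) fun B =>
      (Finset.sum_le_sum_of_subset_of_nonneg (Finset.range_mono (Nat.le_succ B)) fun b _ _ =>
        mul_nonneg (polyNorm_nonneg _) (pow_nonneg hρ b)).trans (hF B)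
  refine continuousOn_tsum (fun b => by fun_prop) h0 fun b t ht => ?_
  rw [norm_mul, norm_pow, coeff_evalCoeff]
  exact mul_le_mul (norm_eval_le hz _) (pow_le_pow_left₀ (norm_nonneg _) (by simpa using ht) b)
    (by positivity) (polyNorm_nonneg _)

/-- The branch of solutions given by the root expansion for the empirical moments. -/
noncomputable def branch (L : ℕ) {N : ℕ} (I : Fin N → ℝ) (φ : ℝ) (k : Fin N) : ℂ :=
  Complex.I - 2 * Complex.I *
    rootFun (rootCoeff (empiricalMoment L (unitPhase L I))) (Real.exp (-2 * φ) : ℂ) (unitPhase L I k)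

section Branch

variable {L N : ℕ} {I : Fin N → ℝ}

lemma isFixedPoint_rootFun (hI : IsFirstLevelBetheNumbers L N I) {t : ℂ} (ht : ‖t‖ ≤ 1 / 100) :
    IsFixedPoint L (unitPhase L I) t
      (fun k => rootFun (rootCoeff (empiricalMoment L (unitPhase L I))) t (unitPhase L I k)) :=
  fun k => (rootCoeff_isRootExpansion _).rootFun_equation (norm_unitPhase L I) hI.card_le
    (norm_unitPhase L I k).le ht

lemma norm_rootFun_le {X : ℤ → ℂ} (hX : ∀ a, ‖X a‖ ≤ 1) {w t : ℂ} (hw : ‖w‖ ≤ 1)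
    (ht : ‖t‖ ≤ 1 / 100) : ‖rootFun (rootCoeff X) t w‖ ≤ 1 / 80 :=
  ((rootCoeff_isRootExpansion X).absEval_halfCoeff hX hw ht).norm_le

lemma norm_rootFun_le_mul {X : ℤ → ℂ} (hX : ∀ a, ‖X a‖ ≤ 1) {w t : ℂ} (hw : ‖w‖ ≤ 1)
    (ht : ‖t‖ ≤ 1 / 100) : ‖rootFun (rootCoeff X) t w‖ ≤ ‖t‖ * 2 := by
  have hc := rootCoeff_isRootExpansion X
  have hu : ‖tildeFun (rootCoeff X) t w‖ ≤ 1 / 4 := (hc.absEval_ctilde hX hw ht).norm_le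
  rw [hc.rootFun_eq hX hw ht, norm_mul, norm_mul]
  refine mul_le_mul (mul_le_of_le_one_right (norm_nonneg _) hw) ((norm_add_le _ _).trans ?_)
    (norm_nonneg _) (norm_nonneg _)
  rw [norm_one]; linarith

lemma tendsto_exp_neg_two_mul : Tendsto (fun φ : ℝ => Real.exp (-2 * φ)) atTop (𝓝 0) :=
  Real.tendsto_exp_atBot.comp (tendsto_id.const_mul_atTop_of_neg (by norm_num))

lemma IsFirstLevelBetheNumbers.isTwistBranch (hI : IsFirstLevelBetheNumbers L N I) :
    IsTwistBranch L N I twistBound (branch L I) := by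
  have hX := norm_empiricalMoment_le (norm_unitPhase L I) hI.card_le
  have ht : ∀ φ : ℝ, twistBound ≤ φ → ‖(Real.exp (-2 * φ) : ℂ)‖ ≤ 1 / 100 := fun φ hφ =>
    (norm_exp_le_of_twistBound_le hφ).trans (by norm_num)
  refine ⟨?_, fun φ hφ => ?_, fun k => ?_⟩
  · refine continuousOn_pi.mpr fun k => ?_
    refine continuousOn_const.sub (continuousOn_const.mul ?_)
    refine ContinuousOn.comp (continuousOn_seriesEval
      ((rootCoeff_isRootExpansion _).truncNorm_halfCoeff_le hX) (by norm_num)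
      (norm_unitPhase L I k).le) (f := fun φ : ℝ => (Real.exp (-2 * φ) : ℂ))
      (by fun_prop) fun φ hφ => ?_
    rw [mem_closedBall_zero_iff]
    exact ht φ hφ
  · exact (isFixedPoint_rootFun hI (ht φ hφ)).isBetheSolution hI fun k =>
      (norm_rootFun_le hX (norm_unitPhase L I k).le (ht φ hφ)).trans (by norm_num)
  · have h1 : Tendsto (fun φ : ℝ => rootFun (rootCoeff (empiricalMoment L (unitPhase L I)))
        (Real.exp (-2 * φ) : ℂ) (unitPhase L I k)) atTop (𝓝 0) := by
      refine squeeze_zero_norm' (a := fun φ : ℝ => Real.exp (-2 * φ) * 2) ?_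
        (by simpa using tendsto_exp_neg_two_mul.mul_const 2)
      filter_upwards [eventually_ge_atTop twistBound] with φ hφ
      refine (norm_rootFun_le_mul hX (norm_unitPhase L I k).le (ht φ hφ)).trans_eq ?_
      rw [Complex.norm_real, Real.norm_of_nonneg (Real.exp_pos _).le]
    simpa [branch] using (h1.const_mul (2 * Complex.I)).const_sub Complex.I

lemma IsTwistBranch.eqOn_branch (hI : IsFirstLevelBetheNumbers L N I) {lam : ℝ → Fin N → ℂ}
    (h : IsTwistBranch L N I twistBound lam) : Set.EqOn lam (branch L I) (Set.Ici twistBound) := by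
  have hX := norm_empiricalMoment_le (norm_unitPhase L I) hI.card_le
  let d : ℝ → Fin N → ℂ := fun φ k => Complex.I / 2 * (lam φ k - Complex.I)
  have hlam : ∀ φ k, lam φ k = Complex.I - 2 * Complex.I * d φ k := fun φ k => by
    simp only [d]
    linear_combination (lam φ k - Complex.I) * Complex.I_mul_I
  have hfix : ∀ φ, twistBound ≤ φ → IsFixedPoint L (unitPhase L I) (Real.exp (-2 * φ) : ℂ) (d φ) :=
    fun φ hφ => (h.solution φ hφ).isFixedPoint hI.size_pos (hlam φ)
  have hcont : ContinuousOn (fun φ => ‖d φ‖) (Set.Ici twistBound) := by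
    refine ContinuousOn.norm (continuousOn_pi.mpr fun k => ?_)
    exact continuousOn_const.mul ((continuousOn_pi.mp h.continuousOn k).sub continuousOn_const)
  have hgap : ∀ φ, twistBound ≤ φ → ‖d φ‖ ≤ 1 / 16 → ‖d φ‖ ≤ 1 / 32 := fun φ hφ hle =>
    (pi_norm_le_iff_of_nonneg (by norm_num)).mpr ((hfix φ hφ).norm_le (norm_unitPhase L I)
      hI.card_le (norm_exp_le_of_twistBound_le hφ)
      ((pi_norm_le_iff_of_nonneg (by norm_num)).mp hle))
  have hlim : Tendsto d atTop (𝓝 0) := by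
    refine tendsto_pi_nhds.mpr fun k => ?_
    simpa [d] using ((h.tendsto_I k).sub_const Complex.I).const_mul (Complex.I / 2)
  have hsmall : ∀ φ, twistBound ≤ φ → ‖d φ‖ ≤ 1 / 16 := by
    intro φ hφ
    by_contra hcon
    have hlim' : Tendsto (fun φ => ‖d φ‖) atTop (𝓝 0) := by simpa using hlim.norm
    obtain ⟨ψ, hψ1, hψ2⟩ := ((hlim'.eventually (gt_mem_nhds (by norm_num : (0 : ℝ) < 1 / 20))).and
      (eventually_ge_atTop twistBound)).exists
    obtain ⟨x, hx, hx'⟩ := isPreconnected_Ici.intermediate_value (Set.mem_Ici.mpr hψ2)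
      (Set.mem_Ici.mpr hφ) hcont ⟨hψ1.le, by linarith⟩
    have := hgap x hx (by simp only at hx'; rw [hx']; norm_num)
    simp only at hx'
    rw [hx'] at this
    norm_num at this
  intro φ hφ
  have ht : ‖(Real.exp (-2 * φ) : ℂ)‖ ≤ 1 / 200 := norm_exp_le_of_twistBound_le hφ
  have heq := (hfix φ hφ).eq (isFixedPoint_rootFun hI (ht.trans (by norm_num)))
    (norm_unitPhase L I) hI.card_le ht ((pi_norm_le_iff_of_nonneg (by norm_num)).mp (hsmall φ hφ))
    fun k => (norm_rootFun_le hX (norm_unitPhase L I k).le (ht.trans (by norm_num))).trans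
      (by norm_num)
  ext k
  rw [hlam, heq, branch]

end Branch

end TwistedBethe

namespace TwistedBethe

open MeasureTheory

/-! ### Moments of filling functions -/

section Moments

variable {m : ℝ} {χ : ℝ → ℝ}

lemma IsFirstLevelFilling.ae_bounds (hχ : IsFirstLevelFilling m χ) :
    ∀ᵐ x ∂volume.restrict (Set.Ioc (-((1 + m) / 2)) ((1 + m) / 2)), 0 ≤ χ x ∧ χ x ≤ 1 :=
  (ae_restrict_iff' measurableSet_Ioc).mpr
    (Eventually.of_forall fun x hx => hχ.bounds x (Set.Ioc_subset_Icc_self hx))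

lemma IsFirstLevelFilling.integrable (hχ : IsFirstLevelFilling m χ) :
    Integrable χ (volume.restrict (Set.Ioc (-((1 + m) / 2)) ((1 + m) / 2))) := by
  refine Integrable.of_bound hχ.measurable.aestronglyMeasurable 1 ?_
  filter_upwards [hχ.ae_bounds] with x hx
  rw [Real.norm_of_nonneg hx.1]
  exact hx.2

lemma IsFirstLevelFilling.density_le_one (hm : 0 < m) (hχ : IsFirstLevelFilling m χ) : m ≤ 1 := by
  have hAB : -((1 + m) / 2) ≤ (1 + m) / 2 := by linarith
  have h1 := hχ.integral_eq
  rw [intervalIntegral.integral_of_le hAB] at h1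
  calc m = ∫ x in Set.Ioc (-((1 + m) / 2)) ((1 + m) / 2), χ x := h1.symm
    _ ≤ ∫ x in Set.Ioc (-((1 + m) / 2)) ((1 + m) / 2),
        (Set.Icc (-(1 / 2) : ℝ) (1 / 2)).indicator (fun _ => (1 : ℝ)) x := by
        rw [integral_Ioc_eq_integral_Ioo, integral_Ioc_eq_integral_Ioo]
        refine setIntegral_mono_on (hχ.integrable.mono_measure
          (Measure.restrict_mono Set.Ioo_subset_Ioc_self le_rfl))
          ((integrable_const 1).indicator measurableSet_Icc) measurableSet_Ioo fun x hx => ?_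
        by_cases hx' : x ∈ Set.Icc (-(1 / 2) : ℝ) (1 / 2)
        · rw [Set.indicator_of_mem hx']
          exact (hχ.bounds x (Set.Ioo_subset_Icc_self hx)).2
        · rw [Set.indicator_of_notMem hx']
          refine (hχ.first_level x ?_ (abs_lt.mpr hx)).le
          by_contra hcon
          exact hx' (abs_le.mp (not_lt.mp hcon))
    _ = ∫ x in Set.Icc (-(1 / 2) : ℝ) (1 / 2), (1 : ℝ) := by
        rw [setIntegral_indicator measurableSet_Icc, Set.inter_eq_right.mpr]
        intro x hx
        exact ⟨by linarith [hx.1], by linarith [hx.2]⟩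
    _ = 1 := by simp; norm_num

lemma norm_fourier (a : ℤ) (x : ℝ) :
    ‖Complex.exp (2 * Complex.I * Real.pi * a * x)‖ = 1 := by
  have : 2 * Complex.I * Real.pi * a * x = ((2 * Real.pi * a * x : ℝ) : ℂ) * Complex.I := by
    push_cast; ring
  rw [this, Complex.norm_exp_ofReal_mul_I]

lemma IsFirstLevelFilling.norm_moment_le (hm : 0 < m) (hχ : IsFirstLevelFilling m χ) (a : ℤ) :
    ‖moment m χ a‖ ≤ 1 := by
  have hAB : -((1 + m) / 2) ≤ (1 + m) / 2 := by linarith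
  have h1 := hχ.integral_eq
  rw [intervalIntegral.integral_of_le hAB] at h1
  rw [moment, intervalIntegral.integral_of_le hAB]
  refine (norm_integral_le_of_norm_le hχ.integrable ?_).trans
    (h1.le.trans (hχ.density_le_one hm))
  filter_upwards [hχ.ae_bounds] with x hx
  rw [norm_mul, norm_fourier, one_mul, Complex.norm_real, Real.norm_of_nonneg hx.1]

lemma integral_Ioc_ite_deriv {f g : ℝ → ℂ} (hf : ∀ x, HasDerivAt f (g x) x) (hg : Continuous g)
    {A B x : ℝ} (hA : A ≤ x) (hB : x ≤ B) :
    ∫ s in Set.Ioc A B, (if x < s then g s else 0) = f B - f x := by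
  have h1 : (fun s => if x < s then g s else 0) = (Set.Ioi x).indicator g := by
    ext s; simp [Set.indicator_apply]
  rw [h1, setIntegral_indicator measurableSet_Ioi]
  have h2 : Set.Ioc A B ∩ Set.Ioi x = Set.Ioc x B := by
    ext s; simp only [Set.mem_inter_iff, Set.mem_Ioc, Set.mem_Ioi]
    constructor
    · rintro ⟨⟨_, h⟩, h'⟩; exact ⟨h', h⟩
    · rintro ⟨h, h'⟩; exact ⟨⟨hA.trans_lt h, h'⟩, h⟩
  rw [h2, ← intervalIntegral.integral_of_le hB]
  exact intervalIntegral.integral_eq_sub_of_hasDerivAt (fun s _ => hf s) (hg.intervalIntegrable _ _)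

lemma integral_Ioc_ite_lt {f : ℝ → ℝ} {A B s : ℝ} (hs : s ∈ Set.Ioc A B) :
    ∫ x in Set.Ioc A B, (if x < s then f x else 0) = ∫ x in A..s, f x := by
  have h1 : (fun x => if x < s then f x else 0) = (Set.Iio s).indicator f := by
    ext s; simp [Set.indicator_apply]
  rw [h1, setIntegral_indicator measurableSet_Iio, intervalIntegral.integral_of_le hs.1.le,
    integral_Ioc_eq_integral_Ioo]
  congr 2
  ext x; simp only [Set.mem_inter_iff, Set.mem_Ioc, Set.mem_Iio, Set.mem_Ioo]
  constructor
  · rintro ⟨⟨h, _⟩, h'⟩; exact ⟨h, h'⟩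
  · rintro ⟨h, h'⟩; exact ⟨⟨h, h'.le.trans hs.2⟩, h'⟩

/-- Integration by parts against the distribution function of an integrable function. -/
lemma integral_mul_eq_sub_integral_primitive {f g : ℝ → ℂ} (hf : ∀ x, HasDerivAt f (g x) x)
    (hg : Continuous g) {C : ℝ} (hgC : ∀ x, ‖g x‖ ≤ C) {A B : ℝ} {χ : ℝ → ℝ}
    (hχ : Integrable χ (volume.restrict (Set.Ioc A B))) (hfi : Integrable (fun x => f x * (χ x : ℂ))
      (volume.restrict (Set.Ioc A B))) :
    ∫ x in Set.Ioc A B, f x * (χ x : ℂ) = f B * ((∫ x in Set.Ioc A B, χ x : ℝ) : ℂ)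
      - ∫ s in Set.Ioc A B, g s * ((∫ x in A..s, χ x : ℝ) : ℂ) := by
  set μ := volume.restrict (Set.Ioc A B) with hμ
  have hχc : Integrable (fun x => (χ x : ℂ)) μ := hχ.ofReal
  have hprod : Integrable (Function.uncurry fun x s : ℝ => (if x < s then g s else 0) * (χ x : ℂ))
      (μ.prod μ) := by
    have h1 : Integrable (fun p : ℝ × ℝ => (χ p.1 : ℂ)) (μ.prod μ) := hχc.comp_fst μ
    refine h1.bdd_mul (c := C) ?_ (Eventually.of_forall fun p => ?_)
    · refine Measurable.aestronglyMeasurable (Measurable.ite ?_ ?_ measurable_const)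
      · exact measurableSet_lt measurable_fst measurable_snd
      · exact hg.measurable.comp measurable_snd
    · split_ifs
      · exact hgC _
      · rw [norm_zero]; exact (norm_nonneg _).trans (hgC 0)
  have hswap := integral_integral_swap hprod
  have hL : ∫ x, ∫ s, (if x < s then g s else 0) * (χ x : ℂ) ∂μ ∂μ =
      ∫ x, (f B * (χ x : ℂ) - f x * (χ x : ℂ)) ∂μ := by
    refine setIntegral_congr_fun measurableSet_Ioc fun x hx => ?_
    rw [integral_mul_const, hμ, integral_Ioc_ite_deriv hf hg hx.1.le hx.2]
    ring
  have hR : ∫ s, ∫ x, (if x < s then g s else 0) * (χ x : ℂ) ∂μ ∂μ =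
      ∫ s, g s * ((∫ x in A..s, χ x : ℝ) : ℂ) ∂μ := by
    refine setIntegral_congr_fun measurableSet_Ioc fun s hs => ?_
    rw [← integral_Ioc_ite_lt hs, ← integral_complex_ofReal, ← integral_const_mul]
    refine integral_congr_ae (Eventually.of_forall fun x => ?_)
    simp only
    split_ifs <;> simp
  rw [hL, hR, integral_sub (hχc.const_mul _) hfi, integral_const_mul, integral_complex_ofReal] at hswap
  rw [← hswap]
  ring

lemma card_subtype_eq_sum {N : ℕ} (p : Fin N → Prop) [DecidablePred p] :
    (Nat.card {k : Fin N // p k} : ℝ) = ∑ k, if p k then 1 else 0 := by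
  rw [Nat.card_eq_fintype_card, Fintype.card_subtype, Finset.sum_boole]

lemma HasFilling.tendsto_moment (hm : 0 < m) (hχ : IsFirstLevelFilling m χ) {L N : ℕ → ℕ}
    {I : ∀ j, Fin (N j) → ℝ} (h : HasFilling m χ L N I) (a : ℤ) :
    Tendsto (fun j => 1 / (L j : ℂ) *
      ∑ k, Complex.exp (2 * Complex.I * Real.pi * a * ((I j k : ℂ) / L j)))
      atTop (𝓝 (moment m χ a)) := by
  set A := -((1 + m) / 2) with hA
  set B := (1 + m) / 2 with hB
  have hAB : A ≤ B := by linarith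
  let f : ℝ → ℂ := fun x => Complex.exp (2 * Complex.I * Real.pi * a * x)
  let g : ℝ → ℂ := fun x => 2 * Complex.I * Real.pi * a * Complex.exp (2 * Complex.I * Real.pi * a * x)
  have hf : ∀ x, HasDerivAt f (g x) x := fun x => by
    have h1 : HasDerivAt (fun x : ℝ => 2 * Complex.I * Real.pi * a * (x : ℂ))
        (2 * Complex.I * Real.pi * a) x := by
      simpa using (Complex.ofRealCLM.hasDerivAt (x := x)).const_mul (2 * Complex.I * Real.pi * a)
    exact h1.cexp.congr_deriv (mul_comm _ _)
  have hg : Continuous g := by fun_prop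
  set C : ℝ := ‖2 * Complex.I * Real.pi * a‖ with hC
  have hgC : ∀ x, ‖g x‖ ≤ C := fun x => by rw [norm_mul, norm_fourier, mul_one]
  have hfc : Continuous f := by fun_prop
  have hfi : Integrable (fun x => f x * (χ x : ℂ)) (volume.restrict (Set.Ioc A B)) :=
    hχ.integrable.ofReal.bdd_mul (c := 1) hfc.aestronglyMeasurable
      (Eventually.of_forall fun x => (norm_fourier a x).le)
  have hx : ∀ j k, A < I j k / L j ∧ I j k / L j < B := fun j k => by
    have hL : (0 : ℝ) < L j := by exact_mod_cast (h.firstLevel j).size_pos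
    have hr := (h.firstLevel j).range k
    rw [lt_div_iff₀ hL, div_lt_iff₀ hL]
    constructor
    · have : (1 / 2 : ℝ) * L j ≤ B * L j := mul_le_mul_of_nonneg_right (by linarith) hL.le
      have hneg : A * L j = -(B * L j) := by rw [hA, hB]; ring
      linarith
    · have : (1 / 2 : ℝ) * L j < B * L j := mul_lt_mul_of_pos_right (by linarith) hL
      linarith
  have hsum : ∀ j, 1 / (L j : ℂ) * ∑ k, Complex.exp (2 * Complex.I * Real.pi * a * ((I j k : ℂ) / L j)) =
      f B * ((N j / L j : ℝ) : ℂ) - ∫ s in Set.Ioc A B,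
        g s * (((∑ k, if I j k / L j < s then (1 : ℝ) else 0) / L j : ℝ) : ℂ) := by
    intro j
    have h1 : ∀ k, Complex.exp (2 * Complex.I * Real.pi * a * ((I j k : ℂ) / L j)) =
        f B - ∫ s in Set.Ioc A B, (if I j k / L j < s then g s else 0) := fun k => by
      rw [integral_Ioc_ite_deriv hf hg (hx j k).1.le (hx j k).2.le]
      simp [f]
    have hint : ∀ k, Integrable (fun s => if I j k / L j < s then g s else 0)
        (volume.restrict (Set.Ioc A B)) := fun k => by
      refine Integrable.of_bound (Measurable.aestronglyMeasurable (Measurable.ite measurableSet_Ioi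
        hg.measurable measurable_const)) C (Eventually.of_forall fun s => ?_)
      split_ifs
      · exact hgC _
      · rw [norm_zero]; exact norm_nonneg _
    simp only [h1]
    rw [Finset.sum_sub_distrib, ← integral_finsetSum _ fun k _ => hint k, mul_sub,
      ← integral_const_mul]
    congr 1
    · simp; ring
    · refine integral_congr_ae (Eventually.of_forall fun s => ?_)
      simp only
      push_cast
      rw [Finset.sum_div, Finset.mul_sum, Finset.mul_sum]
      refine Finset.sum_congr rfl fun k _ => ?_
      split_ifs <;> simp [div_eq_mul_inv, mul_comm]
  simp only [hsum]
  have hlim : moment m χ a = f B * (m : ℂ) - ∫ s in Set.Ioc A B, g s * ((∫ x in A..s, χ x : ℝ) : ℂ) := by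
    have h1 := hχ.integral_eq
    rw [intervalIntegral.integral_of_le hAB] at h1
    rw [moment, intervalIntegral.integral_of_le hAB,
      integral_mul_eq_sub_integral_primitive hf hg hgC hχ.integrable hfi, h1]
  rw [hlim]
  refine Tendsto.sub (Tendsto.const_mul _ ?_) ?_
  · exact (Complex.continuous_ofReal.tendsto m).comp h.density_tendsto
  · refine tendsto_integral_of_dominated_convergence (fun _ => C) (fun j => ?_)
      (integrable_const C) (fun j => Eventually.of_forall fun s => ?_) ?_
    · refine (hg.measurable.mul (Complex.measurable_ofReal.comp (Measurable.div_const
        (Finset.measurable_sum _ fun k _ => Measurable.ite measurableSet_Ioi measurable_const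
          measurable_const) _))).aestronglyMeasurable
    · rw [norm_mul]
      refine (mul_le_of_le_one_right (norm_nonneg _) ?_).trans (hgC s)
      have hle := (h.firstLevel j).card_le
      rw [Complex.norm_real, Real.norm_of_nonneg (div_nonneg (Finset.sum_nonneg fun k _ => by
        split_ifs <;> norm_num) (Nat.cast_nonneg _))]
      refine div_le_one_of_le₀ ((Finset.sum_le_sum (g := fun _ => (1 : ℝ)) fun k _ => by
        split_ifs <;> norm_num).trans ?_) (Nat.cast_nonneg _)
      simpa using hle
    · refine (ae_restrict_iff' measurableSet_Ioc).mpr (Eventually.of_forall fun s hs => ?_)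
      refine Tendsto.const_mul _ ((Complex.continuous_ofReal.tendsto _).comp ?_)
      have h1 := h.count_tendsto A s le_rfl hs.1 hs.2
      refine h1.congr fun j => ?_
      rw [card_subtype_eq_sum]
      simp only [(hx j _).1, true_and]

end Moments

end TwistedBethe

namespace TwistedBethe

/-! ### Convergence of the expansions -/

section Expansion

variable {X : ℤ → ℂ} {c : ℕ → ℕ → ℂ}

lemma polyNorm_coeff_le {s : ℝ} {F : PowerSeries (Polynomial ℂ)}
    (hF : ∀ B, truncNorm (1 / 100) B F ≤ s) (b : ℕ) :
    polyNorm (PowerSeries.coeff b F) ≤ s * 100 ^ b := by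
  have h1 : polyNorm (PowerSeries.coeff b F) * (1 / 100) ^ b ≤ s := by
    refine le_trans ?_ (hF b)
    exact Finset.single_le_sum (f := fun b => polyNorm (PowerSeries.coeff b F) * (1 / 100) ^ b)
      (fun b _ => mul_nonneg (polyNorm_nonneg _) (by positivity)) (Finset.self_mem_range_succ b)
  rw [one_div, inv_pow, ← div_eq_mul_inv, div_le_iff₀ (by positivity)] at h1
  exact h1

lemma mul_pow_le_half {s t x : ℝ} {b : ℕ} (hs : 0 ≤ s) (ht0 : 0 ≤ t) (ht : t ≤ 1 / 200)
    (hx : x ≤ s * 100 ^ b) : x * t ^ b ≤ s * (1 / 2) ^ b := by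
  calc x * t ^ b ≤ s * 100 ^ b * (1 / 200) ^ b :=
        mul_le_mul hx (pow_le_pow_left₀ ht0 ht b) (by positivity) (by positivity)
    _ = s * (1 / 2) ^ b := by rw [mul_assoc, ← mul_pow]; norm_num

lemma IsRootExpansion.polyNorm_coeff_halfCoeff (hc : IsRootExpansion X c) (b : ℕ) :
    polyNorm (PowerSeries.coeff b (rowSeries (halfCoeff c))) =
      ∑ a ∈ Finset.range (b + 1), ‖halfCoeff c a b‖ := by
  rw [polyNorm_eq_sum (s := Finset.range (b + 1))]
  · exact Finset.sum_congr rfl fun a _ => by rw [coeff_rowSeries hc.halfCoeff_support]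
  · intro a ha
    by_contra hlt
    rw [Polynomial.mem_support_iff, coeff_rowSeries hc.halfCoeff_support] at ha
    exact ha (hc.halfCoeff_support a b (by simpa using hlt))

lemma eq_mul_halfCoeff (c : ℕ → ℕ → ℂ) (a b : ℕ) : c a b = -(2 * Complex.I) * halfCoeff c a b := by
  rw [halfCoeff]
  linear_combination (c a b) * Complex.I_mul_I

lemma IsRootExpansion.summable_rootSeries (hc : IsRootExpansion X c) (hX : ∀ a, ‖X a‖ ≤ 1)
    {r : ℝ} (hr0 : 0 ≤ r) (hr : r ≤ 1 / 200) :
    Summable fun p : ℕ × ℕ => r ^ p.2 * ‖c p.1 p.2‖ := by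
  rw [← (Equiv.prodComm ℕ ℕ).summable_iff, summable_prod_of_nonneg fun p => by
    simp only [Equiv.prodComm_apply, Function.comp_apply, Pi.zero_apply]; positivity]
  have hsum : ∀ b, HasSum (fun a => r ^ b * ‖c a b‖)
      (r ^ b * (2 * polyNorm (PowerSeries.coeff b (rowSeries (halfCoeff c))))) := by
    intro b
    rw [hc.polyNorm_coeff_halfCoeff, Finset.mul_sum, Finset.mul_sum]
    refine hasSum_of_forall_eq (hasSum_sum_of_ne_finset_zero
      (f := fun a => r ^ b * (2 * ‖halfCoeff c a b‖)) fun a ha => ?_) fun a => ?_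
    · rw [hc.halfCoeff_support a b (by simpa using ha)]; simp
    · rw [eq_mul_halfCoeff c, norm_mul, norm_neg, norm_mul, Complex.norm_I]; simp
  refine ⟨fun b => (hsum b).summable, ?_⟩
  refine Summable.of_nonneg_of_le (fun b => tsum_nonneg fun a => ?_) (fun b => ?_)
    ((summable_geometric_of_lt_one (r := 1 / 2) (by norm_num) (by norm_num)).mul_left (1 / 40))
  · simp only [Equiv.prodComm_apply, Function.comp_apply]; positivity
  · refine (hsum b).tsum_eq.trans_le ?_
    have := mul_pow_le_half (by norm_num) hr0 hr (polyNorm_coeff_le (hc.truncNorm_halfCoeff_le hX) b)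
    linarith

lemma IsRootExpansion.hasSum_rootSeries (hc : IsRootExpansion X c) (hX : ∀ a, ‖X a‖ ≤ 1)
    {r : ℝ} (hr0 : 0 ≤ r) (hr : r ≤ 1 / 200) {w : ℂ} (hw : ‖w‖ = 1) :
    HasSum (fun p : ℕ × ℕ => (r : ℂ) ^ p.2 * w ^ p.1 * c p.1 p.2)
      (-(2 * Complex.I) * rootFun c r w) := by
  have ht : ‖(r : ℂ)‖ ≤ 1 / 100 := by
    rw [Complex.norm_real, Real.norm_of_nonneg hr0]; linarith
  have hs : Summable fun p : ℕ × ℕ => (r : ℂ) ^ p.2 * w ^ p.1 * c p.1 p.2 := by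
    refine Summable.of_norm ((hc.summable_rootSeries hX hr0 hr).congr fun p => ?_)
    rw [norm_mul, norm_mul, norm_pow, norm_pow, hw, one_pow, mul_one, Complex.norm_real,
      Real.norm_of_nonneg hr0]
  have h1 := (Equiv.prodComm ℕ ℕ).hasSum_iff.mpr hs.hasSum
  have h2 := h1.prod_fiberwise (g := fun b => -(2 * Complex.I) *
    (PowerSeries.coeff b (evalCoeff w (rowSeries (halfCoeff c))) * (r : ℂ) ^ b)) fun b => by
      rw [coeff_evalCoeff, Polynomial.eval_eq_sum_range' (n := b + 1), Finset.sum_mul, Finset.mul_sum]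
      · refine hasSum_of_forall_eq (hasSum_sum_of_ne_finset_zero fun a ha => ?_) fun a => ?_
        · rw [coeff_rowSeries hc.halfCoeff_support, hc.halfCoeff_support a b (by simpa using ha)]
          simp
        · simp only [Function.comp_apply, Equiv.prodComm_apply, Prod.swap_prod_mk]
          rw [coeff_rowSeries hc.halfCoeff_support, eq_mul_halfCoeff c]; ring
      · refine Nat.lt_succ_of_le (Polynomial.natDegree_le_iff_coeff_eq_zero.mpr fun a ha => ?_)
        rw [coeff_rowSeries hc.halfCoeff_support, hc.halfCoeff_support a b (by omega)]
  have h3 := (hc.absEval_halfCoeff hX hw.le ht).hasSum.mul_left (-(2 * Complex.I))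
  have h4 := h2.unique h3
  rw [rootFun, ← h4]
  exact hs.hasSum

/-! ### The energy -/

/-- The generating series of `1 / (1 + c̃)`. -/
noncomputable def tildeInvSeries (c : ℕ → ℕ → ℂ) : PowerSeries (Polynomial ℂ) :=
  seriesComp (fun n => (-1) ^ n) (rowSeries (ctilde c))

/-- The generating series of `t / (1 - d)`. -/
noncomputable def rootInvSeries (c : ℕ → ℕ → ℂ) : PowerSeries (Polynomial ℂ) :=
  PowerSeries.X * seriesComp (fun _ => 1) (rowSeries (halfCoeff c))

lemma IsRootExpansion.energyCoeff_eq_momentFunctional (hc : IsRootExpansion X c) (j : ℕ) :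
    energyCoeff X c ((j : ℤ) - 1) =
      1 / 2 * (momentFunctional (fun i : ℕ => X ((i : ℤ) - 1)) (PowerSeries.coeff j (tildeInvSeries c))
        + momentFunctional (fun i : ℕ => X i) (PowerSeries.coeff j (rootInvSeries c))) := by
  have h1 : momentFunctional (fun i : ℕ => X ((i : ℤ) - 1)) (PowerSeries.coeff j (tildeInvSeries c)) =
      ∑ n ∈ Finset.range (j + 1), ∑ i ∈ Finset.range (j + 1), X ((i : ℤ) - 1) *
        ((-1) ^ n * convPow (ctilde c) n i j) := by
    rw [tildeInvSeries, seriesComp, PowerSeries.coeff_mk, map_sum]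
    refine Finset.sum_congr rfl fun n _ => ?_
    rw [map_smul, momentFunctional_eq_sum _ _ (j + 1), Finset.smul_sum]
    · refine Finset.sum_congr rfl fun i _ => ?_
      rw [coeff_rowSeries_pow hc.ctilde_support, smul_eq_mul]; ring
    · intro a ha
      rw [coeff_rowSeries_pow hc.ctilde_support,
        convPow_eq_zero_of_support hc.ctilde_support _ _ _ (by omega)]
  have h2 : momentFunctional (fun i : ℕ => X i) (PowerSeries.coeff j (rootInvSeries c)) =
      ∑ n ∈ Finset.range (j + 1), ∑ i ∈ Finset.range (j + 1), X ((i : ℤ) - 1) *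
        zext (convPow (halfCoeff c) n) ((i : ℤ) - 1) ((j : ℤ) - 1) := by
    rcases j with _ | j
    · simp [rootInvSeries, zext]
    · rw [rootInvSeries, PowerSeries.coeff_succ_X_mul,
        coeff_seriesComp hc.coeff_zero_halfCoeff_series _ (by omega : j < j + 1 + 1), map_sum]
      refine Finset.sum_congr rfl fun n _ => ?_
      rw [Finset.sum_range_succ', one_smul, momentFunctional_eq_sum _ _ (j + 1)]
      · have h0 : zext (convPow (halfCoeff c) n) (((0 : ℕ) : ℤ) - 1) (((j + 1 : ℕ) : ℤ) - 1) = 0 := by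
          simp [zext]
        rw [h0, mul_zero, add_zero]
        refine Finset.sum_congr rfl fun i _ => ?_
        have h3 : zext (convPow (halfCoeff c) n) (((i + 1 : ℕ) : ℤ) - 1) (((j + 1 : ℕ) : ℤ) - 1) =
            convPow (halfCoeff c) n i j := by
          simp [zext]
        have h4 : ((i + 1 : ℕ) : ℤ) - 1 = i := by push_cast; ring
        rw [h3, h4, coeff_rowSeries_pow hc.halfCoeff_support, mul_comm]
      · intro a ha
        rw [coeff_rowSeries_pow hc.halfCoeff_support,
          convPow_eq_zero_of_support hc.halfCoeff_support _ _ _ (by omega)]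
  rw [h1, h2, hc.energyCoeff_eq, ← Finset.sum_add_distrib, Finset.mul_sum]
  refine Finset.sum_congr rfl fun n _ => ?_
  rw [← Finset.sum_add_distrib, Finset.mul_sum]
  exact Finset.sum_congr rfl fun i _ => by ring

lemma sum_range_pow_le_two {x : ℝ} (hx : 0 ≤ x) (hx1 : x ≤ 1 / 2) (M : ℕ) :
    ∑ n ∈ Finset.range M, x ^ n ≤ 2 := by
  have h1 : x < 1 := by linarith
  refine ((summable_geometric_of_lt_one hx h1).sum_le_tsum _ fun n _ => by positivity).trans ?_
  rw [tsum_geometric_of_lt_one hx h1, inv_eq_one_div, div_le_iff₀ (by linarith)]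
  linarith

lemma IsRootExpansion.truncNorm_tildeInvSeries_le (hc : IsRootExpansion X c) (hX : ∀ a, ‖X a‖ ≤ 1)
    (B : ℕ) : truncNorm (1 / 100) B (tildeInvSeries c) ≤ 2 := by
  refine (truncNorm_seriesComp_le (by norm_num) _ _ _).trans ?_
  simp only [norm_pow, norm_neg, norm_one, one_pow, one_mul]
  exact sum_range_pow_le_two (truncNorm_nonneg (by norm_num) _ _)
    ((hc.truncNorm_ctilde_le hX B).trans (by norm_num)) _

lemma IsRootExpansion.truncNorm_rootInvSeries_le (hc : IsRootExpansion X c) (hX : ∀ a, ‖X a‖ ≤ 1)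
    (B : ℕ) : truncNorm (1 / 100) B (rootInvSeries c) ≤ 2 := by
  refine (truncNorm_mono (by norm_num) (Nat.le_succ B) _).trans ?_
  rw [rootInvSeries, Nat.succ_eq_add_one, truncNorm_X_mul]
  have h1 : truncNorm (1 / 100) B (seriesComp (fun _ => 1) (rowSeries (halfCoeff c))) ≤ 2 := by
    refine (truncNorm_seriesComp_le (by norm_num) _ _ _).trans ?_
    simp only [norm_one, one_mul]
    exact sum_range_pow_le_two (truncNorm_nonneg (by norm_num) _ _)
      ((hc.truncNorm_halfCoeff_le hX B).trans (by norm_num)) _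
  linarith

lemma IsRootExpansion.norm_energyCoeff_le (hc : IsRootExpansion X c) (hX : ∀ a, ‖X a‖ ≤ 1) (j : ℕ) :
    ‖energyCoeff X c ((j : ℤ) - 1)‖ ≤ 2 * 100 ^ j := by
  rw [hc.energyCoeff_eq_momentFunctional, norm_mul]
  have h1 := (norm_momentFunctional_le (X := fun i : ℕ => X ((i : ℤ) - 1)) (fun i => hX _) _).trans
    (polyNorm_coeff_le (hc.truncNorm_tildeInvSeries_le hX) j)
  have h2 := (norm_momentFunctional_le (X := fun i : ℕ => X i) (fun i => hX _) _).trans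
    (polyNorm_coeff_le (hc.truncNorm_rootInvSeries_le hX) j)
  have h3 : ‖(1 / 2 : ℂ)‖ = 1 / 2 := by norm_num
  rw [h3]
  linarith [norm_add_le (momentFunctional (fun i : ℕ => X ((i : ℤ) - 1))
    (PowerSeries.coeff j (tildeInvSeries c)))
    (momentFunctional (fun i : ℕ => X i) (PowerSeries.coeff j (rootInvSeries c)))]

lemma IsRootExpansion.norm_energyTerm_le (hc : IsRootExpansion X c) (hX : ∀ a, ‖X a‖ ≤ 1) {t : ℂ}
    (ht : ‖t‖ ≤ 1 / 200) (j : ℕ) :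
    ‖energyCoeff X c ((j : ℤ) - 1) * t ^ j‖ ≤ 2 * (1 / 2) ^ j := by
  rw [norm_mul, norm_pow]
  exact mul_pow_le_half (by norm_num) (norm_nonneg _) ht (hc.norm_energyCoeff_le hX j)

lemma summable_two_mul_half_pow : Summable fun j : ℕ => 2 * (1 / 2 : ℝ) ^ j :=
  (summable_geometric_of_lt_one (by norm_num) (by norm_num)).mul_left 2

lemma IsRootExpansion.summable_energyTerm (hc : IsRootExpansion X c) (hX : ∀ a, ‖X a‖ ≤ 1) {t : ℂ}
    (ht : ‖t‖ ≤ 1 / 200) : Summable fun j : ℕ => energyCoeff X c ((j : ℤ) - 1) * t ^ j :=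
  Summable.of_norm_bounded summable_two_mul_half_pow (hc.norm_energyTerm_le hX ht)

end Expansion

section EmpiricalEnergy

variable {L N : ℕ} {z : Fin N → ℂ} {c : ℕ → ℕ → ℂ}

lemma momentFunctional_empiricalMoment_sub_one (L : ℕ) {N : ℕ} {z : Fin N → ℂ} (hz : ∀ k, z k ≠ 0)
    (P : Polynomial ℂ) : momentFunctional (fun i : ℕ => empiricalMoment L z ((i : ℤ) - 1)) P =
      1 / (L : ℂ) * ∑ k, (z k)⁻¹ * P.eval (z k) := by
  rw [momentFunctional_eq_sum _ _ (P.natDegree + 1)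
    fun a ha => Polynomial.coeff_eq_zero_of_natDegree_lt (by omega)]
  simp only [Polynomial.eval_eq_sum_range, empiricalMoment, zpow_sub_one₀ (hz _), zpow_natCast,
    Finset.mul_sum]
  rw [Finset.sum_comm]
  exact Finset.sum_congr rfl fun k _ => Finset.sum_congr rfl fun a _ => by ring

lemma IsRootExpansion.hasSum_tildeInvSeries {X : ℤ → ℂ} (hc : IsRootExpansion X c)
    (hX : ∀ a, ‖X a‖ ≤ 1) {w t : ℂ} (hw : ‖w‖ ≤ 1) (ht : ‖t‖ ≤ 1 / 100) :
    HasSum (fun j => (PowerSeries.coeff j (tildeInvSeries c)).eval w * t ^ j)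
      (1 + tildeFun c t w)⁻¹ := by
  have hU := hc.absEval_ctilde hX hw ht
  have h1 := hU.seriesComp (coeff_zero_evalCoeff hc.coeff_zero_ctilde_series w)
    (summable_of_norm_le_one (g := fun n => (-1) ^ n) (fun n => by simp) (by norm_num) (by norm_num))
  have h2 : ∑' n : ℕ, (-1) ^ n * tildeFun c t w ^ n = (1 + tildeFun c t w)⁻¹ := by
    have h3 : ‖-tildeFun c t w‖ < 1 := by
      rw [norm_neg]; exact hU.norm_le.trans_lt (by norm_num)
    rw [← sub_neg_eq_add 1, ← tsum_geometric_of_norm_lt_one h3]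
    exact tsum_congr fun n => (neg_pow _ _).symm
  rw [← h2]
  refine hasSum_of_forall_eq h1 fun j => ?_
  rw [← evalCoeff_seriesComp, coeff_evalCoeff, tildeInvSeries]

lemma IsRootExpansion.hasSum_rootInvSeries {X : ℤ → ℂ} (hc : IsRootExpansion X c)
    (hX : ∀ a, ‖X a‖ ≤ 1) {w t : ℂ} (hw : ‖w‖ ≤ 1) (ht : ‖t‖ ≤ 1 / 100) :
    HasSum (fun j => (PowerSeries.coeff j (rootInvSeries c)).eval w * t ^ j)
      (t * (1 - rootFun c t w)⁻¹) := by
  have hD := hc.absEval_halfCoeff hX hw ht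
  have h1 := hD.seriesComp (coeff_zero_evalCoeff hc.coeff_zero_halfCoeff_series w)
    (summable_of_norm_le_one (g := fun _ => 1) (fun n => by simp) (by norm_num) (by norm_num))
  have h2 : ∑' n : ℕ, 1 * rootFun c t w ^ n = (1 - rootFun c t w)⁻¹ := by
    simp only [one_mul]
    exact tsum_geometric_of_norm_lt_one (hD.norm_le.trans_lt (by norm_num))
  rw [← h2]
  refine ((hasSum_nat_add_iff' (f := fun j =>
    (PowerSeries.coeff j (rootInvSeries c)).eval w * t ^ j) 1).mp ?_)
  have h0 : PowerSeries.coeff 0 (rootInvSeries c) = 0 := by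
    rw [rootInvSeries, PowerSeries.coeff_zero_X_mul]
  rw [Finset.sum_range_one, h0, Polynomial.eval_zero, zero_mul, sub_zero]
  refine hasSum_of_forall_eq (h1.mul_left t) fun j => ?_
  rw [rootInvSeries, PowerSeries.coeff_succ_X_mul, ← evalCoeff_seriesComp, coeff_evalCoeff]
  ring

lemma IsRootExpansion.hasSum_energyTerm (hc : IsRootExpansion (empiricalMoment L z) c)
    (hz : ∀ k, ‖z k‖ = 1) (hNL : N ≤ L) {t : ℂ} (ht0 : t ≠ 0) (ht : ‖t‖ ≤ 1 / 100) :
    HasSum (fun j : ℕ => energyCoeff (empiricalMoment L z) c ((j : ℤ) - 1) * t ^ j)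
      (t * energyPerSite L N (fun k => Complex.I - 2 * Complex.I * rootFun c t (z k))) := by
  have hX := norm_empiricalMoment_le hz hNL
  have hz0 : ∀ k, z k ≠ 0 := fun k h => by have := hz k; rw [h, norm_zero] at this; norm_num at this
  have h1 := ((hasSum_sum (s := Finset.univ) fun k _ =>
      (((hc.hasSum_tildeInvSeries hX (hz k).le ht).mul_left (z k)⁻¹).add
        (hc.hasSum_rootInvSeries hX (hz k).le ht))).mul_left (1 / (L : ℂ))).mul_left (1 / 2)
  have hval : t * energyPerSite L N (fun k => Complex.I - 2 * Complex.I * rootFun c t (z k)) =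
      1 / 2 * (1 / (L : ℂ) * ∑ k, ((z k)⁻¹ * (1 + tildeFun c t (z k))⁻¹
        + t * (1 - rootFun c t (z k))⁻¹)) := by
    rw [energyPerSite, mul_left_comm, mul_left_comm (1 / 2 : ℂ), Finset.mul_sum Finset.univ _ t,
      Finset.mul_sum Finset.univ _ (1 / 2 : ℂ)]
    refine congrArg (1 / (L : ℂ) * ·) (Finset.sum_congr rfl fun k _ => ?_)
    have hu : ‖tildeFun c t (z k)‖ ≤ 1 / 4 := (hc.absEval_ctilde hX (hz k).le ht).norm_le
    have hd : ‖rootFun c t (z k)‖ ≤ 1 / 80 := (hc.absEval_halfCoeff hX (hz k).le ht).norm_le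
    have n1 : 1 + tildeFun c t (z k) ≠ 0 := one_add_ne_zero_of_norm_lt (hu.trans_lt (by norm_num))
    have n2 : 1 - rootFun c t (z k) ≠ 0 := one_sub_ne_zero_of_norm_lt (hd.trans_lt (by norm_num))
    have hrt := hc.rootFun_eq hX (hz k).le ht
    have n3 : rootFun c t (z k) ≠ 0 := by
      rw [hrt]; exact mul_ne_zero (mul_ne_zero ht0 (hz0 k)) n1
    have e1 : (Complex.I - 2 * Complex.I * rootFun c t (z k)) ^ 2 + 1 =
        4 * rootFun c t (z k) * (1 - rootFun c t (z k)) := by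
      linear_combination (1 - 2 * rootFun c t (z k)) ^ 2 * Complex.I_mul_I
    have e2 : (z k)⁻¹ * (1 + tildeFun c t (z k))⁻¹ = t * (rootFun c t (z k))⁻¹ := by
      rw [hrt]
      field_simp
    rw [e1, e2]
    field_simp
    ring
  rw [hval]
  refine hasSum_of_forall_eq h1 fun j => ?_
  rw [hc.energyCoeff_eq_momentFunctional, momentFunctional_empiricalMoment_sub_one L hz0,
    momentFunctional_empiricalMoment, ← mul_add, ← Finset.sum_add_distrib, mul_assoc, mul_assoc,
    Finset.sum_mul]
  congr 2
  exact Finset.sum_congr rfl fun k _ => by ring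

end EmpiricalEnergy

/-! ### The thermodynamic limit -/

section Limit

variable {X : ℤ → ℂ} {Y : ℕ → ℤ → ℂ}

lemma tendsto_halfCoeff (h : ∀ a, Tendsto (fun j => Y j a) atTop (𝓝 (X a))) (a b : ℕ) :
    Tendsto (fun j => halfCoeff (rootCoeff (Y j)) a b) atTop (𝓝 (halfCoeff (rootCoeff X) a b)) :=
  ((continuous_of_mem_momentPoly (halfCoeff_mem b a)).tendsto X).comp (tendsto_pi_nhds.mpr h)

lemma tendsto_energyCoeff (h : ∀ a, Tendsto (fun j => Y j a) atTop (𝓝 (X a))) (b : ℕ) :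
    Tendsto (fun j => energyCoeff (Y j) (rootCoeff (Y j)) ((b : ℤ) - 1)) atTop
      (𝓝 (energyCoeff X (rootCoeff X) ((b : ℤ) - 1))) :=
  ((continuous_of_mem_momentPoly (energyCoeff_mem b)).tendsto X).comp (tendsto_pi_nhds.mpr h)

lemma tendsto_tsum_energyTerm (h : ∀ a, Tendsto (fun j => Y j a) atTop (𝓝 (X a)))
    (hY : ∀ j a, ‖Y j a‖ ≤ 1) {t : ℂ} (ht : ‖t‖ ≤ 1 / 200) :
    Tendsto (fun j => ∑' b : ℕ, energyCoeff (Y j) (rootCoeff (Y j)) ((b : ℤ) - 1) * t ^ b) atTop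
      (𝓝 (∑' b : ℕ, energyCoeff X (rootCoeff X) ((b : ℤ) - 1) * t ^ b)) :=
  tendsto_tsum_of_dominated_convergence summable_two_mul_half_pow
    (fun b => (tendsto_energyCoeff h b).mul_const _)
    (Eventually.of_forall fun j => (rootCoeff_isRootExpansion (Y j)).norm_energyTerm_le (hY j) ht)

/-- The distance of two root expansions, row by row. -/
noncomputable def rowDist (X Y : ℤ → ℂ) (b : ℕ) : ℝ :=
  polyNorm (PowerSeries.coeff b (rowSeries (halfCoeff (rootCoeff Y))) -
    PowerSeries.coeff b (rowSeries (halfCoeff (rootCoeff X))))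

lemma rowDist_nonneg (X Y : ℤ → ℂ) (b : ℕ) : 0 ≤ rowDist X Y b := polyNorm_nonneg _

lemma rowDist_eq (X Y : ℤ → ℂ) (b : ℕ) : rowDist X Y b =
    ∑ a ∈ Finset.range (b + 1), ‖halfCoeff (rootCoeff Y) a b - halfCoeff (rootCoeff X) a b‖ := by
  have hX := (rootCoeff_isRootExpansion X).halfCoeff_support
  have hY := (rootCoeff_isRootExpansion Y).halfCoeff_support
  rw [rowDist, polyNorm_eq_sum (s := Finset.range (b + 1))]
  · exact Finset.sum_congr rfl fun a _ => by
      rw [Polynomial.coeff_sub, coeff_rowSeries hX, coeff_rowSeries hY]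
  · intro a ha
    by_contra hlt
    rw [Polynomial.mem_support_iff, Polynomial.coeff_sub, coeff_rowSeries hX, coeff_rowSeries hY] at ha
    have hlt' : b < a := by simpa using hlt
    exact ha (by rw [hX a b hlt', hY a b hlt', sub_zero])

lemma rowDist_mul_pow_le {X Y : ℤ → ℂ} (hX : ∀ a, ‖X a‖ ≤ 1) (hY : ∀ a, ‖Y a‖ ≤ 1) {r : ℝ}
    (hr0 : 0 ≤ r) (hr : r ≤ 1 / 200) (b : ℕ) : rowDist X Y b * r ^ b ≤ 2 * (1 / 2) ^ b := by
  refine mul_pow_le_half (by norm_num) hr0 hr ((polyNorm_sub_le _ _).trans ?_)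
  have h1 := polyNorm_coeff_le ((rootCoeff_isRootExpansion X).truncNorm_halfCoeff_le hX) b
  have h2 := polyNorm_coeff_le ((rootCoeff_isRootExpansion Y).truncNorm_halfCoeff_le hY) b
  have h3 : (0 : ℝ) < 100 ^ b := by positivity
  linarith

lemma norm_rootFun_sub_le {X Y : ℤ → ℂ} (hX : ∀ a, ‖X a‖ ≤ 1) (hY : ∀ a, ‖Y a‖ ≤ 1) {t w : ℂ}
    (ht : ‖t‖ ≤ 1 / 200) (hw : ‖w‖ ≤ 1) :
    ‖rootFun (rootCoeff Y) t w - rootFun (rootCoeff X) t w‖ ≤ ∑' b, rowDist X Y b * ‖t‖ ^ b := by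
  have ht' : ‖t‖ ≤ 1 / 100 := ht.trans (by norm_num)
  have h1 := ((rootCoeff_isRootExpansion Y).absEval_halfCoeff hY hw ht').hasSum.sub
    ((rootCoeff_isRootExpansion X).absEval_halfCoeff hX hw ht').hasSum
  have h2 : Summable fun b => rowDist X Y b * ‖t‖ ^ b :=
    Summable.of_nonneg_of_le (fun b => mul_nonneg (polyNorm_nonneg _) (by positivity))
      (rowDist_mul_pow_le hX hY (norm_nonneg _) ht) summable_two_mul_half_pow
  rw [rootFun, rootFun, ← h1.tsum_eq]
  refine tsum_of_norm_bounded h2.hasSum fun b => ?_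
  rw [← sub_mul, norm_mul, norm_pow, coeff_evalCoeff, coeff_evalCoeff, ← Polynomial.eval_sub]
  exact mul_le_mul_of_nonneg_right (norm_eval_le hw _) (by positivity)

lemma tendsto_tsum_rowDist (h : ∀ a, Tendsto (fun j => Y j a) atTop (𝓝 (X a)))
    (hX : ∀ a, ‖X a‖ ≤ 1) (hY : ∀ j a, ‖Y j a‖ ≤ 1) {r : ℝ} (hr0 : 0 ≤ r) (hr : r ≤ 1 / 200) :
    Tendsto (fun j => ∑' b, rowDist X (Y j) b * r ^ b) atTop (𝓝 0) := by
  have h1 : Tendsto (fun j => ∑' b, rowDist X (Y j) b * r ^ b) atTop (𝓝 (∑' _ : ℕ, (0 : ℝ))) := by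
    refine tendsto_tsum_of_dominated_convergence summable_two_mul_half_pow (fun b => ?_)
      (Eventually.of_forall fun j b => ?_)
    · rw [← zero_mul (r ^ b)]
      refine Tendsto.mul_const _ ?_
      simp only [rowDist_eq]
      rw [← Finset.sum_const_zero (s := Finset.range (b + 1))]
      refine tendsto_finsetSum _ fun a _ => ?_
      simpa using ((tendsto_halfCoeff h a b).sub_const (halfCoeff (rootCoeff X) a b)).norm
    · rw [Real.norm_of_nonneg (mul_nonneg (rowDist_nonneg _ _ _) (by positivity))]
      exact rowDist_mul_pow_le hX (hY j) hr0 hr b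
  simpa using h1

/-- The index set of the energy coefficients. -/
def natEquivIci : ℕ ≃ Set.Ici (-1 : ℤ) where
  toFun j := ⟨(j : ℤ) - 1, Set.mem_Ici.mpr (by omega)⟩
  invFun b := ((b : ℤ) + 1).toNat
  left_inv j := by simp
  right_inv b := by
    have := b.2
    rw [Set.mem_Ici] at this
    ext
    simp only
    omega

lemma hasSum_energy (hX : ∀ a, ‖X a‖ ≤ 1) {φ : ℝ} (hφ : twistBound ≤ φ) :
    HasSum (fun b : Set.Ici (-1 : ℤ) => (Real.exp (-2 * (b : ℤ) * φ) : ℂ) *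
        energyCoeff X (rootCoeff X) b)
      ((Real.exp (-2 * φ) : ℂ)⁻¹ *
        ∑' j : ℕ, energyCoeff X (rootCoeff X) ((j : ℤ) - 1) * (Real.exp (-2 * φ) : ℂ) ^ j) := by
  rw [← natEquivIci.hasSum_iff]
  refine hasSum_of_forall_eq (((rootCoeff_isRootExpansion X).summable_energyTerm hX
    (norm_exp_le_of_twistBound_le hφ)).hasSum.mul_left _) fun j => ?_
  have h1 : Real.exp (-2 * (((j : ℤ) - 1 : ℤ) : ℝ) * φ) =
      (Real.exp (-2 * φ))⁻¹ * Real.exp (-2 * φ) ^ j := by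
    rw [← Real.exp_neg, ← Real.exp_nat_mul, ← Real.exp_add]
    congr 1
    push_cast
    ring
  simp only [Function.comp_apply, natEquivIci, Equiv.coe_fn_mk]
  rw [h1]
  push_cast
  ring

lemma exp_neg_two_mul_natCast (b : ℕ) (φ : ℝ) :
    Real.exp (-2 * b * φ) = Real.exp (-2 * φ) ^ b := by
  rw [← Real.exp_nat_mul]; congr 1; ring

end Limit

section Thermodynamic

variable {m : ℝ} {χ : ℝ → ℝ} {L N : ℕ → ℕ} {I : ∀ j, Fin (N j) → ℝ}

lemma HasFilling.tendsto_empiricalMoment (hm : 0 < m) (hχ : IsFirstLevelFilling m χ)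
    (h : HasFilling m χ L N I) (a : ℤ) :
    Tendsto (fun j => empiricalMoment (L j) (unitPhase (L j) (I j)) a) atTop (𝓝 (moment m χ a)) := by
  refine (h.tendsto_moment hm hχ a).congr fun j => ?_
  rw [empiricalMoment]
  simp only [unitPhase_zpow]

lemma HasFilling.norm_empiricalMoment_le (h : HasFilling m χ L N I) (j : ℕ) (a : ℤ) :
    ‖empiricalMoment (L j) (unitPhase (L j) (I j)) a‖ ≤ 1 :=
  TwistedBethe.norm_empiricalMoment_le (norm_unitPhase _ _) (h.firstLevel j).card_le a

lemma HasFilling.eventually_roots (hm : 0 < m) (hχ : IsFirstLevelFilling m χ)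
    (h : HasFilling m χ L N I) {lam : ∀ j, ℝ → Fin (N j) → ℂ}
    (hlam : ∀ j, IsTwistBranch (L j) (N j) (I j) twistBound (lam j)) {φ : ℝ} (hφ : twistBound ≤ φ)
    {ε : ℝ} (hε : 0 < ε) : ∀ᶠ j in atTop, ∀ k : Fin (N j),
      ‖lam j φ k - (Complex.I + ∑' p : ℕ × ℕ, (Real.exp (-2 * p.2 * φ) : ℂ) *
        Complex.exp (2 * Complex.I * Real.pi * ((I j k : ℂ) / L j) * p.1) *
          rootCoeff (moment m χ) p.1 p.2)‖ < ε := by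
  have hX := hχ.norm_moment_le hm
  have hr0 := (Real.exp_pos (-2 * φ)).le
  have hr := exp_le_of_twistBound_le hφ
  have hlim := tendsto_tsum_rowDist (h.tendsto_empiricalMoment hm hχ) hX h.norm_empiricalMoment_le hr0 hr
  filter_upwards [hlim.eventually (gt_mem_nhds (half_pos hε))] with j hj k
  have h1 := ((rootCoeff_isRootExpansion (moment m χ)).hasSum_rootSeries hX hr0 hr
    (norm_unitPhase (L j) (I j) k)).tsum_eq
  have h2 : ∀ p : ℕ × ℕ, (Real.exp (-2 * p.2 * φ) : ℂ) *
      Complex.exp (2 * Complex.I * Real.pi * ((I j k : ℂ) / L j) * p.1) *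
        rootCoeff (moment m χ) p.1 p.2 = (Real.exp (-2 * φ) : ℂ) ^ p.2 *
          unitPhase (L j) (I j) k ^ p.1 * rootCoeff (moment m χ) p.1 p.2 := fun p => by
    rw [exp_neg_two_mul_natCast, unitPhase, ← Complex.exp_nat_mul]
    push_cast
    rw [mul_comm (p.1 : ℂ)]
  rw [tsum_congr h2, h1, (hlam j).eqOn_branch (h.firstLevel j) (Set.mem_Ici.mpr hφ), branch]
  have h3 := norm_rootFun_sub_le hX (h.norm_empiricalMoment_le j) (norm_exp_le_of_twistBound_le hφ)
    (norm_unitPhase (L j) (I j) k).le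
  rw [Complex.norm_real, Real.norm_of_nonneg hr0] at h3
  have h4 : ∀ x y : ℂ, Complex.I - 2 * Complex.I * x - (Complex.I + -(2 * Complex.I) * y) =
      -(2 * Complex.I) * (x - y) := fun x y => by ring
  rw [h4, norm_mul, norm_neg, norm_mul, Complex.norm_I, Complex.norm_two]
  linarith

lemma HasFilling.tendsto_energy (hm : 0 < m) (hχ : IsFirstLevelFilling m χ)
    (h : HasFilling m χ L N I) {lam : ∀ j, ℝ → Fin (N j) → ℂ}
    (hlam : ∀ j, IsTwistBranch (L j) (N j) (I j) twistBound (lam j)) {φ : ℝ} (hφ : twistBound ≤ φ) :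
    Tendsto (fun j => energyPerSite (L j) (N j) (lam j φ)) atTop
      (𝓝 ((Real.exp (-2 * φ) : ℂ)⁻¹ * ∑' j : ℕ, energyCoeff (moment m χ) (rootCoeff (moment m χ))
        ((j : ℤ) - 1) * (Real.exp (-2 * φ) : ℂ) ^ j)) := by
  have ht := norm_exp_le_of_twistBound_le hφ
  have ht0 : (Real.exp (-2 * φ) : ℂ) ≠ 0 := by exact_mod_cast (Real.exp_pos _).ne'
  refine ((tendsto_tsum_energyTerm (h.tendsto_empiricalMoment hm hχ) h.norm_empiricalMoment_le
    ht).const_mul (Real.exp (-2 * φ) : ℂ)⁻¹).congr fun j => ?_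
  rw [((rootCoeff_isRootExpansion _).hasSum_energyTerm (norm_unitPhase (L j) (I j))
    (h.firstLevel j).card_le ht0 (ht.trans (by norm_num))).tsum_eq, inv_mul_cancel_left₀ ht0]
  congr 1
  exact ((hlam j).eqOn_branch (h.firstLevel j) (Set.mem_Ici.mpr hφ)).symm

end Thermodynamic

end TwistedBethe
theorem theorem1 :
    -- the recursion determines the root coefficients, for every sequence of moments
    (∀ X : ℤ → ℂ, ∃! c : ℕ → ℕ → ℂ, TwistedBethe.IsRootExpansion X c) ∧
    (∀ (X : ℤ → ℂ) (c : ℕ → ℕ → ℂ), TwistedBethe.IsRootExpansion X c →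
      c 1 1 = -2 * Complex.I ∧ ∀ a b : ℕ, b < a → c a b = 0) ∧
    -- each `f_b` is a universal polynomial in finitely many moments
    (∃ P : ℤ → MvPolynomial ℤ ℚ,
      (∀ b : ℤ, -1 ≤ b → ∀ a ∈ (P b).vars, -1 ≤ a ∧ a ≤ b + 1) ∧
      ∀ (X : ℤ → ℂ) (c : ℕ → ℕ → ℂ), TwistedBethe.IsRootExpansion X c →
        ∀ b : ℤ, -1 ≤ b → TwistedBethe.energyCoeff X c b = MvPolynomial.aeval X (P b)) ∧
    -- the expansion of the thermodynamic energy
    (∀ (m : ℝ) (χ : ℝ → ℝ), 0 < m → TwistedBethe.IsFirstLevelFilling m χ →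
      ∀ c : ℕ → ℕ → ℂ, TwistedBethe.IsRootExpansion (TwistedBethe.moment m χ) c →
      -- the moments are the limits of the empirical moments of the Bethe numbers
      (∀ (L N : ℕ → ℕ) (I : ∀ j, Fin (N j) → ℝ), TwistedBethe.HasFilling m χ L N I →
        ∀ a : ℤ, Tendsto
          (fun j => 1 / (L j : ℂ) *
            ∑ k, Complex.exp (2 * Complex.I * Real.pi * a * ((I j k : ℂ) / L j)))
          atTop (𝓝 (TwistedBethe.moment m χ a))) ∧
      ∃ φ₀ : ℝ, 0 ≤ φ₀ ∧
        -- existence and uniqueness of the branch of solutions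
        (∀ (L N : ℕ) (I : Fin N → ℝ), TwistedBethe.IsFirstLevelBetheNumbers L N I →
          ∃ lam : ℝ → Fin N → ℂ, TwistedBethe.IsTwistBranch L N I φ₀ lam ∧
            ∀ lam' : ℝ → Fin N → ℂ, TwistedBethe.IsTwistBranch L N I φ₀ lam' →
              Set.EqOn lam' lam (Set.Ici φ₀)) ∧
        -- the root expansion converges and describes the roots in the thermodynamic limit
        (∀ φ : ℝ, φ₀ ≤ φ →
          Summable (fun p : ℕ × ℕ => Real.exp (-2 * p.2 * φ) * ‖c p.1 p.2‖)) ∧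
        (∀ (L N : ℕ → ℕ) (I : ∀ j, Fin (N j) → ℝ) (lam : ∀ j, ℝ → Fin (N j) → ℂ),
          TwistedBethe.HasFilling m χ L N I →
          (∀ j, TwistedBethe.IsTwistBranch (L j) (N j) (I j) φ₀ (lam j)) →
          ∀ φ : ℝ, φ₀ ≤ φ → ∀ ε : ℝ, 0 < ε → ∀ᶠ j in atTop, ∀ k : Fin (N j),
            ‖lam j φ k - (Complex.I + ∑' p : ℕ × ℕ, (Real.exp (-2 * p.2 * φ) : ℂ) *
              Complex.exp (2 * Complex.I * Real.pi * ((I j k : ℂ) / L j) * p.1) *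
              c p.1 p.2)‖ < ε) ∧
        -- the thermodynamic energy `F` exists and has the stated expansion
        ∃ F : ℝ → ℂ,
          (∀ (L N : ℕ → ℕ) (I : ∀ j, Fin (N j) → ℝ) (lam : ∀ j, ℝ → Fin (N j) → ℂ),
            TwistedBethe.HasFilling m χ L N I →
            (∀ j, TwistedBethe.IsTwistBranch (L j) (N j) (I j) φ₀ (lam j)) →
            ∀ φ : ℝ, φ₀ ≤ φ →
              Tendsto (fun j => TwistedBethe.energyPerSite (L j) (N j) (lam j φ))
                atTop (𝓝 (F φ))) ∧
          ∀ φ : ℝ, φ₀ ≤ φ →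
            HasSum (fun b : Set.Ici (-1 : ℤ) =>
              (Real.exp (-2 * (b : ℤ) * φ) : ℂ) *
                TwistedBethe.energyCoeff (TwistedBethe.moment m χ) c b) (F φ)) := by
  refine ⟨fun X => ⟨TwistedBethe.rootCoeff X, TwistedBethe.rootCoeff_isRootExpansion X,
    fun c hc => hc.eq_rootCoeff⟩, fun X c hc => ⟨hc.one_one, hc.support⟩,
    TwistedBethe.exists_energy_polynomial, fun m χ hm hχ c hc => ?_⟩
  obtain rfl := hc.eq_rootCoeff
  have hX := hχ.norm_moment_le hm
  refine ⟨fun L N I h => h.tendsto_moment hm hχ, TwistedBethe.twistBound,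
    TwistedBethe.twistBound_nonneg, fun L N I hI => ⟨TwistedBethe.branch L I, hI.isTwistBranch,
      fun lam' h => h.eqOn_branch hI⟩, fun φ hφ => ?_, fun L N I lam h hlam φ hφ ε hε =>
        h.eventually_roots hm hχ hlam hφ hε, _, fun L N I lam h hlam φ hφ =>
          h.tendsto_energy hm hχ hlam hφ, fun φ hφ => TwistedBethe.hasSum_energy hX hφ⟩
  refine (hc.summable_rootSeries hX (Real.exp_pos (-2 * φ)).le
    (TwistedBethe.exp_le_of_twistBound_le hφ)).congr fun p => ?_
  rw [TwistedBethe.exp_neg_two_mul_natCast]
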